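/- **Proposition 1.8.** Let $S\subset\mathbb R^3$ be a smooth embedded hypersurface with surface measure $\sigma$, let $x^0\in S$, let $T_{x^0}S$ be the tangent space of $S$ at $x^0$, and let $d_{T,x^0}(x)=\operatorname{dist}(x^0+T_{x^0}S,\,x)$ be the distance from $x$ to the affine tangent plane of $S$ at $x^0$. Apply a Euclidean motion after which $x^0=(0,0,1)$ and $S$ is, near $x^0$, the graph of $1+\phi$, where $\phi$ is a smooth function defined near the origin of $\mathbb R^2$ with $\phi(0)=0$ and $\nabla\phi(0)=0$. The height $h(x^0,S)\in(0,\infty]$ is defined as $h(\phi)=\sup_y d_y$, where the supremum is taken over all smooth local coordinate systems $y$ at the origin (preserving $0$), and $d_y$ is the Newton distance of $\phi$ expressed in the coordinates $y$, as follows: if $\sum_{j,k} c_{jk}\,y_1^jy_2^k$ is the Taylor series of $\phi$ at the origin in these coordinates, and $\mathcal N$ is the convex hull of the union of the quadrants $(j,k)+[0,\infty)^2$ over all $(j,k)$ with $c_{jk}\neq 0$, then $d_y$ is the coordinate $d$ of the point $(d,d)$ at which the line $t_1=t_2$ enters $\mathcal N$ ($d_y=\infty$ if $\mathcal N=\emptyset$).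 The number $h(x^0,S)$ does not depend on the choice of the motion. Then, for every real $p$ with $0<p<h(x^0,S)$, $$\int_{S\cap U} d_{T,x^0}(x)^{-1/p}\,d\sigma(x)=\infty\qquad\text{for every neighborhood } U \text{ of } x^0,$$ where $0^{-1/p}=\infty$. Moreover, if $S$ is real analytic near $x^0$ and $h(x^0,S)<\infty$, then this also holds for $p=h(x^0,S)$. -/

import Mathlib

open Set Filter Topology MeasureTheory
open scoped NNReal ENNReal ContDiff

namespace SurfaceHeight

/-- The Euclidean plane. -/
abbrev E2 : Type := EuclideanSpace ℝ (Fin 2)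

/-- Euclidean three-space. -/
abbrev E3 : Type := EuclideanSpace ℝ (Fin 3)

/-- `f` is of class `C^n` on some neighbourhood of `x` (`n = ∞`: smooth, `n = ω`: real analytic). -/
def ContDiffNear {E F : Type*} [NormedAddCommGroup E] [NormedSpace ℝ E]
    [NormedAddCommGroup F] [NormedSpace ℝ F] (n : WithTop ℕ∞) (f : E → F) (x : E) : Prop :=
  ∀ᶠ y in 𝓝 x, ContDiffAt ℝ n f y

/-! ### Newton polyhedra and the height of a function of two variables -/

/-- The Taylor coefficient `c_{jk} = ∂₁^j ∂₂^k φ(0) / (j! k!)`. -/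
noncomputable def taylorCoeff (φ : E2 → ℝ) (j k : ℕ) : ℝ :=
  iteratedFDeriv ℝ (j + k) φ 0
    (Fin.append (fun _ : Fin j => EuclideanSpace.single (0 : Fin 2) (1 : ℝ))
      (fun _ : Fin k => EuclideanSpace.single (1 : Fin 2) (1 : ℝ))) / ((j.factorial : ℝ) * (k.factorial : ℝ))

/-- The Taylor support of `φ` at the origin. -/
def taylorSupport (φ : E2 → ℝ) : Set (ℕ × ℕ) :=
  {m | taylorCoeff φ m.1 m.2 ≠ 0}

/-- The Newton polyhedron of `φ` at the origin: the convex hull of the union of the quadrants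
`(j, k) + ℝ₊²` over the points `(j, k)` of the Taylor support. -/
def newtonPolyhedron (φ : E2 → ℝ) : Set (ℝ × ℝ) :=
  convexHull ℝ (⋃ m ∈ taylorSupport φ, {t : ℝ × ℝ | (m.1 : ℝ) ≤ t.1 ∧ (m.2 : ℝ) ≤ t.2})

/-- The Newton distance of `φ`: the coordinate `d` of the point `(d, d)` at which the bisectrix
enters the Newton polyhedron. The polyhedron is closed, lies in the first quadrant and is stable
under adding vectors with nonnegative entries, so that it meets the bisectrix in the half-line
starting at `(d, d)`. For a flat `φ` (empty Newton polyhedron) the value is `∞`. -/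
noncomputable def newtonDistance (φ : E2 → ℝ) : ℝ≥0∞ :=
  ⨅ (d : ℝ≥0) (_ : ((d : ℝ), (d : ℝ)) ∈ newtonPolyhedron φ), (d : ℝ≥0∞)

/-- `ψ` expresses the old coordinates through the coordinates of a smooth local coordinate system
at the origin: it is smooth near `0`, fixes `0`, and its derivative at `0` is invertible. -/
def IsLocalCoordinateChange (ψ : E2 → E2) : Prop :=
  ContDiffNear ∞ ψ 0 ∧ ψ 0 = 0 ∧ ∃ A : E2 ≃L[ℝ] E2, HasFDerivAt ψ (A : E2 →L[ℝ] E2) 0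

/-- The height `h(φ)` of `φ` at the origin: the supremum of the Newton distances of `φ` expressed
in all smooth local coordinate systems at the origin. -/
noncomputable def height (φ : E2 → ℝ) : ℝ≥0∞ :=
  ⨆ (ψ : E2 → E2) (_ : IsLocalCoordinateChange ψ), newtonDistance (φ ∘ ψ)

/-! ### Hypersurfaces in three-space -/

/-- Near `x`, the set `S` is an embedded hypersurface of class `C^n`, i.e. the zero set of a
function of class `C^n` with nonvanishing derivative. -/
def IsHypersurfaceNear (n : WithTop ℕ∞) (S : Set E3) (x : E3) : Prop :=
  ∃ f : E3 → ℝ, ContDiffNear n f x ∧ fderiv ℝ f x ≠ 0 ∧ ∀ᶠ y in 𝓝 x, (y ∈ S ↔ f y = 0)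

/-- `S` is a smooth (embedded) hypersurface in three-space. -/
def IsSmoothHypersurface (S : Set E3) : Prop :=
  ∀ x ∈ S, IsHypersurfaceNear ∞ S x

/-- The tangent space `T_x S`: the velocities at `x` of smooth curves in `S` through `x`. -/
def tangentSpaceAt (S : Set E3) (x : E3) : Set E3 :=
  {v | ∃ γ : ℝ → E3, ContDiffNear ∞ γ 0 ∧ γ 0 = x ∧ (∀ᶠ t in 𝓝 (0 : ℝ), γ t ∈ S) ∧
    HasDerivAt γ v 0}

/-- The distance `d_{T,x₀}(x)` from `x` to the affine tangent plane `x₀ + T_{x₀} S`. -/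
noncomputable def tangentPlaneDist (S : Set E3) (x₀ x : E3) : ℝ≥0∞ :=
  Metric.infEDist x ((fun v => x₀ + v) '' tangentSpaceAt S x₀)

/-- After a Euclidean motion taking `x₀` to `(0, 0, 1)`, the surface `S` is near that point the
graph of `1 + φ`, with `φ` smooth near the origin, `φ(0) = 0` and `∇φ(0) = 0` (so that the motion
takes the tangent space at `x₀` to the horizontal plane). -/
def IsGraphRepresentation (S : Set E3) (x₀ : E3) (φ : E2 → ℝ) : Prop :=
  ContDiffNear ∞ φ 0 ∧ φ 0 = 0 ∧ fderiv ℝ φ 0 = 0 ∧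
    ∃ M : E3 ≃ᵃⁱ[ℝ] E3, M x₀ = !₂[0, 0, 1] ∧
      ∀ᶠ y in 𝓝 (!₂[0, 0, 1] : E3), (y ∈ M '' S ↔ y 2 = 1 + φ !₂[y 0, y 1])

/-- The height `h(x₀, S)`: the height of a function `φ` representing `S` near `x₀` as above. The
choice of `φ` is immaterial: two choices differ by a sign and a linear isometry of the plane, which
do not change the height, so the supremum below is the common value. -/
noncomputable def surfaceHeight (S : Set E3) (x₀ : E3) : ℝ≥0∞ :=
  ⨆ (φ : E2 → ℝ) (_ : IsGraphRepresentation S x₀ φ), height φ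

end SurfaceHeight

namespace SurfaceHeight

attribute [local fun_prop] analyticAt_fst analyticAt_snd

/-! ### Bivariate expansions of multilinear maps -/

/-! Over its tangent plane the surface is the graph of `φ`, and the distance to the tangent plane is
`|φ|`. The orthogonal projection is 1-Lipschitz and the graph map is locally Lipschitz, so near `x₀`
the surface integral and the planar integral of `|φ| ^ (-1 / p)` are finite together
(`exists_lintegral_le`, `exists_lintegral_ge`).

Below the height, some coordinates have Newton distance greater than `p`. A line separating the
Newton polyhedron from the part of the bisectrix below it gives weights `κ₀, κ₁ > 0` with `(κ₀ + κ₁)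
* p < 1` such that every Taylor exponent has weight at least `1` (`exists_separating_weight`). On
the box `|x₀| ≤ δ ^ κ₀`, `|x₁| ≤ δ ^ κ₁` the function is then `O(δ)` (`exists_bound_on_weightBox`).
The box has area `4 * δ ^ (κ₀ + κ₁)`, so the integral is at least a constant times `δ ^ (κ₀ + κ₁ - 1
/ p)`, which is unbounded as `δ → 0`.

At the height, in the analytic case, the key is openness: the exponents `α` for which `|φ| ^ (-α)`
is integrable near `0` form an open set (`eventually_lintegral_rpow_lt_top`). Finiteness at `1 / h`
would give finiteness at some `r > 1 / h`, which the first part excludes since `1 / r < h`.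

Openness is `FiniteNear.stable`, an elementary resolution of singularities. The densities `x ^ β *
|F| ^ (-a)` on a half-plane form a class preserved by shears and weighted blow-ups, with `(β, a)`
changing continuously. Induction is on the order `m + 1` of `F` in `y`. A Tschirnhaus shear removes
the `y ^ m` term. Either a monomial times a unit remains, where integrability is an explicit open
condition, or a blow-up adapted to the Newton polygon makes every order along the exceptional line
at most `m`. Compactness of a segment of that line and two monomial charts then cover a
half-neighbourhood. -/

theorem multilinear_apply_smul_add_smul {E : Type*} [AddCommGroup E] [Module ℝ E] {n : ℕ}
    (p : MultilinearMap ℝ (fun _ : Fin n => E) ℝ) (x y : ℝ) (e e' : E) :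
    p (fun _ => x • e + y • e') =
      ∑ s : Finset (Fin n), x ^ s.card * y ^ (n - s.card) *
        p (s.piecewise (fun _ => e) (fun _ => e')) := by
  have h := p.map_add_univ (fun _ => x • e) (fun _ => y • e')
  rw [show (fun _ : Fin n => x • e + y • e') = (fun _ => x • e) + (fun _ => y • e') from rfl, h]
  refine Finset.sum_congr rfl fun s _ => ?_
  have h2 := p.map_smul_univ (s.piecewise (fun _ => x) (fun _ => y))
    (s.piecewise (fun _ => e) (fun _ => e'))
  have h3 : (fun i => (s.piecewise (fun _ => x) (fun _ => y)) i •
      (s.piecewise (fun _ => e) (fun _ => e')) i) =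
      s.piecewise (fun _ => x • e) (fun _ => y • e') := by
    funext i
    by_cases hi : i ∈ s <;> simp [hi]
  rw [h3] at h2
  rw [h2, Finset.prod_piecewise]
  simp [Finset.card_univ_sdiff]

/-- The monomial `x ^ j * y ^ (n - j)` as a multilinear map in `n` arguments. -/
noncomputable def monomialMap (n j : ℕ) : (ℝ × ℝ) [×n]→L[ℝ] ℝ :=
  (ContinuousMultilinearMap.mkPiAlgebra ℝ (Fin n) ℝ).compContinuousLinearMap
    (fun i => if i.val < j then ContinuousLinearMap.fst ℝ ℝ ℝ else ContinuousLinearMap.snd ℝ ℝ ℝ)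

theorem norm_monomialMap_le (n j : ℕ) : ‖monomialMap n j‖ ≤ 1 := by
  refine (ContinuousMultilinearMap.norm_compContinuousLinearMap_le _ _).trans ?_
  rw [ContinuousMultilinearMap.norm_mkPiAlgebra, one_mul]
  refine Finset.prod_le_one (fun _ _ => norm_nonneg _) fun i _ => ?_
  split_ifs
  · exact ContinuousLinearMap.norm_fst_le ..
  · exact ContinuousLinearMap.norm_snd_le ..

theorem monomialMap_apply_diag {n j : ℕ} (hj : j ≤ n) (v : ℝ × ℝ) :
    monomialMap n j (fun _ => v) = v.1 ^ j * v.2 ^ (n - j) := by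
  have : monomialMap n j (fun _ => v) = ∏ i : Fin n, (if i.val < j then v.1 else v.2) := by
    simp only [monomialMap, ContinuousMultilinearMap.compContinuousLinearMap_apply,
      ContinuousMultilinearMap.mkPiAlgebra_apply]
    refine Finset.prod_congr rfl fun i _ => ?_
    split_ifs <;> rfl
  rw [this, Fin.prod_univ_eq_prod_range (fun i => if i < j then v.1 else v.2) n,
    ← Finset.prod_range_mul_prod_Ico _ hj, Finset.prod_congr rfl (g := fun _ => v.1),
    Finset.prod_congr (s₁ := Finset.Ico j n) rfl (g := fun _ => v.2)]
  · simp
  · intro i hi; simp at hi; simp; omega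
  · intro i hi; simp at hi; simp [hi]

/-- Hadamard's lemma in the analytic category. -/
theorem exists_analyticAt_eq_add_mul {F : ℝ × ℝ → ℝ} (hF : AnalyticAt ℝ F (0, 0)) :
    ∃ G : ℝ × ℝ → ℝ, AnalyticAt ℝ G (0, 0) ∧
      ∀ᶠ v in 𝓝 ((0, 0) : ℝ × ℝ), F v = F (v.1, 0) + v.2 * G v := by
  obtain ⟨p, r, hp⟩ := hF
  obtain ⟨ρ, hρ0, hρr⟩ := ENNReal.lt_iff_exists_nnreal_btwn.1 hp.r_pos
  have hρpos : (0 : ℝ) < ρ := by exact_mod_cast hρ0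
  obtain ⟨C, hC, hCb⟩ := p.norm_mul_pow_le_of_lt_radius (hρr.trans_le hp.r_le)
  let e : (n : ℕ) → Finset (Fin n) → Fin n → ℝ × ℝ := fun n s =>
    s.piecewise (fun _ => ((1, 0) : ℝ × ℝ)) (fun _ => ((0, 1) : ℝ × ℝ))
  have he : ∀ n s, |p n (e n s)| ≤ ‖p n‖ := by
    intro n s
    refine ((p n).le_opNorm _).trans (mul_le_of_le_one_right (norm_nonneg _) ?_)
    refine Finset.prod_le_one (fun _ _ => norm_nonneg _) fun i _ => ?_
    by_cases hi : i ∈ s <;> simp [e, hi, Prod.norm_def]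
  -- The subset `s` marks the slots holding `(1, 0)` and stands for `x ^ |s| * y ^ (n + 1 - |s|)`.
  -- The full subset gives the pure power of `x`, which cancels in `F v - F (v.1, 0)`; every other
  -- term is divided by `y`.
  let q : FormalMultilinearSeries ℝ (ℝ × ℝ) ℝ := fun n =>
    ∑ s ∈ (Finset.univ : Finset (Finset (Fin (n + 1)))).erase Finset.univ,
      (p (n + 1) (e (n + 1) s)) • monomialMap n s.card
  have hqn : ∀ n, ‖q n‖ ≤ 2 ^ (n + 1) * ‖p (n + 1)‖ := by
    intro n
    refine (norm_sum_le _ _).trans ?_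
    have : ∀ s ∈ (Finset.univ : Finset (Finset (Fin (n + 1)))).erase Finset.univ,
        ‖(p (n + 1) (e (n + 1) s)) • monomialMap n s.card‖ ≤ ‖p (n + 1)‖ := by
      intro s _
      rw [norm_smul]
      exact (mul_le_of_le_one_right (norm_nonneg _) (norm_monomialMap_le _ _)).trans (he _ _)
    refine (Finset.sum_le_card_nsmul _ _ _ this).trans ?_
    rw [nsmul_eq_mul]
    gcongr
    have h2 := Finset.card_erase_le (s := (Finset.univ : Finset (Finset (Fin (n + 1)))))
      (a := Finset.univ)
    simp only [Finset.card_univ, Fintype.card_finset, Fintype.card_fin] at h2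
    exact_mod_cast h2
  -- The factor `2 ^ (n + 1)`, the number of subsets, costs half of the radius.
  have hqr : ((ρ / 2 : ℝ≥0) : ℝ≥0∞) ≤ q.radius := by
    refine q.le_radius_of_bound (2 * C / ρ) fun n => ?_
    have h1 := hCb (n + 1)
    calc ‖q n‖ * ((ρ / 2 : ℝ≥0) : ℝ) ^ n
        ≤ (2 ^ (n + 1) * ‖p (n + 1)‖) * ((ρ / 2 : ℝ≥0) : ℝ) ^ n := by gcongr; exact hqn n
      _ = 2 * (‖p (n + 1)‖ * ρ ^ (n + 1)) / ρ := by
        push_cast; rw [div_pow]; field_simp; ring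
      _ ≤ 2 * C / ρ := by gcongr
  have hq0 : 0 < q.radius := lt_of_lt_of_le (by
    have : 0 < ρ := by exact_mod_cast hρpos
    exact_mod_cast half_pos this) hqr
  have hG := q.hasFPowerSeriesOnBall hq0
  refine ⟨q.sum, ⟨q, _, hG⟩, ?_⟩
  have hball1 : Metric.eball (0 : ℝ × ℝ) r ∈ 𝓝 ((0, 0) : ℝ × ℝ) := Metric.eball_mem_nhds _ hp.r_pos
  have hball2 : Metric.eball (0 : ℝ × ℝ) q.radius ∈ 𝓝 ((0, 0) : ℝ × ℝ) :=
    Metric.eball_mem_nhds _ hq0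
  have hcont : Tendsto (fun v : ℝ × ℝ => (v.1, (0 : ℝ))) (𝓝 ((0, 0) : ℝ × ℝ)) (𝓝 (0, 0)) := by
    have : Continuous (fun v : ℝ × ℝ => (v.1, (0 : ℝ))) := by fun_prop
    exact this.tendsto' _ _ rfl
  filter_upwards [hball1, hball2, hcont.eventually hball1] with v hv1 hv2 hv3
  have s1 := hp.hasSum hv1
  have s2 := hG.hasSum hv2
  have s3 := hp.hasSum hv3
  simp only [Prod.mk_zero_zero, zero_add] at s1 s2 s3
  have s4 := (hasSum_nat_add_iff' 1).2 (s1.sub s3)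
  have key : ∀ n, p (n + 1) (fun _ => v) - p (n + 1) (fun _ => (v.1, 0)) =
      v.2 * q n (fun _ => v) := by
    intro n
    have ex : ∀ x y : ℝ, p (n + 1) (fun _ => (x, y)) = ∑ s : Finset (Fin (n + 1)),
        x ^ s.card * y ^ (n + 1 - s.card) * p (n + 1) (e (n + 1) s) := by
      intro x y
      have := multilinear_apply_smul_add_smul (p (n + 1)).toMultilinearMap x y (1, 0) (0, 1)
      simpa using this
    rw [show v = (v.1, v.2) from rfl, ex, ex, ← Finset.sum_sub_distrib,
      ← Finset.add_sum_erase _ _ (Finset.mem_univ (Finset.univ : Finset (Fin (n + 1))))]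
    simp only [Finset.card_univ, Fintype.card_fin, tsub_self, pow_zero, sub_self, zero_add]
    simp only [q, sum_apply, smul_apply,
      Finset.mul_sum]
    refine Finset.sum_congr rfl fun s hs => ?_
    have hs' : s.card < n + 1 := by
      have h := Finset.card_lt_card (Finset.ssubset_univ_iff.2 (Finset.ne_of_mem_erase hs))
      simpa using h
    rw [monomialMap_apply_diag (by omega)]
    obtain ⟨d, hd⟩ : ∃ d, n = s.card + d := ⟨n - s.card, by omega⟩
    have e1 : n + 1 - s.card = d + 1 := by omega
    have e2 : n - s.card = d := by omega
    rw [e1, e2]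
    simp only [smul_eq_mul, ne_eq, Nat.add_eq_zero_iff, one_ne_zero, and_false, not_false_eq_true,
      zero_pow]
    ring
  have s5 := s2.mul_left v.2
  simp only [key] at s4
  have := s4.unique s5
  have h0 : p 0 (fun _ => v) = p 0 (fun _ => (v.1, 0)) := by congr 1; funext i; exact i.elim0
  simp [h0] at this
  linarith

/-- Taylor expansion with analytic coefficients in the second variable. -/
theorem exists_analyticAt_taylor_snd {F : ℝ × ℝ → ℝ} (hF : AnalyticAt ℝ F (0, 0)) (m : ℕ) :
    ∃ (a : ℕ → ℝ → ℝ) (u : ℝ × ℝ → ℝ), (∀ k, AnalyticAt ℝ (a k) 0) ∧ AnalyticAt ℝ u (0, 0) ∧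
      ∀ᶠ v in 𝓝 ((0, 0) : ℝ × ℝ),
        F v = ∑ k ∈ Finset.range m, a k v.1 * v.2 ^ k + v.2 ^ m * u v := by
  induction m with
  | zero => exact ⟨fun _ _ => 0, F, fun _ => analyticAt_const, hF, by simp⟩
  | succ m ih =>
    obtain ⟨a, u, ha, hu, h⟩ := ih
    obtain ⟨w, hw, h2⟩ := exists_analyticAt_eq_add_mul hu
    refine ⟨Function.update a m (fun x => u (x, 0)), w, fun k => ?_, hw, ?_⟩
    · by_cases hk : k = m
      · subst hk
        rw [Function.update_self]
        exact AnalyticAt.fun_comp (f := fun x : ℝ => (x, (0 : ℝ))) (x := (0 : ℝ)) hu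
          (by fun_prop)
      · rw [Function.update_of_ne hk]; exact ha k
    · filter_upwards [h, h2] with v h h2
      rw [h, h2, Finset.sum_range_succ, Function.update_self]
      have : ∀ k ∈ Finset.range m,
          Function.update a m (fun x => u (x, 0)) k v.1 * v.2 ^ k = a k v.1 * v.2 ^ k := by
        intro k hk
        rw [Function.update_of_ne (Finset.mem_range.1 hk).ne]
      rw [Finset.sum_congr rfl this]
      ring

/-! ### Analytic functions of two variables, regular in the second variable -/

/-- The analytic order of a nonzero polynomial at a point is its root multiplicity there. -/
theorem pow_dvd_of_le_analyticOrderAt {P : Polynomial ℝ} {z : ℝ} {m : ℕ}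
    (h : (m : ℕ∞) ≤ analyticOrderAt (fun y => P.eval y) z) :
    (Polynomial.X - Polynomial.C z) ^ m ∣ P := by
  by_cases hP : P = 0
  · simp [hP]
  obtain ⟨q, hq, hqd⟩ := Polynomial.exists_eq_pow_rootMultiplicity_mul_and_not_dvd P hP z
  have han : ∀ R : Polynomial ℝ, AnalyticAt ℝ (fun y => R.eval y) z := fun R =>
    AnalyticOnNhd.eval_polynomial R z (mem_univ z)
  have h2 : analyticOrderAt (fun y => P.eval y) z = (P.rootMultiplicity z : ℕ) := by
    rw [(han P).analyticOrderAt_eq_natCast]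
    refine ⟨fun y => q.eval y, han q, ?_, ?_⟩
    · rwa [Polynomial.dvd_iff_isRoot] at hqd
    · refine Eventually.of_forall fun y => ?_
      conv_lhs => rw [hq]
      simp
  rw [h2] at h
  exact (pow_dvd_pow _ (by exact_mod_cast h)).trans (Polynomial.pow_rootMultiplicity_dvd P z)

/-- Subtracting `y ^ m * u` from `f` leaves a polynomial of degree below `m` that vanishes to order
at least `m`, hence zero. If `u 0` vanished too, the order of `f` would exceed `m`. -/
theorem analyticOrderAt_taylor_coeff {f : ℝ → ℝ} {m : ℕ} {c : ℕ → ℝ} {u : ℝ → ℝ}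
    (hu : AnalyticAt ℝ u 0) (hf : ∀ᶠ y in 𝓝 0, f y = ∑ k ∈ Finset.range m, c k * y ^ k + y ^ m * u y)
    (hord : analyticOrderAt f 0 = m) : (∀ k < m, c k = 0) ∧ u 0 ≠ 0 := by
  have hfa : AnalyticAt ℝ f 0 := by
    -- A function that is not analytic has order `0` by convention; then `m = 0` and the expansion
    -- reads `f = u`.
    by_contra hn
    have hm : m = 0 := by
      have h0 := analyticOrderAt_of_not_analyticAt hn
      rw [hord] at h0
      exact_mod_cast h0
    subst hm
    exact hn (hu.congr (hf.mono fun y hy => by simpa using hy.symm))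
  obtain ⟨g, hg, hg0, hfg⟩ := hfa.analyticOrderAt_eq_natCast.1 hord
  let P : Polynomial ℝ := ∑ k ∈ Finset.range m, Polynomial.monomial k (c k)
  have hPc : ∀ k < m, P.coeff k = c k := by
    intro k hk
    simp [P, Polynomial.coeff_monomial, hk]
  have hPe : ∀ y, P.eval y = ∑ k ∈ Finset.range m, c k * y ^ k := by
    intro y; simp [P, Polynomial.eval_finsetSum]
  have hPa : AnalyticAt ℝ (fun y => P.eval y) 0 :=
    AnalyticOnNhd.eval_polynomial P 0 (mem_univ 0)
  have hle : (m : ℕ∞) ≤ analyticOrderAt (fun y => P.eval y) 0 := by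
    rw [natCast_le_analyticOrderAt hPa]
    refine ⟨fun y => g y - u y, hg.sub hu, ?_⟩
    filter_upwards [hf, hfg] with y h1 h2
    rw [hPe]
    simp only [smul_eq_mul, sub_zero] at h2 ⊢
    linarith
  have hdvd := pow_dvd_of_le_analyticOrderAt hle
  simp only [map_zero, sub_zero] at hdvd
  have hc : ∀ k < m, c k = 0 := fun k hk => by
    rw [← hPc k hk]; exact Polynomial.X_pow_dvd_iff.1 hdvd k hk
  refine ⟨hc, fun hu0 => ?_⟩
  have h1 : (1 : ℕ) ≤ analyticOrderAt u 0 := by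
    rw [Nat.cast_one, Order.one_le_iff_ne_zero]
    exact hu.analyticOrderAt_ne_zero.2 hu0
  obtain ⟨w, hw, huw⟩ := (natCast_le_analyticOrderAt hu).1 h1
  have : ((m + 1 : ℕ) : ℕ∞) ≤ analyticOrderAt f 0 := by
    rw [natCast_le_analyticOrderAt hfa]
    refine ⟨w, hw, ?_⟩
    filter_upwards [hf, huw] with y h1 h2
    rw [h1, h2, Finset.sum_eq_zero fun k hk => by rw [hc k (Finset.mem_range.1 hk), zero_mul]]
    simp only [sub_zero, smul_eq_mul]; ring
  rw [hord] at this
  exact absurd (by exact_mod_cast this : m + 1 ≤ m) (by omega)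

/-- The partial derivative in the second variable. -/
noncomputable def partialSnd (F : ℝ × ℝ → ℝ) (v : ℝ × ℝ) : ℝ := deriv (fun y => F (v.1, y)) v.2

theorem partialSnd_shear (F : ℝ × ℝ → ℝ) (ψ : ℝ → ℝ) :
    partialSnd (fun v => F (v.1, ψ v.1 + v.2)) = fun v => partialSnd F (v.1, ψ v.1 + v.2) := by
  funext v
  exact deriv_comp_const_add (f := fun y => F (v.1, y)) (ψ v.1) v.2

/-- Lets the coefficient of `y ^ n` after a shear be read off from the derivative of the original
function along the curve `y = ψ x`. -/
theorem iterate_partialSnd_shear (F : ℝ × ℝ → ℝ) (ψ : ℝ → ℝ) (n : ℕ) :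
    partialSnd^[n] (fun v => F (v.1, ψ v.1 + v.2)) =
      fun v => (partialSnd^[n] F) (v.1, ψ v.1 + v.2) := by
  induction n generalizing F with
  | zero => rfl
  | succ n ih => rw [Function.iterate_succ_apply, partialSnd_shear, ih, Function.iterate_succ_apply]

theorem partialSnd_eq_fderiv {F : ℝ × ℝ → ℝ} {v : ℝ × ℝ} (h : DifferentiableAt ℝ F v) :
    partialSnd F v = fderiv ℝ F v (0, 1) := by
  have h1 : HasDerivAt (fun y : ℝ => (v.1, y)) ((0 : ℝ), (1 : ℝ)) v.2 :=
    (hasDerivAt_const _ _).prodMk (hasDerivAt_id _)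
  exact (h.hasFDerivAt.comp_hasDerivAt (x := v.2) (f := fun y : ℝ => (v.1, y)) h1).deriv

theorem analyticAt_partialSnd {F : ℝ × ℝ → ℝ} {v : ℝ × ℝ} (h : AnalyticAt ℝ F v) :
    AnalyticAt ℝ (partialSnd F) v := by
  have h1 : AnalyticAt ℝ (fun w => fderiv ℝ F w (0, 1)) v := by
    exact ((ContinuousLinearMap.apply ℝ ℝ ((0 : ℝ), (1 : ℝ))).analyticAt _).comp h.fderiv
  exact h1.congr (h.eventually_analyticAt.mono fun w hw =>
    (partialSnd_eq_fderiv hw.differentiableAt).symm)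

theorem partialSnd_congr {F G : ℝ × ℝ → ℝ} {v : ℝ × ℝ} (h : F =ᶠ[𝓝 v] G) :
    partialSnd F v = partialSnd G v := by
  refine Filter.EventuallyEq.deriv_eq ?_
  have hc : Tendsto (fun y : ℝ => (v.1, y)) (𝓝 v.2) (𝓝 v) :=
    (by fun_prop : Continuous fun y : ℝ => (v.1, y)).tendsto' _ _ rfl
  exact hc.eventually h

/-- This form yields both facts needed about the `m`-th derivative: its value on `y = 0` is `m! * a
m`, and its `y`-derivative at the origin is `w (0, 0)`, nonzero exactly when `u (0, 0)` is. -/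
theorem iterate_partialSnd_expansion (m : ℕ) {F : ℝ × ℝ → ℝ} {a : ℕ → ℝ → ℝ} {u : ℝ × ℝ → ℝ}
    (hu : AnalyticAt ℝ u (0, 0))
    (hF : ∀ᶠ v in 𝓝 ((0, 0) : ℝ × ℝ),
      F v = ∑ k ∈ Finset.range (m + 1), a k v.1 * v.2 ^ k + v.2 ^ (m + 1) * u v) :
    ∃ w : ℝ × ℝ → ℝ, AnalyticAt ℝ w (0, 0) ∧ w (0, 0) = (m + 1).factorial * u (0, 0) ∧
      ∀ᶠ v in 𝓝 ((0, 0) : ℝ × ℝ),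
        (partialSnd^[m] F) v = m.factorial * a m v.1 + v.2 * w v := by
  induction m generalizing F a u with
  | zero => exact ⟨u, hu, by simp, hF.mono fun v hv => by simpa using hv⟩
  | succ m ih =>
    have hDu := analyticAt_partialSnd hu
    -- One derivative turns the remainder `y ^ (m + 2) * u` into `y ^ (m + 1)` times this function,
    -- whose value at the origin is `(m + 2) * u (0, 0)`; these factors build up the factorial.
    have hanalytic : AnalyticAt ℝ (fun v : ℝ × ℝ => ((m : ℝ) + 2) * u v + v.2 * partialSnd u v)
        (0, 0) := by fun_prop
    obtain ⟨w, hw, hw0, h⟩ := ih (F := partialSnd F) (a := fun k x => (k + 1) * a (k + 1) x)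
      hanalytic (by
        filter_upwards [hF.eventually_nhds, hu.eventually_analyticAt] with v hv huv
        rw [partialSnd_congr hv]
        have h1 : HasDerivAt (fun y => u (v.1, y)) (partialSnd u v) v.2 := by
          refine DifferentiableAt.hasDerivAt ?_
          exact DifferentiableAt.comp (g := u) (f := fun y : ℝ => (v.1, y)) v.2
            huv.differentiableAt (by fun_prop)
        have h2 : HasDerivAt (fun y : ℝ => ∑ k ∈ Finset.range (m + 1 + 1), a k v.1 * y ^ k +
            y ^ (m + 1 + 1) * u (v.1, y))
            (∑ k ∈ Finset.range (m + 1 + 1), a k v.1 * (k * v.2 ^ (k - 1)) +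
              (((m + 1 + 1 : ℕ) * v.2 ^ (m + 1)) * u (v.1, v.2) +
                v.2 ^ (m + 1 + 1) * partialSnd u v)) v.2 := by
          refine HasDerivAt.add ?_ ((hasDerivAt_pow _ _).mul h1)
          exact HasDerivAt.fun_sum fun k _ => (hasDerivAt_pow k v.2).const_mul _
        refine h2.deriv.trans ?_
        rw [Finset.sum_range_succ']
        simp only [Nat.add_sub_cancel, Nat.cast_zero, zero_mul, mul_zero, add_zero]
        push_cast
        rw [Finset.sum_congr rfl fun k _ => show a (k + 1) v.1 * (((k : ℝ) + 1) * v.2 ^ k) =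
          ((k : ℝ) + 1) * a (k + 1) v.1 * v.2 ^ k by ring]
        ring)
    refine ⟨w, hw, ?_, ?_⟩
    · rw [hw0, Nat.factorial_succ (m + 1)]; push_cast; ring
    · filter_upwards [h] with v hv
      rw [Function.iterate_succ_apply, hv, Nat.factorial_succ m]; push_cast; ring

/-- The analytic implicit function theorem for a scalar equation, with local uniqueness. -/
theorem exists_analyticAt_implicit {E : Type*} [NormedAddCommGroup E] [NormedSpace ℝ E]
    [CompleteSpace E] {g : E × ℝ → ℝ} {x₀ : E} {z₀ : ℝ} (hg : AnalyticAt ℝ g (x₀, z₀))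
    (h0 : g (x₀, z₀) = 0) (hd : fderiv ℝ g (x₀, z₀) (0, 1) ≠ 0) :
    ∃ ψ : E → ℝ, AnalyticAt ℝ ψ x₀ ∧ ψ x₀ = z₀ ∧
      ∀ᶠ v in 𝓝 (x₀, z₀), g v = 0 ↔ ψ v.1 = v.2 := by
  have hinv : (fderiv ℝ g (x₀, z₀) ∘L .inr ℝ E ℝ).IsInvertible := by
    refine ⟨ContinuousLinearEquiv.unitsEquivAut ℝ (Units.mk0 _ hd), ?_⟩
    ext
    simp
  refine ⟨(hg.contDiffAt (n := ω)).implicitFunction (by simp) hinv, ?_, ?_, ?_⟩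
  · exact (hg.contDiffAt.contDiffAt_implicitFunction (by simp) hinv).analyticAt
  · exact hg.contDiffAt.implicitFunction_apply_self (by simp) hinv
  · have := (hg.contDiffAt (n := ω)).eventually_apply_eq_iff_implicitFunction (by simp) hinv
    simpa [h0] using this

/-- After an analytic shear, the Taylor expansion in the second variable of a function which is
regular of order `m + 1` has no term of order `m`. -/
theorem exists_tschirnhaus {F : ℝ × ℝ → ℝ} (hF : AnalyticAt ℝ F (0, 0)) {m : ℕ}
    (hord : analyticOrderAt (fun y => F (0, y)) 0 = (m + 1 : ℕ)) :
    ∃ (ψ : ℝ → ℝ) (a : ℕ → ℝ → ℝ) (u : ℝ × ℝ → ℝ), AnalyticAt ℝ ψ 0 ∧ ψ 0 = 0 ∧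
      (∀ k, AnalyticAt ℝ (a k) 0) ∧ (∀ k < m, a k 0 = 0) ∧ AnalyticAt ℝ u (0, 0) ∧ u (0, 0) ≠ 0 ∧
      ∀ᶠ v in 𝓝 ((0, 0) : ℝ × ℝ), F (v.1, ψ v.1 + v.2) =
        ∑ k ∈ Finset.range m, a k v.1 * v.2 ^ k + v.2 ^ (m + 1) * u v := by
  have slice : ∀ {G : ℝ × ℝ → ℝ}, AnalyticAt ℝ G (0, 0) → AnalyticAt ℝ (fun y => G (0, y)) 0 :=
    fun hG => AnalyticAt.fun_comp (f := fun y : ℝ => ((0 : ℝ), y)) (x := (0 : ℝ)) hG (by fun_prop)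
  have slice_ev : ∀ {p : ℝ × ℝ → Prop}, (∀ᶠ v in 𝓝 ((0, 0) : ℝ × ℝ), p v) →
      ∀ᶠ y in 𝓝 (0 : ℝ), p (0, y) := fun h =>
    ((by fun_prop : Continuous fun y : ℝ => ((0 : ℝ), y)).tendsto' 0 (0, 0) rfl).eventually h
  have slice_ev' : ∀ {p : ℝ × ℝ → Prop}, (∀ᶠ v in 𝓝 ((0, 0) : ℝ × ℝ), p v) →
      ∀ᶠ x in 𝓝 (0 : ℝ), p (x, 0) := fun h =>
    ((by fun_prop : Continuous fun x : ℝ => (x, (0 : ℝ))).tendsto' 0 (0, 0) rfl).eventually h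
  obtain ⟨b, w, hb, hw, hFb⟩ := exists_analyticAt_taylor_snd hF (m + 1)
  obtain ⟨hb0, hw0⟩ := analyticOrderAt_taylor_coeff (c := fun k => b k 0) (slice hw)
    (slice_ev hFb) hord
  obtain ⟨g, hg, hg0, hFg⟩ := iterate_partialSnd_expansion m hw hFb
  have hH : AnalyticAt ℝ (partialSnd^[m] F) (0, 0) := by
    have : AnalyticAt ℝ (fun v : ℝ × ℝ => m.factorial * b m v.1 + v.2 * g v) (0, 0) := by
      have hbm : AnalyticAt ℝ (fun v : ℝ × ℝ => b m v.1) (0, 0) :=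
        AnalyticAt.fun_comp (f := fun v : ℝ × ℝ => v.1) (x := (0, 0)) (hb m) (by fun_prop)
      fun_prop
    exact this.congr (hFg.mono fun v hv => hv.symm)
  have hH0 : (partialSnd^[m] F) (0, 0) = 0 := by
    rw [hFg.self_of_nhds]; simp [hb0 m (by omega)]
  have hHd : fderiv ℝ (partialSnd^[m] F) (0, 0) (0, 1) ≠ 0 := by
    rw [← partialSnd_eq_fderiv hH.differentiableAt, partialSnd_congr hFg]
    have h1 : HasDerivAt (fun y => g (0, y)) (deriv (fun y => g (0, y)) 0) 0 :=
      (slice hg).differentiableAt.hasDerivAt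
    have h2 : HasDerivAt (fun y => m.factorial * b m 0 + y * g (0, y)) _ 0 :=
      ((hasDerivAt_id (0 : ℝ)).mul h1).const_add _
    have h3 : partialSnd (fun v => m.factorial * b m v.1 + v.2 * g v) (0, 0) =
      (m + 1).factorial * w (0, 0) := by
      refine h2.deriv.trans ?_
      simp [hg0]
    rw [h3]
    exact mul_ne_zero (by positivity) hw0
  -- The `m`-th `y`-derivative has a simple zero in `y` at the origin. Its zero curve `y = ψ x`
  -- becomes the new axis.
  obtain ⟨ψ, hψ, hψ0, hψe⟩ := exists_analyticAt_implicit hH hH0 hHd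
  have hψz : ∀ᶠ x in 𝓝 (0 : ℝ), (partialSnd^[m] F) (x, ψ x) = 0 := by
    have hc : Tendsto (fun x : ℝ => (x, ψ x)) (𝓝 0) (𝓝 (0, 0)) := by
      have : ContinuousAt (fun x : ℝ => (x, ψ x)) 0 := continuousAt_id.prodMk hψ.continuousAt
      simpa [ContinuousAt, hψ0] using this
    filter_upwards [hc.eventually hψe] with x hx
    exact hx.2 rfl
  let F' : ℝ × ℝ → ℝ := fun v => F (v.1, ψ v.1 + v.2)
  have hF' : AnalyticAt ℝ F' (0, 0) := by
    have hψ' : AnalyticAt ℝ (fun v : ℝ × ℝ => ψ v.1) (0, 0) :=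
      AnalyticAt.fun_comp (f := fun v : ℝ × ℝ => v.1) (x := (0, 0)) hψ (by fun_prop)
    refine AnalyticAt.fun_comp (g := F) (f := fun v : ℝ × ℝ => (v.1, ψ v.1 + v.2)) (x := (0, 0))
      (by simpa [hψ0] using hF) (by fun_prop)
  obtain ⟨a, u, ha, hu, hFa⟩ := exists_analyticAt_taylor_snd hF' (m + 1)
  -- Since `ψ 0 = 0`, the shear does not change the slice `x = 0`, so the order is still `m + 1`.
  obtain ⟨ha0, hu0⟩ := analyticOrderAt_taylor_coeff (c := fun k => a k 0) (slice hu)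
    (f := fun y => F (0, y))
    ((slice_ev hFa).mono fun y hy => by simpa [F', hψ0] using hy) hord
  obtain ⟨q, hq, hq0, hFq⟩ := iterate_partialSnd_expansion m hu hFa
  have ham : ∀ᶠ x in 𝓝 (0 : ℝ), a m x = 0 := by
    filter_upwards [hψz, slice_ev' hFq] with x h1 h2
    rw [iterate_partialSnd_shear F ψ m] at h2
    simp only [add_zero, zero_mul] at h2
    rw [h1] at h2
    have : (m.factorial : ℝ) ≠ 0 := by positivity
    simpa [this] using h2.symm
  refine ⟨ψ, a, u, hψ, hψ0, ha, fun k hk => ha0 k (by omega), hu, hu0, ?_⟩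
  have hfst : Tendsto (fun v : ℝ × ℝ => v.1) (𝓝 ((0, 0) : ℝ × ℝ)) (𝓝 0) :=
    continuous_fst.tendsto' _ _ rfl
  filter_upwards [hFa, hfst.eventually ham] with v h1 h2
  rw [show F (v.1, ψ v.1 + v.2) = F' v from rfl, h1, Finset.sum_range_succ, h2]
  ring

/-- Common weights for the orders of vanishing of the coefficients: after the substitution
`x = t ^ M`, all the coefficients `a k` are divisible by `t ^ (B * (d - k))`, one of them exactly. -/
theorem exists_scaling {m d : ℕ} (hmd : m < d) {a : ℕ → ℝ → ℝ} (ha : ∀ k, AnalyticAt ℝ (a k) 0)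
    (ha0 : ∀ k < m, a k 0 = 0) (hne : ¬ ∀ k < m, ∀ᶠ x in 𝓝 (0 : ℝ), a k x = 0) :
    ∃ (M B : ℕ) (b : ℕ → ℝ → ℝ), 1 ≤ M ∧ 1 ≤ B ∧ (∀ k, AnalyticAt ℝ (b k) 0) ∧
      (∃ k < m, b k 0 ≠ 0) ∧
      ∀ k < m, ∀ᶠ t in 𝓝 (0 : ℝ), a k (t ^ M) = t ^ (B * (d - k)) * b k t := by
  classical
  have h1 : ∀ k, ∃ (n : ℕ) (g : ℝ → ℝ), AnalyticAt ℝ g 0 ∧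
      ((k < m ∧ ¬ ∀ᶠ x in 𝓝 (0 : ℝ), a k x = 0) →
        1 ≤ n ∧ g 0 ≠ 0 ∧ ∀ᶠ x in 𝓝 (0 : ℝ), a k x = x ^ n * g x) := by
    intro k
    by_cases hk : k < m ∧ ¬ ∀ᶠ x in 𝓝 (0 : ℝ), a k x = 0
    · obtain ⟨n, g, hg, hg0, h⟩ := (ha k).exists_eventuallyEq_pow_smul_nonzero_iff.2 hk.2
      simp only [sub_zero, smul_eq_mul] at h
      refine ⟨n, g, hg, fun _ => ⟨?_, hg0, h⟩⟩
      by_contra hn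
      have hn0 : n = 0 := by omega
      have := h.self_of_nhds
      rw [ha0 k hk.1, hn0] at this
      simp at this
      exact hg0 this.symm
    · exact ⟨0, fun _ => 0, analyticAt_const, fun h => absurd h hk⟩
  choose n g hg hng using h1
  let K := (Finset.range m).filter fun k => ¬ ∀ᶠ x in 𝓝 (0 : ℝ), a k x = 0
  have hK : ∀ k, k ∈ K ↔ (k < m ∧ ¬ ∀ᶠ x in 𝓝 (0 : ℝ), a k x = 0) := by simp [K]
  have hKne : K.Nonempty := by
    push Not at hne
    obtain ⟨k, hk, h⟩ := hne
    exact ⟨k, (hK k).2 ⟨hk, by simpa using h⟩⟩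
  -- With `n k` the order of `a k`, minimising `n k / (d - k)` selects the edge of the Newton
  -- polygon through `(0, d)`. The factor `d!` makes these quotients integers, so the truncated
  -- division is exact and equality holds at `k₀`.
  obtain ⟨k₀, hk₀, hmin⟩ := Finset.exists_min_image K (fun k => d.factorial * n k / (d - k)) hKne
  set B := d.factorial * n k₀ / (d - k₀) with hB
  have hdvd : ∀ k < m, (d - k) ∣ d.factorial * n k := fun k hk =>
    Dvd.dvd.mul_right (Nat.dvd_factorial (by omega) (by omega)) _
  have hle : ∀ k ∈ K, B * (d - k) ≤ d.factorial * n k := fun k hk =>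
    (Nat.le_div_iff_mul_le (by have := ((hK k).1 hk).1; omega)).1 (hmin k hk)
  have heq : B * (d - k₀) = d.factorial * n k₀ := Nat.div_mul_cancel (hdvd k₀ ((hK k₀).1 hk₀).1)
  refine ⟨d.factorial, B, fun k t => if k ∈ K then
    t ^ (d.factorial * n k - B * (d - k)) * g k (t ^ d.factorial) else 0,
    Nat.factorial_pos d, ?_, fun k => ?_, ⟨k₀, ((hK k₀).1 hk₀).1, ?_⟩, fun k hk => ?_⟩
  · have h2 := (hng k₀ ((hK k₀).1 hk₀)).1
    have h3 := Nat.factorial_pos d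
    by_contra hB0
    have : B = 0 := Nat.lt_one_iff.1 (not_le.1 hB0)
    rw [this, zero_mul] at heq
    exact absurd heq.symm (by positivity)
  · by_cases hk : k ∈ K
    · simp only [hk, if_true]
      have : AnalyticAt ℝ (fun t : ℝ => g k (t ^ d.factorial)) 0 :=
        AnalyticAt.fun_comp (g := g k) (f := fun t : ℝ => t ^ d.factorial) (x := 0)
          (by rw [zero_pow (Nat.factorial_pos d).ne']; exact hg k) (by fun_prop)
      exact (analyticAt_id.pow _).mul this
    · simp only [hk, if_false]
      exact analyticAt_const
  · simp only [hk₀, if_true, heq, Nat.sub_self, pow_zero, one_mul]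
    rw [zero_pow (Nat.factorial_pos d).ne']
    exact (hng k₀ ((hK k₀).1 hk₀)).2.1
  · have htend : Tendsto (fun t : ℝ => t ^ d.factorial) (𝓝 0) (𝓝 0) := by
      have : Continuous fun t : ℝ => t ^ d.factorial := by fun_prop
      exact this.tendsto' _ _ (zero_pow (Nat.factorial_pos d).ne')
    by_cases hkK : k ∈ K
    · filter_upwards [htend.eventually (hng k ((hK k).1 hkK)).2.2] with t ht
      simp only [hkK, if_true]
      rw [ht, ← pow_mul, ← mul_assoc, ← pow_add, Nat.add_sub_cancel' (hle k hkK)]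
    · have hz : ∀ᶠ x in 𝓝 (0 : ℝ), a k x = 0 := by
        by_contra h
        exact hkK ((hK k).2 ⟨hk, h⟩)
      filter_upwards [htend.eventually hz] with t ht
      simp [ht, hkK]

/-- A polynomial of degree `m + 1` without term of degree `m` which is not a monomial has only roots
of multiplicity at most `m`. -/
theorem analyticOrderAt_lt_of_coeff_eq_zero {m : ℕ} {c : ℕ → ℝ} {e : ℝ} (he : e ≠ 0)
    (hc : ∃ k < m, c k ≠ 0) (z : ℝ) :
    analyticOrderAt (fun y : ℝ => ∑ k ∈ Finset.range m, c k * y ^ k + y ^ (m + 1) * e) z <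
      (m + 1 : ℕ) := by
  by_contra hlt
  rw [not_lt] at hlt
  let P : Polynomial ℝ := ∑ k ∈ Finset.range m, Polynomial.monomial k (e⁻¹ * c k) +
    Polynomial.X ^ (m + 1)
  have hsum_deg : (∑ k ∈ Finset.range m, Polynomial.monomial k (e⁻¹ * c k)).degree <
      ((m + 1 : ℕ) : WithBot ℕ) := by
    refine (Polynomial.degree_sum_le _ _).trans_lt ?_
    rw [Finset.sup_lt_iff (WithBot.bot_lt_coe _)]
    intro k hk
    refine (Polynomial.degree_monomial_le _ _).trans_lt ?_
    have := Finset.mem_range.1 hk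
    exact_mod_cast (by omega : k < m + 1)
  have hcoeff : ∀ j < m + 1, P.coeff j = if j < m then e⁻¹ * c j else 0 := by
    intro j hj
    simp [P, Polynomial.coeff_monomial, Polynomial.coeff_X_pow, hj.ne]
  have hmonic : P.Monic := by
    rw [show P = Polynomial.X ^ (m + 1) + ∑ k ∈ Finset.range m, Polynomial.monomial k (e⁻¹ * c k)
      from add_comm _ _]
    exact Polynomial.monic_X_pow_add (by exact_mod_cast hsum_deg)
  have hdeg : P.natDegree = m + 1 := by
    apply Polynomial.natDegree_eq_of_degree_eq_some
    rw [show P = Polynomial.X ^ (m + 1) + ∑ k ∈ Finset.range m, Polynomial.monomial k (e⁻¹ * c k)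
      from add_comm _ _, Polynomial.degree_add_eq_left_of_degree_lt] <;>
      rw [Polynomial.degree_X_pow]
    exact hsum_deg
  have hPe : (fun y : ℝ => ∑ k ∈ Finset.range m, c k * y ^ k + y ^ (m + 1) * e) =
      fun y => (Polynomial.C e * P).eval y := by
    funext y
    simp only [P, Polynomial.eval_mul, Polynomial.eval_C, Polynomial.eval_add,
      Polynomial.eval_finsetSum, Polynomial.eval_monomial, Polynomial.eval_pow, Polynomial.eval_X,
      mul_add, Finset.mul_sum]
    congr 1
    · exact Finset.sum_congr rfl fun k _ => by field_simp
    · ring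
  rw [hPe] at hlt
  have hd := pow_dvd_of_le_analyticOrderAt hlt
  have hd' : (Polynomial.X - Polynomial.C z) ^ (m + 1) ∣ P :=
    ((Polynomial.isUnit_C.2 he.isUnit).dvd_mul_left).1 hd
  -- A root of multiplicity `m + 1` exhausts the degree. The coefficient of `X ^ m` is then `-(m +
  -- 1) * z`, so `z = 0` and `P` would be the monomial `X ^ (m + 1)`.
  have heq : P = (Polynomial.X - Polynomial.C z) ^ (m + 1) := by
    refine (Polynomial.eq_of_monic_of_dvd_of_natDegree_le ((Polynomial.monic_X_sub_C z).pow _)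
      hmonic hd' ?_)
    rw [hdeg, Polynomial.natDegree_pow, Polynomial.natDegree_X_sub_C, mul_one]
  have hz : z = 0 := by
    have h1 := hcoeff m (by omega)
    rw [heq, sub_eq_add_neg, ← Polynomial.C_neg, Polynomial.coeff_X_add_C_pow] at h1
    have h2 : ((m : ℝ) + 1) ≠ 0 := by positivity
    simpa [h2] using h1
  obtain ⟨k, hk, hck⟩ := hc
  have h1 := hcoeff k (by omega)
  rw [heq, hz, Polynomial.C_0, sub_zero, Polynomial.coeff_X_pow] at h1
  have : k ≠ m + 1 := by omega
  simp [hk, this, he, hck] at h1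

/-! ### Weighted integrals over the half-plane and changes of variables -/

/-- The density `x ^ β * |F| ^ (-a)` for the pair of exponents `q = (β, a)`. -/
noncomputable def weight (F : ℝ × ℝ → ℝ) (q p : ℝ × ℝ) : ℝ≥0∞ :=
  ENNReal.ofReal (p.1 ^ q.1 * |F p| ^ (-q.2))

/-- The open right half-plane. -/
def rightHalf : Set (ℝ × ℝ) := {p | 0 < p.1}

theorem measurableSet_rightHalf : MeasurableSet rightHalf :=
  (isOpen_lt continuous_const continuous_fst).measurableSet

/-- The density is integrable on the right of `(0, y)`, near this point. -/
def FiniteNear (F : ℝ × ℝ → ℝ) (y : ℝ) (q : ℝ × ℝ) : Prop :=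
  ∃ U ∈ 𝓝 ((0 : ℝ), y), ∫⁻ p in U ∩ rightHalf, weight F q p < ⊤

/-- The density is integrable on the right of `(0, y)`, near this point, for all pairs of exponents
close to `q`. -/
def StablyFiniteNear (F : ℝ × ℝ → ℝ) (y : ℝ) (q : ℝ × ℝ) : Prop :=
  ∃ U ∈ 𝓝 ((0 : ℝ), y), ∀ᶠ r in 𝓝 q, ∫⁻ p in U ∩ rightHalf, weight F r p < ⊤

/-- The linear map with matrix `!![a, b; c, d]`. -/
noncomputable def matMap (a b c d : ℝ) : ℝ × ℝ →L[ℝ] ℝ × ℝ :=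
  (a • ContinuousLinearMap.fst ℝ ℝ ℝ + b • ContinuousLinearMap.snd ℝ ℝ ℝ).prod
    (c • ContinuousLinearMap.fst ℝ ℝ ℝ + d • ContinuousLinearMap.snd ℝ ℝ ℝ)

theorem det_matMap (a b c d : ℝ) : (matMap a b c d).det = a * d - b * c := by
  have : (matMap a b c d : ℝ × ℝ →ₗ[ℝ] ℝ × ℝ) =
      Matrix.toLin (Module.Basis.finTwoProd ℝ) (Module.Basis.finTwoProd ℝ) !![a, b; c, d] := by
    rw [Matrix.toLin_finTwoProd]
    rfl
  rw [ContinuousLinearMap.det, this, LinearMap.det_toLin, Matrix.det_fin_two_of]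

theorem lintegral_weight_congr {F G : ℝ × ℝ → ℝ} {s : Set (ℝ × ℝ)} (hs : MeasurableSet s)
    (h : EqOn F G s) (q : ℝ × ℝ) : ∫⁻ p in s, weight F q p = ∫⁻ p in s, weight G q p :=
  setLIntegral_congr_fun hs fun p hp => by simp only [weight, h hp]

theorem StablyFiniteNear.congr {F G : ℝ × ℝ → ℝ} {y : ℝ} {q : ℝ × ℝ}
    (h : StablyFiniteNear F y q) (hFG : F =ᶠ[𝓝 (0, y)] G) : StablyFiniteNear G y q := by
  obtain ⟨U, hU, hfin⟩ := h
  obtain ⟨V, hVs, hVo, hV0⟩ := mem_nhds_iff.1 (inter_mem hU hFG)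
  refine ⟨V, hVo.mem_nhds hV0, hfin.mono fun r hr => ?_⟩
  rw [← lintegral_weight_congr (F := F) (hVo.measurableSet.inter measurableSet_rightHalf)
    fun p hp => (hVs hp.1).2]
  exact (lintegral_mono_set (inter_subset_inter_left _ fun p hp => (hVs hp).1)).trans_lt hr

theorem FiniteNear.congr {F G : ℝ × ℝ → ℝ} {y : ℝ} {q : ℝ × ℝ}
    (h : FiniteNear F y q) (hFG : F =ᶠ[𝓝 (0, y)] G) : FiniteNear G y q := by
  obtain ⟨U, hU, hfin⟩ := h
  obtain ⟨V, hVs, hVo, hV0⟩ := mem_nhds_iff.1 (inter_mem hU hFG)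
  refine ⟨V, hVo.mem_nhds hV0, ?_⟩
  rw [← lintegral_weight_congr (F := F) (hVo.measurableSet.inter measurableSet_rightHalf)
    fun p hp => (hVs hp.1).2]
  exact (lintegral_mono_set (inter_subset_inter_left _ fun p hp => (hVs hp).1)).trans_lt hfin

/-- The shear `(x, y) ↦ (x, ψ x + y)`. -/
def shear (ψ : ℝ → ℝ) (v : ℝ × ℝ) : ℝ × ℝ := (v.1, ψ v.1 + v.2)

/-- A shear has Jacobian `1` and keeps the first coordinate, so neither exponent changes. -/
theorem lintegral_weight_shear {ψ : ℝ → ℝ} {s : Set (ℝ × ℝ)} (hs : MeasurableSet s)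
    (hψ : ∀ v ∈ s, DifferentiableAt ℝ ψ v.1) (F : ℝ × ℝ → ℝ) (q : ℝ × ℝ) :
    ∫⁻ p in shear ψ '' s, weight F q p = ∫⁻ p in s, weight (F ∘ shear ψ) q p := by
  rw [lintegral_image_eq_lintegral_abs_det_fderiv_mul volume hs
    (f' := fun v => matMap 1 0 (deriv ψ v.1) 1)]
  · refine setLIntegral_congr_fun hs fun v _ => ?_
    simp [det_matMap, weight, shear]
  · intro v hv
    have h1 : HasFDerivAt (fun v : ℝ × ℝ => v.1) (ContinuousLinearMap.fst ℝ ℝ ℝ) v := hasFDerivAt_fst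
    have h2 : HasFDerivAt (fun v : ℝ × ℝ => v.2) (ContinuousLinearMap.snd ℝ ℝ ℝ) v := hasFDerivAt_snd
    have h3 := (hψ v hv).hasDerivAt.comp_hasFDerivAt v h1
    convert! (h1.prodMk (h3.add h2)).hasFDerivWithinAt using 1
    ext <;> simp [matMap]
  · rintro ⟨x, y⟩ _ ⟨x', y'⟩ _ h
    simp only [shear, Prod.mk.injEq] at h
    obtain ⟨rfl, h⟩ := h
    simpa using h

/-- Finiteness passes to the sheared function, and `StablyFiniteNear.of_comp_shear` brings stability
back; together they allow the passage to a normal form. -/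
theorem FiniteNear.comp_shear {F : ℝ × ℝ → ℝ} {ψ : ℝ → ℝ} {y : ℝ} {q : ℝ × ℝ}
    (hψ : ∀ᶠ x in 𝓝 (0 : ℝ), DifferentiableAt ℝ ψ x) (h : FiniteNear F (ψ 0 + y) q) :
    FiniteNear (F ∘ shear ψ) y q := by
  obtain ⟨U, hU, hfin⟩ := h
  have hc : ContinuousAt (shear ψ) (0, y) := by
    have h1 : ContinuousAt (fun v : ℝ × ℝ => ψ v.1) (0, y) :=
      ContinuousAt.comp (f := fun v : ℝ × ℝ => v.1) (g := ψ) hψ.self_of_nhds.continuousAt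
        continuousAt_fst
    exact continuousAt_fst.prodMk (h1.add continuousAt_snd)
  have hfst : Tendsto (fun v : ℝ × ℝ => v.1) (𝓝 ((0, y) : ℝ × ℝ)) (𝓝 0) :=
    continuous_fst.tendsto' _ _ rfl
  obtain ⟨V, hVs, hVo, hV0⟩ := mem_nhds_iff.1 (inter_mem (hc.preimage_mem_nhds hU)
    (hfst.eventually hψ))
  refine ⟨V, hVo.mem_nhds hV0, ?_⟩
  rw [← lintegral_weight_shear (hVo.measurableSet.inter measurableSet_rightHalf)
    fun v hv => (hVs hv.1).2]
  refine (lintegral_mono_set ?_).trans_lt hfin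
  rintro _ ⟨v, hv, rfl⟩
  exact ⟨(hVs hv.1).1, hv.2⟩

theorem StablyFiniteNear.of_comp_shear {F : ℝ × ℝ → ℝ} {ψ : ℝ → ℝ} {y : ℝ} {q : ℝ × ℝ}
    (hψ : ∀ᶠ x in 𝓝 (0 : ℝ), DifferentiableAt ℝ ψ x) (h : StablyFiniteNear (F ∘ shear ψ) y q) :
    StablyFiniteNear F (ψ 0 + y) q := by
  obtain ⟨U, hU, hfin⟩ := h
  have hfst : ∀ z, Tendsto (fun v : ℝ × ℝ => v.1) (𝓝 ((0, z) : ℝ × ℝ)) (𝓝 0) := fun z =>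
    continuous_fst.tendsto' _ _ rfl
  have hc : ContinuousAt (fun v : ℝ × ℝ => (v.1, v.2 - ψ v.1)) (0, ψ 0 + y) := by
    have h1 : ContinuousAt (fun v : ℝ × ℝ => ψ v.1) (0, ψ 0 + y) :=
      ContinuousAt.comp (f := fun v : ℝ × ℝ => v.1) (g := ψ) hψ.self_of_nhds.continuousAt
        continuousAt_fst
    exact continuousAt_fst.prodMk (continuousAt_snd.sub h1)
  obtain ⟨V, hVs, hVo, hV0⟩ := mem_nhds_iff.1 (inter_mem hU ((hfst y).eventually hψ))
  refine ⟨_, hc.preimage_mem_nhds (by simpa using hVo.mem_nhds hV0), hfin.mono fun r hr => ?_⟩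
  have h1 : ∫⁻ p in shear ψ '' (V ∩ rightHalf), weight F r p < ⊤ := by
    rw [lintegral_weight_shear (hVo.measurableSet.inter measurableSet_rightHalf)
      fun v hv => (hVs hv.1).2]
    exact (lintegral_mono_set (inter_subset_inter_left _ fun p hp => (hVs hp).1)).trans_lt hr
  refine (lintegral_mono_set ?_).trans_lt h1
  rintro ⟨x, z⟩ ⟨hv, hx⟩
  exact ⟨(x, z - ψ x), ⟨hv, hx⟩, by simp [shear]⟩

/-! ### Monomial charts -/

theorem lintegral_Ioo_rpow_lt_top_iff {c : ℝ} (hc : 0 < c) (s : ℝ) :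
    ∫⁻ x in Ioo 0 c, ENNReal.ofReal (x ^ s) < ⊤ ↔ -1 < s := by
  rw [← intervalIntegral.integrableOn_Ioo_rpow_iff hc]
  have hm : AEStronglyMeasurable (fun x : ℝ => x ^ s) (volume.restrict (Ioo 0 c)) :=
    (measurable_id.pow_const s).aestronglyMeasurable
  rw [IntegrableOn, Integrable, and_iff_right hm, hasFiniteIntegral_iff_ofReal]
  filter_upwards [ae_restrict_mem measurableSet_Ioo] with x hx
  exact Real.rpow_nonneg hx.1.le s

theorem lintegral_Ioo_rpow_ne_zero {c : ℝ} (hc : 0 < c) (s : ℝ) :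
    ∫⁻ x in Ioo 0 c, ENNReal.ofReal (x ^ s) ≠ 0 := by
  rw [← zero_lt_iff]
  refine (setLIntegral_pos_iff (by fun_prop)).2 ?_
  have : Ioo 0 c ⊆ (Function.support fun x : ℝ => ENNReal.ofReal (x ^ s)) ∩ Ioo 0 c := fun x hx =>
    ⟨by simpa using Real.rpow_pos_of_pos hx.1 s, hx⟩
  exact lt_of_lt_of_le (by simpa using hc) (measure_mono this)

theorem lintegral_box_monomial_lt_top_iff {c ρ : ℝ} (hc : 0 < c) (hρ : 0 < ρ) (s t : ℝ) :
    ∫⁻ p in Ioo 0 c ×ˢ Ioo 0 ρ, ENNReal.ofReal (p.1 ^ s) * ENNReal.ofReal (p.2 ^ t) < ⊤ ↔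
      -1 < s ∧ -1 < t := by
  rw [Measure.volume_eq_prod, ← Measure.prod_restrict,
    lintegral_prod_mul (f := fun x : ℝ => ENNReal.ofReal (x ^ s))
      (g := fun x : ℝ => ENNReal.ofReal (x ^ t)) (by fun_prop) (by fun_prop),
    ← lintegral_Ioo_rpow_lt_top_iff hc, ← lintegral_Ioo_rpow_lt_top_iff hρ]
  -- As neither factor is zero, a finite product in `ℝ≥0∞` forces both factors to be finite.
  have h1 := lintegral_Ioo_rpow_ne_zero hc s
  have h2 := lintegral_Ioo_rpow_ne_zero hρ t
  rw [ENNReal.mul_lt_top_iff]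
  simp [h1, h2]

/-- The sign of `a` decides whether the power increases or decreases; the minimum and maximum of the
endpoint values serve both cases. -/
theorem exists_rpow_comparison {c₁ c₂ : ℝ} (hc₁ : 0 < c₁) (hc₂ : 0 < c₂) (a : ℝ) :
    ∃ k K : ℝ, 0 < k ∧ 0 < K ∧ ∀ r X : ℝ, 0 < r → c₁ * r ≤ X → X ≤ c₂ * r →
      k * r ^ a ≤ X ^ a ∧ X ^ a ≤ K * r ^ a := by
  refine ⟨min (c₁ ^ a) (c₂ ^ a), max (c₁ ^ a) (c₂ ^ a), by positivity, by positivity,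
    fun r X hr h1 h2 => ?_⟩
  have hX : 0 < X := lt_of_lt_of_le (by positivity) h1
  have hra : 0 ≤ r ^ a := by positivity
  rcases le_total 0 a with ha | ha
  · have h3 := Real.rpow_le_rpow (by positivity) h1 ha
    have h4 := Real.rpow_le_rpow hX.le h2 ha
    rw [Real.mul_rpow hc₁.le hr.le] at h3
    rw [Real.mul_rpow hc₂.le hr.le] at h4
    exact ⟨(mul_le_mul_of_nonneg_right (min_le_left _ _) hra).trans h3,
      h4.trans (mul_le_mul_of_nonneg_right (le_max_right _ _) hra)⟩
  · have h3 := Real.rpow_le_rpow_of_nonpos (by positivity) h1 ha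
    have h4 := Real.rpow_le_rpow_of_nonpos hX h2 ha
    rw [Real.mul_rpow hc₁.le hr.le] at h3
    rw [Real.mul_rpow hc₂.le hr.le] at h4
    exact ⟨(mul_le_mul_of_nonneg_right (min_le_right _ _) hra).trans h4,
      h3.trans (mul_le_mul_of_nonneg_right (le_max_left _ _) hra)⟩

/-- The monomial chart `(w, s) ↦ (s ^ M * w, σ * s ^ B)`. -/
def monomialChart (M B : ℕ) (σ : ℝ) (v : ℝ × ℝ) : ℝ × ℝ := (v.2 ^ M * v.1, σ * v.2 ^ B)

/-- The Jacobian is `B * s ^ (M + B - 1)` in absolute value and `|F|` is comparable to `s ^ D`, so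
the density becomes, up to constants, a product of a power of `w` and a power of `s` on a rectangle.
-/
theorem lintegral_weight_monomialChart_lt_top_iff {M B D : ℕ} (hB : 1 ≤ B) {σ : ℝ} (hσ : |σ| = 1)
    {c ρ c₁ c₂ : ℝ} (hc : 0 < c) (hρ : 0 < ρ) (hc₁ : 0 < c₁) (hc₂ : 0 < c₂) {F : ℝ × ℝ → ℝ}
    (hF : ∀ v ∈ Ioo 0 c ×ˢ Ioo 0 ρ, c₁ * v.2 ^ D ≤ |F (monomialChart M B σ v)| ∧
      |F (monomialChart M B σ v)| ≤ c₂ * v.2 ^ D) (q : ℝ × ℝ) :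
    ∫⁻ p in monomialChart M B σ '' (Ioo 0 c ×ˢ Ioo 0 ρ), weight F q p < ⊤ ↔
      -1 < q.1 ∧ -1 < M * q.1 + M + B - 1 - D * q.2 := by
  have hs : MeasurableSet (Ioo (0 : ℝ) c ×ˢ Ioo (0 : ℝ) ρ) := measurableSet_Ioo.prod measurableSet_Ioo
  have hσ0 : σ ≠ 0 := by rintro rfl; simp at hσ
  have hBR : (0 : ℝ) < B := by exact_mod_cast hB
  rw [lintegral_image_eq_lintegral_abs_det_fderiv_mul volume hs
    (f' := fun v => matMap (v.2 ^ M) (M * v.2 ^ (M - 1) * v.1) 0 (σ * (B * v.2 ^ (B - 1))))]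
  rotate_left
  · intro v hv
    have h1 : HasFDerivAt (fun v : ℝ × ℝ => v.1) (ContinuousLinearMap.fst ℝ ℝ ℝ) v := hasFDerivAt_fst
    have h2 : HasFDerivAt (fun v : ℝ × ℝ => v.2) (ContinuousLinearMap.snd ℝ ℝ ℝ) v := hasFDerivAt_snd
    have h3 := ((hasDerivAt_pow M v.2).comp_hasFDerivAt v h2).mul h1
    have h4 := ((hasDerivAt_pow B v.2).comp_hasFDerivAt v h2).const_mul σ
    convert! (h3.prodMk h4).hasFDerivWithinAt using 1
    ext <;> (simp [matMap]; try ring)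
  · rintro ⟨w, s⟩ ⟨hw, hs⟩ ⟨w', s'⟩ ⟨hw', hs'⟩ h
    simp only [monomialChart, Prod.mk.injEq] at h hw hs hw' hs'
    have : s = s' := (pow_left_inj₀ hs.1.le hs'.1.le (by omega)).1 (mul_left_cancel₀ hσ0 h.2)
    subst this
    have h0 : s ^ M ≠ 0 := pow_ne_zero _ hs.1.ne'
    simpa [h0] using h.1
  obtain ⟨k, K, hk, hK, hkK⟩ := exists_rpow_comparison hc₁ hc₂ (-q.2)
  set δ : ℝ := M * q.1 + M + B - 1 - D * q.2 with hδ
  rw [← lintegral_box_monomial_lt_top_iff hc hρ]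
  have key : ∀ v ∈ Ioo (0 : ℝ) c ×ˢ Ioo (0 : ℝ) ρ,
      |(matMap (v.2 ^ M) (M * v.2 ^ (M - 1) * v.1) 0 (σ * (B * v.2 ^ (B - 1)))).det| *
        (monomialChart M B σ v).1 ^ q.1 * (v.2 ^ D) ^ (-q.2) = B * (v.1 ^ q.1 * v.2 ^ δ) := by
    rintro ⟨w, s⟩ ⟨hw, hs⟩
    simp only at hw hs
    have hs0 := hs.1
    have hw0 := hw.1
    simp only [det_matMap, monomialChart, mul_zero, sub_zero, abs_mul, hσ, one_mul]
    rw [abs_of_pos (by positivity : 0 < s ^ M), abs_of_pos hBR,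
      abs_of_pos (by positivity : 0 < s ^ (B - 1)), Real.mul_rpow (by positivity) hw0.le]
    have e1 : s ^ δ = s ^ (M : ℝ) * s ^ ((B : ℝ) - 1) * (s ^ (M * q.1)) * s ^ (D * (-q.2)) := by
      rw [← Real.rpow_add hs0, ← Real.rpow_add hs0, ← Real.rpow_add hs0, hδ]
      congr 1; ring
    have e2 : s ^ ((B : ℝ) - 1) = s ^ (B - 1) := by
      rw [← Real.rpow_natCast, Nat.cast_sub hB, Nat.cast_one]
    rw [e1, e2, Real.rpow_mul hs0.le, Real.rpow_mul hs0.le, Real.rpow_natCast, Real.rpow_natCast]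
    ring
  have split : ∀ v ∈ Ioo (0 : ℝ) c ×ˢ Ioo (0 : ℝ) ρ, ∀ κ : ℝ, 0 ≤ κ →
      ENNReal.ofReal κ * (ENNReal.ofReal (v.1 ^ q.1) * ENNReal.ofReal (v.2 ^ δ)) =
        ENNReal.ofReal (κ * (v.1 ^ q.1 * v.2 ^ δ)) := by
    intro v hv κ hκ
    rw [← ENNReal.ofReal_mul (Real.rpow_nonneg hv.1.1.le _), ← ENNReal.ofReal_mul hκ]
  constructor
  · intro h
    have hle : ∫⁻ v in Ioo (0 : ℝ) c ×ˢ Ioo (0 : ℝ) ρ, ENNReal.ofReal (k * B) *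
        (ENNReal.ofReal (v.1 ^ q.1) * ENNReal.ofReal (v.2 ^ δ)) < ⊤ := by
      refine (setLIntegral_mono' hs fun v hv => ?_).trans_lt h
      rw [split v hv _ (by positivity), weight, ← ENNReal.ofReal_mul (abs_nonneg _)]
      refine ENNReal.ofReal_le_ofReal ?_
      rw [mul_assoc k, ← key v hv]
      have hb := (hkK (v.2 ^ D) _ (pow_pos hv.2.1 _) (hF v hv).1 (hF v hv).2).1
      have h0 : 0 ≤ (monomialChart M B σ v).1 ^ q.1 := by
        have := hv.1.1; have := hv.2.1
        simp only [monomialChart]; positivity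
      have := mul_le_mul_of_nonneg_left hb (mul_nonneg (abs_nonneg
        (matMap (v.2 ^ M) (M * v.2 ^ (M - 1) * v.1) 0 (σ * (B * v.2 ^ (B - 1)))).det) h0)
      simp only [mul_assoc, mul_left_comm _ k] at this ⊢
      exact this
    rw [lintegral_const_mul' _ _ ENNReal.ofReal_ne_top, ENNReal.mul_lt_top_iff] at hle
    rcases hle with h1 | h1 | h1
    · exact h1.2
    · rw [ENNReal.ofReal_eq_zero] at h1
      exact absurd h1 (not_le.2 (by positivity))
    · rw [h1]; exact ENNReal.zero_lt_top
  · intro h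
    have hle : ∫⁻ v in Ioo (0 : ℝ) c ×ˢ Ioo (0 : ℝ) ρ, ENNReal.ofReal (K * B) *
        (ENNReal.ofReal (v.1 ^ q.1) * ENNReal.ofReal (v.2 ^ δ)) < ⊤ := by
      rw [lintegral_const_mul' _ _ ENNReal.ofReal_ne_top]
      exact ENNReal.mul_lt_top ENNReal.ofReal_lt_top h
    refine (setLIntegral_mono' hs fun v hv => ?_).trans_lt hle
    rw [split v hv _ (by positivity), weight, ← ENNReal.ofReal_mul (abs_nonneg _)]
    refine ENNReal.ofReal_le_ofReal ?_
    rw [mul_assoc K, ← key v hv]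
    have hb := (hkK (v.2 ^ D) _ (pow_pos hv.2.1 _) (hF v hv).1 (hF v hv).2).2
    have h0 : 0 ≤ (monomialChart M B σ v).1 ^ q.1 := by
      have := hv.1.1; have := hv.2.1
      simp only [monomialChart]; positivity
    have := mul_le_mul_of_nonneg_left hb (mul_nonneg (abs_nonneg
      (matMap (v.2 ^ M) (M * v.2 ^ (M - 1) * v.1) 0 (σ * (B * v.2 ^ (B - 1)))).det) h0)
    simp only [mul_assoc, mul_left_comm _ K] at this ⊢
    exact this

/-- The criterion consists of two strict inequalities between continuous functions of the exponents,
hence is open. -/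
theorem eventually_lintegral_weight_monomialChart {M B D : ℕ} (hB : 1 ≤ B) {σ : ℝ} (hσ : |σ| = 1)
    {c ρ c₁ c₂ : ℝ} (hc : 0 < c) (hρ : 0 < ρ) (hc₁ : 0 < c₁) (hc₂ : 0 < c₂) {F : ℝ × ℝ → ℝ}
    (hF : ∀ v ∈ Ioo 0 c ×ˢ Ioo 0 ρ, c₁ * v.2 ^ D ≤ |F (monomialChart M B σ v)| ∧
      |F (monomialChart M B σ v)| ≤ c₂ * v.2 ^ D) {q : ℝ × ℝ}
    (h : ∫⁻ p in monomialChart M B σ '' (Ioo 0 c ×ˢ Ioo 0 ρ), weight F q p < ⊤) :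
    ∀ᶠ r in 𝓝 q, ∫⁻ p in monomialChart M B σ '' (Ioo 0 c ×ˢ Ioo 0 ρ), weight F r p < ⊤ := by
  simp only [lintegral_weight_monomialChart_lt_top_iff hB hσ hc hρ hc₁ hc₂ hF] at h ⊢
  have c1 : Continuous fun r : ℝ × ℝ => r.1 := continuous_fst
  have c2 : Continuous fun r : ℝ × ℝ => (M : ℝ) * r.1 + M + B - 1 - D * r.2 := by fun_prop
  exact (c1.continuousAt.eventually (lt_mem_nhds h.1)).and
    (c2.continuousAt.eventually (lt_mem_nhds h.2))

/-! ### Weighted blow-ups -/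

/-- The ramified weighted blow-up `(t, z) ↦ (t ^ M, t ^ B * z)`. -/
def blowup (M B : ℕ) (v : ℝ × ℝ) : ℝ × ℝ := (v.1 ^ M, v.1 ^ B * v.2)

/-- The action of the blow-up on the exponents of the density. -/
def blowupExponent (M B d : ℕ) (q : ℝ × ℝ) : ℝ × ℝ := (M * q.1 + M + B - 1 - B * d * q.2, q.2)

theorem continuous_blowupExponent (M B d : ℕ) : Continuous (blowupExponent M B d) := by
  unfold blowupExponent; fun_prop

/-- The Jacobian `M * t ^ (M + B - 1)`, the power `x ^ β = t ^ (M * β)` and the factor `t ^ (B * d)`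
split off from `Q` all go into the exponent of `t`. This is why the densities carry a power of the
first coordinate. -/
theorem lintegral_weight_blowup {M B d : ℕ} (hM : 1 ≤ M) {Q Q₁ : ℝ × ℝ → ℝ} {s : Set (ℝ × ℝ)}
    (hs : MeasurableSet s) (hs0 : ∀ v ∈ s, 0 < v.1)
    (hQ : ∀ v ∈ s, Q (blowup M B v) = v.1 ^ (B * d) * Q₁ v) (q : ℝ × ℝ) :
    ∫⁻ p in blowup M B '' s, weight Q q p =
      ENNReal.ofReal M * ∫⁻ p in s, weight Q₁ (blowupExponent M B d q) p := by
  have hMR : (0 : ℝ) < M := by exact_mod_cast hM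
  rw [lintegral_image_eq_lintegral_abs_det_fderiv_mul volume hs
    (f' := fun v => matMap (M * v.1 ^ (M - 1)) 0 (B * v.1 ^ (B - 1) * v.2) (v.1 ^ B))]
  rotate_left
  · intro v hv
    have h1 : HasFDerivAt (fun v : ℝ × ℝ => v.1) (ContinuousLinearMap.fst ℝ ℝ ℝ) v := hasFDerivAt_fst
    have h2 : HasFDerivAt (fun v : ℝ × ℝ => v.2) (ContinuousLinearMap.snd ℝ ℝ ℝ) v := hasFDerivAt_snd
    have h3 := (hasDerivAt_pow M v.1).comp_hasFDerivAt v h1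
    have h4 := ((hasDerivAt_pow B v.1).comp_hasFDerivAt v h1).mul h2
    convert! (h3.prodMk h4).hasFDerivWithinAt using 1
    ext <;> (simp [matMap]; try ring)
  · rintro ⟨t, z⟩ h ⟨t', z'⟩ h' he
    have ht := hs0 _ h
    have ht' := hs0 _ h'
    simp only [blowup, Prod.mk.injEq] at he ht ht'
    have : t = t' := (pow_left_inj₀ ht.le ht'.le (by omega)).1 he.1
    subst this
    have h0 : t ^ B ≠ 0 := pow_ne_zero _ ht.ne'
    simpa [h0] using he.2
  rw [← lintegral_const_mul' _ _ ENNReal.ofReal_ne_top]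
  refine setLIntegral_congr_fun hs fun v hv => ?_
  have hv0 := hs0 v hv
  simp only [weight]
  rw [← ENNReal.ofReal_mul (abs_nonneg _), ← ENNReal.ofReal_mul hMR.le, hQ v hv]
  congr 1
  simp only [det_matMap, blowup, blowupExponent, zero_mul, sub_zero, abs_mul]
  rw [abs_of_pos hMR, abs_of_pos (by positivity : 0 < v.1 ^ (M - 1)),
    abs_of_pos (by positivity : 0 < v.1 ^ B), abs_of_pos (by positivity : 0 < v.1 ^ (B * d)),
    Real.mul_rpow (by positivity) (abs_nonneg _)]
  have e1 : v.1 ^ (M * q.1 + M + B - 1 - B * d * q.2) =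
      v.1 ^ ((M : ℝ) - 1) * v.1 ^ (B : ℝ) * (v.1 ^ (M * q.1)) * v.1 ^ ((B * d : ℕ) * (-q.2)) := by
    rw [← Real.rpow_add hv0, ← Real.rpow_add hv0, ← Real.rpow_add hv0]
    congr 1; push_cast; ring
  have e2 : v.1 ^ ((M : ℝ) - 1) = v.1 ^ (M - 1) := by
    rw [← Real.rpow_natCast, Nat.cast_sub hM, Nat.cast_one]
  rw [e1, e2, Real.rpow_mul hv0.le, Real.rpow_mul hv0.le, Real.rpow_natCast, Real.rpow_natCast,
    Real.rpow_natCast]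
  ring

theorem continuous_blowup (M B : ℕ) : Continuous (blowup M B) := by unfold blowup; fun_prop

theorem blowup_zero_left {M B : ℕ} (hM : 1 ≤ M) (hB : 1 ≤ B) (z : ℝ) :
    blowup M B (0, z) = (0, 0) := by
  rw [blowup, zero_pow (by omega), zero_pow (by omega), zero_mul]

theorem FiniteNear.comp_blowup {M B d : ℕ} (hM : 1 ≤ M) (hB : 1 ≤ B) {Q Q₁ : ℝ × ℝ → ℝ} {z : ℝ}
    (hQ : ∀ᶠ v in 𝓝 ((0 : ℝ), z), Q (blowup M B v) = v.1 ^ (B * d) * Q₁ v) {q : ℝ × ℝ}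
    (h : FiniteNear Q 0 q) : FiniteNear Q₁ z (blowupExponent M B d q) := by
  obtain ⟨U, hU, hfin⟩ := h
  have hb0 := blowup_zero_left hM hB z
  obtain ⟨V, hVs, hVo, hV0⟩ := mem_nhds_iff.1 (inter_mem
    ((continuous_blowup M B).continuousAt.preimage_mem_nhds (by rwa [hb0])) hQ)
  refine ⟨V, hVo.mem_nhds hV0, ?_⟩
  have h1 := lintegral_weight_blowup hM (hVo.measurableSet.inter measurableSet_rightHalf)
    (fun v hv => hv.2) (fun v hv => (hVs hv.1).2) q
  have h2 : ∫⁻ p in blowup M B '' (V ∩ rightHalf), weight Q q p < ⊤ := by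
    refine (lintegral_mono_set ?_).trans_lt hfin
    rintro _ ⟨v, hv, rfl⟩
    have : 0 < v.1 := hv.2
    exact ⟨(hVs hv.1).1, by simp only [rightHalf, blowup, mem_ofPred_eq]; positivity⟩
  rw [h1, ENNReal.mul_lt_top_iff] at h2
  rcases h2 with h2 | h2 | h2
  · exact h2.2
  · rw [ENNReal.ofReal_eq_zero] at h2
    have : (1 : ℝ) ≤ M := by exact_mod_cast hM
    linarith
  · rw [h2]; exact ENNReal.zero_lt_top

/-- The segment `{0} ×ˢ Icc (-C) C` of the exceptional line is compact, so finitely many local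
statements give one neighbourhood of it and one neighbourhood of exponents; the latter pulls back
along the continuous map `blowupExponent`. -/
theorem eventually_lintegral_weight_blowup {M B d : ℕ} (hM : 1 ≤ M) {Q Q₁ : ℝ × ℝ → ℝ}
    (hQ : ∀ z, ∀ᶠ v in 𝓝 ((0 : ℝ), z), Q (blowup M B v) = v.1 ^ (B * d) * Q₁ v) {q : ℝ × ℝ}
    (h : ∀ z, StablyFiniteNear Q₁ z (blowupExponent M B d q)) (C : ℝ) :
    ∃ r > 0, ∀ᶠ q' in 𝓝 q,
      ∫⁻ p in blowup M B '' (Ioo 0 r ×ˢ Icc (-C) C), weight Q q' p < ⊤ := by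
  set e := blowupExponent M B d q with he
  have hK : IsCompact (({0} : Set ℝ) ×ˢ Icc (-C) C) := isCompact_singleton.prod isCompact_Icc
  have hcov : ∃ U ∈ 𝓝ˢ (({0} : Set ℝ) ×ˢ Icc (-C) C),
      ∀ᶠ r in 𝓝 e, ∫⁻ p in U ∩ rightHalf, weight Q₁ r p < ⊤ := by
    refine hK.induction_on (p := fun s => ∃ U ∈ 𝓝ˢ s,
      ∀ᶠ r in 𝓝 e, ∫⁻ p in U ∩ rightHalf, weight Q₁ r p < ⊤) ⟨∅, by simp, by simp⟩ ?_ ?_ ?_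
    · rintro s t hst ⟨U, hU, h⟩
      exact ⟨U, nhdsSet_mono hst hU, h⟩
    · rintro s t ⟨U, hU, h⟩ ⟨V, hV, h'⟩
      refine ⟨U ∪ V, union_mem_nhdsSet hU hV, ?_⟩
      filter_upwards [h, h'] with r h1 h2
      rw [union_inter_distrib_right]
      exact (lintegral_union_le _ _ _).trans_lt (ENNReal.add_lt_top.2 ⟨h1, h2⟩)
    · rintro ⟨x, z⟩ ⟨hx, -⟩
      obtain rfl : x = 0 := hx
      obtain ⟨U, hU, hfin⟩ := h z
      refine ⟨interior U, mem_nhdsWithin_of_mem_nhds (interior_mem_nhds.2 hU), U, ?_, hfin⟩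
      exact mem_nhdsSet_interior
  obtain ⟨U, hU, hfin⟩ := hcov
  have hid : ∀ᶠ v in 𝓝ˢ (({0} : Set ℝ) ×ˢ Icc (-C) C),
      Q (blowup M B v) = v.1 ^ (B * d) * Q₁ v := by
    rw [eventually_nhdsSet_iff_forall]
    rintro ⟨x, z⟩ ⟨hx, -⟩
    obtain rfl : x = 0 := hx
    exact hQ z
  obtain ⟨O, hOo, hKO, hOs⟩ := mem_nhdsSet_iff_exists.1 (inter_mem hU hid)
  -- The tube lemma fits a strip of uniform width `r` inside the neighbourhood of the segment.
  obtain ⟨u, v, huo, -, hu, hv, huv⟩ :=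
    generalized_tube_lemma isCompact_singleton isCompact_Icc hOo hKO
  obtain ⟨r, hr, hru⟩ := Metric.isOpen_iff.1 huo 0 (hu rfl)
  have hsub : Ioo 0 r ×ˢ Icc (-C) C ⊆ O ∩ rightHalf := by
    rintro ⟨t, z⟩ ⟨ht, hz⟩
    refine ⟨huv ⟨hru ?_, hv hz⟩, ht.1⟩
    simp only [Metric.mem_ball, dist_zero_right, Real.norm_eq_abs, abs_lt]
    exact ⟨by linarith [ht.1], ht.2⟩
  refine ⟨r, hr, ?_⟩
  filter_upwards [(continuous_blowupExponent M B d).continuousAt.eventually hfin] with q' hq'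
  rw [lintegral_weight_blowup hM (d := d) (Q₁ := Q₁) (measurableSet_Ioo.prod measurableSet_Icc)
    (fun v hv => hv.1.1) (fun v hv => (hOs (hsub hv).1).2)]
  refine ENNReal.mul_lt_top ENNReal.ofReal_lt_top ((lintegral_mono_set ?_).trans_lt hq')
  exact fun p hp => ⟨(hOs (hsub hp).1).1, (hsub hp).2⟩

/-- Away from the exceptional curve, the weighted blow-up is covered by two monomial charts. -/
theorem mem_blowup_or_monomialChart {M B : ℕ} (hM : 1 ≤ M) (hB : 1 ≤ B) {η r ρ : ℝ} (hη : 0 < η)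
    (hr : 0 < r) (hρ : 0 < ρ) {x y : ℝ} (hx0 : 0 < x) (hx : x < r ^ M) (hy : |y| < ρ ^ B) :
    (x, y) ∈ blowup M B '' (Ioo 0 r ×ˢ Icc (-((η⁻¹) ^ B)) ((η⁻¹) ^ B)) ∪
      (monomialChart M B 1 '' (Ioo 0 (η ^ M) ×ˢ Ioo 0 ρ) ∪
        monomialChart M B (-1) '' (Ioo 0 (η ^ M) ×ˢ Ioo 0 ρ)) := by
  obtain ⟨t, ht0, ht⟩ : ∃ t : ℝ, 0 < t ∧ t ^ M = x :=
    ⟨x ^ ((M : ℝ)⁻¹), Real.rpow_pos_of_pos hx0 _, Real.rpow_inv_natCast_pow hx0.le (by omega)⟩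
  obtain ⟨s, hs0, hs⟩ : ∃ s : ℝ, 0 ≤ s ∧ s ^ B = |y| :=
    ⟨|y| ^ ((B : ℝ)⁻¹), Real.rpow_nonneg (abs_nonneg _) _,
      Real.rpow_inv_natCast_pow (abs_nonneg _) (by omega)⟩
  have htr : t < r := lt_of_pow_lt_pow_left₀ M hr.le (by rw [ht]; exact hx)
  have hsρ : s < ρ := lt_of_pow_lt_pow_left₀ B hρ.le (by rw [hs]; exact hy)
  -- Here `t = x ^ (1 / M)` and `s = |y| ^ (1 / B)`. If `t < η * s`, the chart coordinate `w = (t /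
  -- s) ^ M` is below `η ^ M`; otherwise the blow-up coordinate satisfies `|y / t ^ B| ≤ η⁻¹ ^ B`.
  by_cases hts : t < η * s
  · right
    have hspos : 0 < s := by
      by_contra h
      have : s = 0 := by linarith
      rw [this, mul_zero] at hts
      linarith
    have hw : (t / s) ^ M ∈ Ioo 0 (η ^ M) := by
      refine ⟨by positivity, pow_lt_pow_left₀ ?_ (by positivity) (by omega)⟩
      rwa [div_lt_iff₀ hspos]
    have hx' : s ^ M * (t / s) ^ M = x := by
      rw [← mul_pow, mul_div_cancel₀ _ hspos.ne', ht]
    rcases le_total 0 y with hy0 | hy0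
    · exact Or.inl ⟨((t / s) ^ M, s), ⟨hw, hspos, hsρ⟩, by
        simp [monomialChart, hx', hs, abs_of_nonneg hy0]⟩
    · exact Or.inr ⟨((t / s) ^ M, s), ⟨hw, hspos, hsρ⟩, by
        simp [monomialChart, hx', hs, abs_of_nonpos hy0]⟩
  · left
    refine ⟨(t, y / t ^ B), ⟨⟨ht0, htr⟩, ?_⟩, ?_⟩
    · rw [mem_Icc, ← abs_le, abs_div, abs_of_pos (by positivity : 0 < t ^ B), ← hs, ← div_pow]
      refine pow_le_pow_left₀ (by positivity) ?_ _
      rw [div_le_iff₀ ht0, inv_mul_eq_div, le_div_iff₀ hη]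
      linarith
    · simp only [blowup, ht]
      rw [mul_div_cancel₀ _ (by positivity)]

theorem monomialChart_mem {M B : ℕ} (hM : 1 ≤ M) (hB : 1 ≤ B) {σ : ℝ} (hσ : |σ| = 1) {c ρ : ℝ}
    (hc1 : c ≤ 1) (hρ1 : ρ ≤ 1) {v : ℝ × ℝ} (hv : v ∈ Ioo 0 c ×ˢ Ioo 0 ρ) :
    0 < (monomialChart M B σ v).1 ∧ (monomialChart M B σ v).1 < ρ ∧
      |(monomialChart M B σ v).2| < ρ := by
  obtain ⟨⟨hw0, hwc⟩, hs0, hsρ⟩ := hv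
  simp only [monomialChart, abs_mul, hσ, one_mul]
  have h1 : v.2 ^ M ≤ v.2 := pow_le_of_le_one hs0.le (by linarith) (by omega)
  have h2 : v.2 ^ B ≤ v.2 := pow_le_of_le_one hs0.le (by linarith) (by omega)
  refine ⟨by positivity, ?_, by rw [abs_of_pos (by positivity)]; linarith⟩
  have : v.2 ^ M * v.1 ≤ v.2 ^ M := mul_le_of_le_one_right (by positivity) (by linarith)
  linarith

theorem exists_square_subset {U : Set (ℝ × ℝ)} (hU : U ∈ 𝓝 ((0 : ℝ), (0 : ℝ))) :
    ∃ ρ, 0 < ρ ∧ ρ ≤ 1 ∧ ∀ x y : ℝ, |x| < ρ → |y| < ρ → (x, y) ∈ U := by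
  obtain ⟨ε, hε, h⟩ := Metric.mem_nhds_iff.1 hU
  refine ⟨min ε 1, by positivity, min_le_right _ _, fun x y hx hy => h ?_⟩
  rw [Metric.mem_ball, Prod.dist_eq, max_lt_iff]
  simp only [dist_zero_right, Real.norm_eq_abs]
  exact ⟨hx.trans_le (min_le_left _ _), hy.trans_le (min_le_left _ _)⟩

/-- Stability for a monomial times a unit. -/
theorem StablyFiniteNear.of_monomial {d : ℕ} {u : ℝ × ℝ → ℝ} (hu : ContinuousAt u (0, 0))
    (hu0 : u (0, 0) ≠ 0) {q : ℝ × ℝ} (h : FiniteNear (fun v => v.2 ^ d * u v) 0 q) :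
    StablyFiniteNear (fun v => v.2 ^ d * u v) 0 q := by
  obtain ⟨U, hU, hfin⟩ := h
  have hupos : 0 < |u (0, 0)| := abs_pos.2 hu0
  have hnear : ∀ᶠ v in 𝓝 ((0 : ℝ), (0 : ℝ)), |u (0, 0)| / 2 < |u v| ∧ |u v| < 2 * |u (0, 0)| :=
    (hu.abs.eventually (lt_mem_nhds (by linarith))).and
      (hu.abs.eventually (gt_mem_nhds (by linarith)))
  obtain ⟨ρ, hρ, -, hρU⟩ := exists_square_subset (inter_mem hU hnear)
  -- For `M = 0` and `B = 1` the monomial chart is `(w, s) ↦ (w, σ * s)`. The two signs cover the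
  -- half-square up to the null line `y = 0`.
  have hmem : ∀ σ : ℝ, |σ| = 1 → ∀ v ∈ Ioo 0 ρ ×ˢ Ioo 0 ρ, monomialChart 0 1 σ v ∈
      (U ∩ {v | |u (0, 0)| / 2 < |u v| ∧ |u v| < 2 * |u (0, 0)|}) ∩ rightHalf := by
    rintro σ hσ ⟨w, s⟩ ⟨hw, hs⟩
    refine ⟨hρU _ _ ?_ ?_, ?_⟩
    · simpa [abs_of_pos hw.1] using hw.2
    · simpa [abs_mul, hσ, abs_of_pos hs.1] using hs.2
    · simpa [rightHalf, monomialChart] using hw.1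
  have hchart : ∀ σ : ℝ, |σ| = 1 → ∀ᶠ r in 𝓝 q, ∫⁻ p in monomialChart 0 1 σ ''
      (Ioo 0 ρ ×ˢ Ioo 0 ρ), weight (fun v => v.2 ^ d * u v) r p < ⊤ := by
    intro σ hσ
    refine eventually_lintegral_weight_monomialChart (D := d) le_rfl hσ hρ hρ
      (by positivity : 0 < |u (0, 0)| / 2) (by positivity : 0 < 2 * |u (0, 0)|) ?_ ?_
    · intro v hv
      have h1 := (hmem σ hσ v hv).1.2
      have h2 : 0 < v.2 ^ d := pow_pos hv.2.1 d
      have h3 : |(monomialChart 0 1 σ v).2 ^ d * u (monomialChart 0 1 σ v)| =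
          v.2 ^ d * |u (monomialChart 0 1 σ v)| := by
        simp [monomialChart, abs_mul, hσ, abs_of_pos hv.2.1]
      rw [h3]
      constructor
      · rw [mul_comm]; exact mul_le_mul_of_nonneg_left h1.1.le h2.le
      · rw [mul_comm _ (v.2 ^ d)]; exact mul_le_mul_of_nonneg_left h1.2.le h2.le
    · refine (lintegral_mono_set ?_).trans_lt hfin
      rintro _ ⟨v, hv, rfl⟩
      exact ⟨(hmem σ hσ v hv).1.1, (hmem σ hσ v hv).2⟩
  refine ⟨Ioo (-ρ) ρ ×ˢ Ioo (-ρ) ρ, prod_mem_nhds (Ioo_mem_nhds (by linarith) hρ)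
    (Ioo_mem_nhds (by linarith) hρ), ?_⟩
  filter_upwards [hchart 1 (by simp), hchart (-1) (by simp)] with r h1 h2
  have hsub : (Ioo (-ρ) ρ ×ˢ Ioo (-ρ) ρ) ∩ rightHalf ⊆ (univ ×ˢ {0}) ∪
      (monomialChart 0 1 1 '' (Ioo 0 ρ ×ˢ Ioo 0 ρ) ∪
        monomialChart 0 1 (-1) '' (Ioo 0 ρ ×ˢ Ioo 0 ρ)) := by
    rintro ⟨x, y⟩ ⟨⟨hx, hy⟩, hx0⟩
    rcases lt_trichotomy y 0 with h | h | h
    · exact Or.inr (Or.inr ⟨(x, -y), ⟨⟨hx0, hx.2⟩, by simp; exact h, by simp; linarith [hy.1]⟩,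
        by simp [monomialChart]⟩)
    · exact Or.inl ⟨mem_univ _, h⟩
    · exact Or.inr (Or.inl ⟨(x, y), ⟨⟨hx0, hx.2⟩, h, hy.2⟩, by simp [monomialChart]⟩)
  have hz : ∫⁻ p in (univ : Set ℝ) ×ˢ ({0} : Set ℝ), weight (fun v => v.2 ^ d * u v) r p = 0 := by
    rw [Measure.restrict_eq_zero.2, lintegral_zero_measure]
    rw [Measure.volume_eq_prod, Measure.prod_prod]
    simp
  refine (lintegral_mono_set hsub).trans_lt ((lintegral_union_le _ _ _).trans_lt ?_)
  rw [hz, zero_add]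
  exact (lintegral_union_le _ _ _).trans_lt (ENNReal.add_lt_top.2 ⟨h1, h2⟩)

/-- Stability is a consequence of stability after a weighted blow-up. -/
theorem StablyFiniteNear.of_blowup {m M B : ℕ} (hM : 1 ≤ M) (hB : 1 ≤ B) {Q u : ℝ × ℝ → ℝ}
    {a b : ℕ → ℝ → ℝ} (hb : ∀ k, ContinuousAt (b k) 0) (hu : ContinuousAt u (0, 0))
    (hu0 : u (0, 0) ≠ 0)
    (hQ : ∀ᶠ v in 𝓝 ((0 : ℝ), (0 : ℝ)),
      Q v = ∑ k ∈ Finset.range m, a k v.1 * v.2 ^ k + v.2 ^ (m + 1) * u v)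
    (hab : ∀ k < m, ∀ᶠ t in 𝓝 (0 : ℝ), a k (t ^ M) = t ^ (B * (m + 1 - k)) * b k t)
    {q : ℝ × ℝ} (h : FiniteNear Q 0 q)
    (hst : ∀ C : ℝ, ∃ r > 0, ∀ᶠ q' in 𝓝 q,
      ∫⁻ p in blowup M B '' (Ioo 0 r ×ˢ Icc (-C) C), weight Q q' p < ⊤) :
    StablyFiniteNear Q 0 q := by
  obtain ⟨U, hU, hfin⟩ := h
  have hupos : 0 < |u (0, 0)| := abs_pos.2 hu0
  have hnear : ∀ᶠ v in 𝓝 ((0 : ℝ), (0 : ℝ)), |u (0, 0)| / 2 < |u v| ∧ |u v| < 2 * |u (0, 0)| :=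
    (hu.abs.eventually (lt_mem_nhds (by linarith))).and
      (hu.abs.eventually (gt_mem_nhds (by linarith)))
  obtain ⟨A, hA0, hA⟩ : ∃ A > 0, ∀ᶠ t in 𝓝 (0 : ℝ), ∀ k ∈ Finset.range m, |b k t| ≤ A := by
    refine ⟨∑ k ∈ Finset.range m, |b k 0| + 1, by positivity, ?_⟩
    rw [Finset.eventually_all]
    intro k hk
    have h1 : |b k 0| < ∑ k ∈ Finset.range m, |b k 0| + 1 :=
      lt_of_le_of_lt (Finset.single_le_sum (f := fun k => |b k 0|) (fun _ _ => abs_nonneg _) hk)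
        (by linarith)
    exact ((hb k).abs.eventually (gt_mem_nhds h1)).mono fun t ht => ht.le
  have hab' : ∀ᶠ t in 𝓝 (0 : ℝ), ∀ k ∈ Finset.range m,
      a k (t ^ M) = t ^ (B * (m + 1 - k)) * b k t := by
    rw [Finset.eventually_all]
    exact fun k hk => hab k (Finset.mem_range.1 hk)
  obtain ⟨τ, hτ, hτt⟩ := Metric.eventually_nhds_iff.1 (hA.and hab')
  obtain ⟨ρ₀, hρ₀, hρ₀1, hρU⟩ := exists_square_subset (inter_mem hU (inter_mem hnear hQ))
  set ρ := min ρ₀ τ with hρdef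
  have hρ : 0 < ρ := lt_min hρ₀ hτ
  have hρ1 : ρ ≤ 1 := (min_le_left _ _).trans hρ₀1
  -- In a monomial chart with `w = t' ^ M` and `t' < η`, each of the `m` lower terms is at most `A *
  -- η * s ^ (B * (m + 1))`. This `η` keeps their sum below a quarter of `|u (0, 0)| * s ^ (B * (m +
  -- 1))`, so the top term, which is at least half of it, dominates.
  obtain ⟨η, hη, hη1, hηA⟩ : ∃ η : ℝ, 0 < η ∧ η ≤ 1 ∧ m * A * η ≤ |u (0, 0)| / 4 := by
    refine ⟨min 1 (|u (0, 0)| / 4 / (m * A + 1)), by positivity, min_le_left _ _, ?_⟩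
    have h1 : (0 : ℝ) < m * A + 1 := by positivity
    calc m * A * min 1 (|u (0, 0)| / 4 / (m * A + 1))
        ≤ (m * A + 1) * (|u (0, 0)| / 4 / (m * A + 1)) :=
          mul_le_mul (by linarith) (min_le_right _ _) (by positivity) h1.le
      _ = _ := by field_simp
  have hc : 0 < η ^ M := by positivity
  have hc1 : η ^ M ≤ 1 := pow_le_one₀ hη.le hη1
  have hmem : ∀ σ : ℝ, |σ| = 1 → ∀ v ∈ Ioo 0 (η ^ M) ×ˢ Ioo 0 ρ, monomialChart M B σ v ∈
      (U ∩ ({v | |u (0, 0)| / 2 < |u v| ∧ |u v| < 2 * |u (0, 0)|} ∩ {v | Q v =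
        ∑ k ∈ Finset.range m, a k v.1 * v.2 ^ k + v.2 ^ (m + 1) * u v})) ∩ rightHalf := by
    intro σ hσ v hv
    obtain ⟨h1, h2, h3⟩ := monomialChart_mem hM hB hσ hc1 hρ1 hv
    exact ⟨hρU _ _ ((abs_of_pos h1).trans_lt (h2.trans_le (min_le_left _ _)))
      (h3.trans_le (min_le_left _ _)), h1⟩
  have hchart : ∀ σ : ℝ, |σ| = 1 → ∀ᶠ r in 𝓝 q, ∫⁻ p in monomialChart M B σ ''
      (Ioo 0 (η ^ M) ×ˢ Ioo 0 ρ), weight Q r p < ⊤ := by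
    intro σ hσ
    refine eventually_lintegral_weight_monomialChart (D := B * (m + 1)) hB hσ hc hρ
      (by positivity : 0 < |u (0, 0)| / 4) (by positivity : 0 < 3 * |u (0, 0)|) ?_ ?_
    · rintro ⟨w, s⟩ hv
      obtain ⟨⟨-, hu1, hQv⟩, -⟩ := hmem σ hσ _ hv
      obtain ⟨⟨hw0, hwc⟩, hs0, hsρ⟩ := hv
      simp only at hw0 hwc hs0 hsρ ⊢
      simp only [mem_ofPred_eq] at hu1 hQv
      obtain ⟨t', ht'0, ht'⟩ : ∃ t : ℝ, 0 < t ∧ t ^ M = w :=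
        ⟨w ^ ((M : ℝ)⁻¹), Real.rpow_pos_of_pos hw0 _, Real.rpow_inv_natCast_pow hw0.le (by omega)⟩
      have ht'η : t' < η := lt_of_pow_lt_pow_left₀ M hη.le (by rw [ht']; exact hwc)
      have hfst : (monomialChart M B σ (w, s)).1 = (s * t') ^ M := by
        simp [monomialChart, mul_pow, ht']
      have hsnd : |(monomialChart M B σ (w, s)).2| = s ^ B := by
        simp [monomialChart, abs_mul, hσ, abs_of_pos hs0]
      have htτ : dist (s * t') 0 < τ := by
        rw [dist_zero_right, Real.norm_eq_abs, abs_of_pos (by positivity)]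
        have : s * t' ≤ s := mul_le_of_le_one_right hs0.le (by linarith)
        exact (this.trans_lt hsρ).trans_le (min_le_right _ _)
      obtain ⟨hAt, habt⟩ := hτt htτ
      set S := ∑ k ∈ Finset.range m, a k (monomialChart M B σ (w, s)).1 *
        (monomialChart M B σ (w, s)).2 ^ k with hS
      have hSle : |S| ≤ |u (0, 0)| / 4 * s ^ (B * (m + 1)) := by
        calc |S| ≤ ∑ k ∈ Finset.range m, |a k (monomialChart M B σ (w, s)).1 *
              (monomialChart M B σ (w, s)).2 ^ k| := Finset.abs_sum_le_sum_abs _ _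
          _ ≤ ∑ k ∈ Finset.range m, A * η * s ^ (B * (m + 1)) := by
              refine Finset.sum_le_sum fun k hk => ?_
              have hkm := Finset.mem_range.1 hk
              rw [hfst, habt k hk, abs_mul, abs_mul, abs_pow _ k, hsnd, mul_pow,
                abs_of_pos (by positivity : 0 < s ^ (B * (m + 1 - k)) * t' ^ (B * (m + 1 - k)))]
              have e1 : t' ^ (B * (m + 1 - k)) ≤ η := by
                refine (pow_le_of_le_one ht'0.le (by linarith) ?_).trans ht'η.le
                exact (Nat.mul_pos (by omega) (by omega)).ne'
              have e2 : s ^ (B * (m + 1)) = s ^ (B * (m + 1 - k)) * (s ^ B) ^ k := by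
                rw [← pow_mul, ← pow_add, ← mul_add, Nat.sub_add_cancel (by omega)]
              calc _ = (t' ^ (B * (m + 1 - k)) * |b k (s * t')|) *
                    (s ^ (B * (m + 1 - k)) * (s ^ B) ^ k) := by ring
                _ ≤ (η * A) * (s ^ (B * (m + 1 - k)) * (s ^ B) ^ k) := by
                    gcongr
                    exact hAt k hk
                _ = _ := by rw [e2]; ring
          _ = m * A * η * s ^ (B * (m + 1)) := by
              rw [Finset.sum_const, Finset.card_range, nsmul_eq_mul]; ring
          _ ≤ _ := by gcongr
      have hsp : 0 < s ^ (B * (m + 1)) := by positivity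
      have htop : |(monomialChart M B σ (w, s)).2 ^ (m + 1) * u (monomialChart M B σ (w, s))| =
          s ^ (B * (m + 1)) * |u (monomialChart M B σ (w, s))| := by
        rw [abs_mul, abs_pow, hsnd, ← pow_mul]
      have t1 := mul_le_mul_of_nonneg_left hu1.1.le hsp.le
      have t2 := mul_le_mul_of_nonneg_left hu1.2.le hsp.le
      rw [← htop] at t1 t2
      rw [hQv]
      constructor
      · have := abs_sub_abs_le_abs_sub
          ((monomialChart M B σ (w, s)).2 ^ (m + 1) * u (monomialChart M B σ (w, s))) (-S)
        rw [abs_neg, sub_neg_eq_add, add_comm _ S] at this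
        linarith
      · refine (abs_add_le _ _).trans ?_
        nlinarith
    · refine (lintegral_mono_set ?_).trans_lt hfin
      rintro _ ⟨v, hv, rfl⟩
      exact ⟨(hmem σ hσ v hv).1.1, (hmem σ hσ v hv).2⟩
  -- This is the width of the part of the exceptional line that the two monomial charts of opening
  -- `η ^ M` leave uncovered.
  obtain ⟨r, hr, hrfin⟩ := hst ((η⁻¹) ^ B)
  have hrM : 0 < r ^ M := by positivity
  have hρB : 0 < ρ ^ B := by positivity
  refine ⟨Ioo (-r ^ M) (r ^ M) ×ˢ Ioo (-ρ ^ B) (ρ ^ B),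
    prod_mem_nhds (Ioo_mem_nhds (by linarith) hrM) (Ioo_mem_nhds (by linarith) hρB), ?_⟩
  filter_upwards [hrfin, hchart 1 (by simp), hchart (-1) (by simp)] with q' h0 h1 h2
  refine (lintegral_mono_set (t := blowup M B '' (Ioo 0 r ×ˢ Icc (-((η⁻¹) ^ B)) ((η⁻¹) ^ B)) ∪
      (monomialChart M B 1 '' (Ioo 0 (η ^ M) ×ˢ Ioo 0 ρ) ∪
        monomialChart M B (-1) '' (Ioo 0 (η ^ M) ×ˢ Ioo 0 ρ))) ?_).trans_lt ?_
  · rintro ⟨x, y⟩ ⟨⟨hx, hy⟩, hx0⟩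
    exact mem_blowup_or_monomialChart hM hB hη hr hρ hx0 hx.2 (abs_lt.2 ⟨hy.1, hy.2⟩)
  · refine (lintegral_union_le _ _ _).trans_lt (ENNReal.add_lt_top.2 ⟨h0, ?_⟩)
    exact (lintegral_union_le _ _ _).trans_lt (ENNReal.add_lt_top.2 ⟨h1, h2⟩)

/-- The term of degree `k` in `y` receives `t ^ (B * k)` from `y ^ k` and `t ^ (B * (m + 1 - k))`
from its coefficient, so all terms share the factor `t ^ (B * (m + 1))`. -/
theorem blowup_identity {m M B : ℕ} (hM : 1 ≤ M) (hB : 1 ≤ B) {Q u : ℝ × ℝ → ℝ}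
    {a b : ℕ → ℝ → ℝ}
    (hQ : ∀ᶠ v in 𝓝 ((0 : ℝ), (0 : ℝ)),
      Q v = ∑ k ∈ Finset.range m, a k v.1 * v.2 ^ k + v.2 ^ (m + 1) * u v)
    (hab : ∀ k < m, ∀ᶠ t in 𝓝 (0 : ℝ), a k (t ^ M) = t ^ (B * (m + 1 - k)) * b k t) (z : ℝ) :
    ∀ᶠ v in 𝓝 ((0 : ℝ), z), Q (blowup M B v) = v.1 ^ (B * (m + 1)) *
      (∑ k ∈ Finset.range m, b k v.1 * v.2 ^ k + v.2 ^ (m + 1) * u (blowup M B v)) := by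
  have hab' : ∀ᶠ t in 𝓝 (0 : ℝ), ∀ k ∈ Finset.range m,
      a k (t ^ M) = t ^ (B * (m + 1 - k)) * b k t := by
    rw [Finset.eventually_all]
    exact fun k hk => hab k (Finset.mem_range.1 hk)
  have hfst : Tendsto (fun v : ℝ × ℝ => v.1) (𝓝 ((0, z) : ℝ × ℝ)) (𝓝 0) :=
    continuous_fst.tendsto' _ _ rfl
  have hbl : Tendsto (blowup M B) (𝓝 (0, z)) (𝓝 (0, 0)) :=
    (continuous_blowup M B).tendsto' _ _ (blowup_zero_left hM hB z)
  filter_upwards [hfst.eventually hab', hbl.eventually hQ] with v h1 h2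
  rw [h2, mul_add, Finset.mul_sum]
  congr 1
  · refine Finset.sum_congr rfl fun k hk => ?_
    simp only [blowup]
    have hkm := Finset.mem_range.1 hk
    rw [h1 k hk, mul_pow, ← pow_mul]
    have : v.1 ^ (B * (m + 1)) = v.1 ^ (B * (m + 1 - k)) * v.1 ^ (B * k) := by
      rw [← pow_add, ← mul_add, Nat.sub_add_cancel (by omega)]
    rw [this]; ring
  · simp only [blowup]
    rw [mul_pow, ← pow_mul]; ring

/-- Openness of the set of exponents of local integrability for analytic functions of two variables
which are regular in the second variable. -/
theorem FiniteNear.stable (n : ℕ) {F : ℝ × ℝ → ℝ} {y : ℝ} (hF : AnalyticAt ℝ F (0, y))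
    (hord : analyticOrderAt (fun z => F (0, z)) y = n) {q : ℝ × ℝ} (h : FiniteNear F y q) :
    StablyFiniteNear F y q := by
  induction n using Nat.strong_induction_on generalizing F y q with
  | _ n ih =>
  -- translation to the origin
  let F₀ : ℝ × ℝ → ℝ := F ∘ shear fun _ => y
  have hF₀e : F₀ = fun v : ℝ × ℝ => F (v.1, y + v.2) := rfl
  have hF₀ : AnalyticAt ℝ F₀ (0, 0) := by
    rw [hF₀e]
    exact AnalyticAt.fun_comp (g := F) (f := fun v : ℝ × ℝ => (v.1, y + v.2)) (x := (0, 0))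
      (by simpa using hF) (by fun_prop)
  have hslice : AnalyticAt ℝ (fun z => F (0, z)) y :=
    AnalyticAt.fun_comp (g := F) (f := fun z : ℝ => ((0 : ℝ), z)) (x := y) hF (by fun_prop)
  have hslice₀ : AnalyticAt ℝ (fun z => F₀ (0, z)) 0 :=
    AnalyticAt.fun_comp (g := F₀) (f := fun z : ℝ => ((0 : ℝ), z)) (x := (0 : ℝ)) hF₀ (by fun_prop)
  have hord₀ : analyticOrderAt (fun z => F₀ (0, z)) 0 = n := by
    rw [hslice.analyticOrderAt_eq_natCast] at hord
    obtain ⟨g, hg, hg0, hgF⟩ := hord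
    rw [hslice₀.analyticOrderAt_eq_natCast]
    have ht : Tendsto (fun z : ℝ => y + z) (𝓝 0) (𝓝 y) :=
      (by fun_prop : Continuous fun z : ℝ => y + z).tendsto' _ _ (add_zero y)
    refine ⟨fun z => g (y + z), AnalyticAt.fun_comp (g := g) (f := fun z : ℝ => y + z) (x := (0 : ℝ))
      (by simpa using hg) (by fun_prop), by simpa using hg0, ?_⟩
    filter_upwards [ht.eventually hgF] with z hz
    simpa [hF₀e] using hz
  have hdiff : ∀ᶠ x in 𝓝 (0 : ℝ), DifferentiableAt ℝ (fun _ : ℝ => y) x := by simp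
  have h₀ : FiniteNear F₀ 0 q := FiniteNear.comp_shear hdiff (by simpa using h)
  suffices hs : StablyFiniteNear F₀ 0 q by simpa using hs.of_comp_shear hdiff
  clear_value F₀
  -- In order `0` the function is a unit, that is, the monomial case with exponent `0`.
  rcases n with _ | m
  · have h00 : F₀ (0, 0) ≠ 0 := by
      have h1 : ¬ analyticOrderAt (fun z => F₀ (0, z)) 0 ≠ 0 := by simpa using hord₀
      rw [hslice₀.analyticOrderAt_ne_zero] at h1
      exact h1
    have := StablyFiniteNear.of_monomial (d := 0) (q := q) hF₀.continuousAt h00 (by simpa using h₀)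
    simpa using this
  obtain ⟨ψ, a, u, hψ, hψ0, ha, ha0, hu, hu0, hFe⟩ := exists_tschirnhaus hF₀ hord₀
  have hψd : ∀ᶠ x in 𝓝 (0 : ℝ), DifferentiableAt ℝ ψ x :=
    hψ.eventually_analyticAt.mono fun x hx => hx.differentiableAt
  have h₁ : FiniteNear (F₀ ∘ shear ψ) 0 q := FiniteNear.comp_shear hψd (by simpa [hψ0] using h₀)
  suffices hs : StablyFiniteNear (F₀ ∘ shear ψ) 0 q by simpa [hψ0] using hs.of_comp_shear hψd
  by_cases hall : ∀ k < m, ∀ᶠ x in 𝓝 (0 : ℝ), a k x = 0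
  · have hmon : F₀ ∘ shear ψ =ᶠ[𝓝 (0, 0)] fun v => v.2 ^ (m + 1) * u v := by
      have hfst : Tendsto (fun v : ℝ × ℝ => v.1) (𝓝 ((0, 0) : ℝ × ℝ)) (𝓝 0) :=
        continuous_fst.tendsto' _ _ rfl
      have hall' : ∀ᶠ x in 𝓝 (0 : ℝ), ∀ k ∈ Finset.range m, a k x = 0 := by
        rw [Finset.eventually_all]
        exact fun k hk => hall k (Finset.mem_range.1 hk)
      filter_upwards [hFe, hfst.eventually hall'] with v h1 h2
      refine h1.trans ?_
      rw [Finset.sum_eq_zero fun k hk => by rw [h2 k hk, zero_mul], zero_add]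
    exact (StablyFiniteNear.of_monomial hu.continuousAt hu0 (h₁.congr hmon)).congr hmon.symm
  · obtain ⟨M, B, b, hM, hB, hb, hb0, hab⟩ := exists_scaling (d := m + 1) (by omega) ha ha0 hall
    refine StablyFiniteNear.of_blowup hM hB (fun k => (hb k).continuousAt) hu.continuousAt hu0 hFe
      hab h₁ ?_
    have hid := blowup_identity hM hB (Q := F₀ ∘ shear ψ) hFe hab
    refine eventually_lintegral_weight_blowup hM hid fun z => ?_
    have hbl0 := blowup_zero_left hM hB
    have hQ₁ : AnalyticAt ℝ (fun v : ℝ × ℝ => ∑ k ∈ Finset.range m, b k v.1 * v.2 ^ k +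
        v.2 ^ (m + 1) * u (blowup M B v)) (0, z) := by
      have h1 : AnalyticAt ℝ (fun v => u (blowup M B v)) (0, z) :=
        AnalyticAt.fun_comp (g := u) (f := blowup M B) (x := (0, z)) (by rwa [hbl0 z])
          (by unfold blowup; fun_prop)
      have h2 : ∀ k, AnalyticAt ℝ (fun v : ℝ × ℝ => b k v.1) (0, z) := fun k =>
        AnalyticAt.fun_comp (g := b k) (f := fun v : ℝ × ℝ => v.1) (x := (0, z)) (hb k) (by fun_prop)
      refine AnalyticAt.fun_add (Finset.analyticAt_fun_sum _ fun k _ => ?_)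
        ((analyticAt_snd.pow _).mul h1)
      exact (h2 k).mul (analyticAt_snd.pow _)
    -- On the exceptional line `t = 0` the transformed function is a polynomial in `z` without a
    -- term of degree `m` that is not a monomial. Its order at every `z` is thus at most `m`, and
    -- induction applies there with the new exponents.
    have hlt := analyticOrderAt_lt_of_coeff_eq_zero (c := fun k => b k 0) hu0 hb0 z
    obtain ⟨n', hn'⟩ := ENat.ne_top_iff_exists.1 (ne_top_of_lt hlt)
    rw [← hn'] at hlt
    refine ih n' (by exact_mod_cast hlt) hQ₁ ?_ (h₁.comp_blowup hM hB (hid z))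
    rw [hn']
    congr 1
    funext y
    simp [hbl0]

/-! ### Openness of the exponents of integrability in the plane -/

/-- If the restriction to a line vanishes near `0`, the identity theorem makes it vanish on the
whole segment inside a ball of analyticity. If this held for all lines, the function would vanish on
the ball. -/
theorem exists_direction_not_eventually_zero {E : Type*} [NormedAddCommGroup E] [NormedSpace ℝ E]
    [Nontrivial E] {G : E → ℝ} (hG : AnalyticAt ℝ G 0)
    (hne : ¬ ∀ᶠ x in 𝓝 (0 : E), G x = 0) :
    ∃ v : E, v ≠ 0 ∧ ¬ ∀ᶠ s in 𝓝 (0 : ℝ), G (s • v) = 0 := by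
  by_contra! hall
  refine hne ?_
  obtain ⟨r, hr, hball⟩ := Metric.eventually_nhds_iff_ball.1 hG.eventually_analyticAt
  filter_upwards [Metric.ball_mem_nhds (0 : E) hr] with x hx
  rcases eq_or_ne x 0 with rfl | hx0
  · obtain ⟨w, hw⟩ := exists_ne (0 : E)
    simpa using (hall w hw).self_of_nhds
  have hlin : Continuous fun s : ℝ => s • x := by fun_prop
  have hpre : IsPreconnected ((fun s : ℝ => s • x) ⁻¹' Metric.ball 0 r) := by
    have : Convex ℝ ((fun s : ℝ => s • x) ⁻¹' Metric.ball 0 r) :=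
      (convex_ball (0 : E) r).linear_preimage (LinearMap.toSpanSingleton ℝ E x)
    exact this.isPreconnected
  have han : AnalyticOnNhd ℝ (fun s : ℝ => G (s • x)) ((fun s : ℝ => s • x) ⁻¹' Metric.ball 0 r) :=
    fun s hs => AnalyticAt.fun_comp (g := G) (f := fun s : ℝ => s • x) (x := s) (hball _ hs)
      (by fun_prop)
  have := han.eqOn_zero_of_preconnected_of_eventuallyEq_zero hpre (z₀ := 0) (by simpa using hr)
    (hall x hx0) (show (1 : ℝ) ∈ _ by simpa using hx)
  simpa using this

theorem matMap_apply (a b c d : ℝ) (v : ℝ × ℝ) :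
    matMap a b c d v = (a * v.1 + b * v.2, c * v.1 + d * v.2) := by
  simp [matMap]

theorem matMap_bijective {a b c d : ℝ} (h : a * d - b * c ≠ 0) :
    Function.Bijective (matMap a b c d) := by
  constructor
  · rintro ⟨x, y⟩ ⟨x', y'⟩ hxy
    simp only [matMap_apply, Prod.mk.injEq] at hxy ⊢
    obtain ⟨h1, h2⟩ := hxy
    constructor
    · apply mul_left_cancel₀ h; linear_combination d * h1 - b * h2
    · apply mul_left_cancel₀ h; linear_combination a * h2 - c * h1
  · rintro ⟨x, y⟩
    refine ⟨((d * x - b * y) / (a * d - b * c), (a * y - c * x) / (a * d - b * c)), ?_⟩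
    simp only [matMap_apply, Prod.mk.injEq]
    constructor <;> rw [mul_div_assoc', mul_div_assoc', ← add_div, div_eq_iff h] <;> ring

theorem lintegral_image_matMap {a b c d : ℝ} (h : a * d - b * c ≠ 0) {s : Set (ℝ × ℝ)}
    (hs : MeasurableSet s) (g : ℝ × ℝ → ℝ≥0∞) :
    ∫⁻ x in matMap a b c d '' s, g x =
      ENNReal.ofReal |a * d - b * c| * ∫⁻ x in s, g (matMap a b c d x) := by
  rw [lintegral_image_eq_lintegral_abs_det_fderiv_mul volume hs
    (fun x _ => (matMap a b c d).hasFDerivAt.hasFDerivWithinAt) (matMap_bijective h).1.injOn,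
    det_matMap, lintegral_const_mul' _ _ ENNReal.ofReal_ne_top]

/-- At a zero of `F` the real power in `weight` is `0` while the power in `ℝ≥0∞` is `⊤`; elsewhere
the two agree. Hence only an inequality here, and a nonvanishing hypothesis in `rpow_eq_weight`. -/
theorem weight_le_rpow (F : ℝ × ℝ → ℝ) {a : ℝ} (ha : 0 < a) (v : ℝ × ℝ) :
    weight F (0, a) v ≤ ENNReal.ofReal |F v| ^ (-a) := by
  rw [weight, Real.rpow_zero, one_mul]
  rcases eq_or_ne (F v) 0 with h | h
  · simp [h, Real.zero_rpow (neg_ne_zero.2 ha.ne')]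
  · rw [ENNReal.ofReal_rpow_of_pos (abs_pos.2 h)]

theorem rpow_eq_weight {F : ℝ × ℝ → ℝ} {v : ℝ × ℝ} (h : F v ≠ 0) (a : ℝ) :
    ENNReal.ofReal |F v| ^ (-a) = weight F (0, a) v := by
  rw [weight, Real.rpow_zero, one_mul, ENNReal.ofReal_rpow_of_pos (abs_pos.2 h)]

/-- The stable finiteness near the origin on one side of a line, for the function `G` itself. -/
theorem exists_half_neighbourhood {G : ℝ × ℝ → ℝ} (hG : AnalyticAt ℝ G (0, 0)) {a b c d : ℝ}
    (hdet : a * d - b * c ≠ 0) (hbd : ¬ ∀ᶠ s in 𝓝 (0 : ℝ), G (s • (b, d)) = 0) {α : ℝ} (hα : 0 < α)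
    {U : Set (ℝ × ℝ)} (hU : U ∈ 𝓝 ((0 : ℝ), (0 : ℝ)))
    (hfin : ∫⁻ x in U, ENNReal.ofReal |G x| ^ (-α) < ⊤) :
    ∃ V ∈ 𝓝 ((0 : ℝ), (0 : ℝ)), ∀ᶠ r in 𝓝 α,
      ∫⁻ x in matMap a b c d '' (V ∩ rightHalf), weight G (0, r) x < ⊤ := by
  let L := matMap a b c d
  have hL0 : L (0, 0) = (0, 0) := by simp [L, matMap_apply]
  have hLc : Continuous L := L.continuous
  have hF : AnalyticAt ℝ (G ∘ L) (0, 0) :=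
    AnalyticAt.comp (by rwa [hL0]) (L.analyticAt _)
  have hslice : AnalyticAt ℝ (fun y => (G ∘ L) (0, y)) 0 :=
    AnalyticAt.fun_comp (g := G ∘ L) (f := fun y : ℝ => ((0 : ℝ), y)) (x := (0 : ℝ)) hF (by fun_prop)
  -- The map `L` sends `(0, y)` to `y • (b, d)`, a direction along which `G` is not identically
  -- zero.
  have hord : analyticOrderAt (fun y => (G ∘ L) (0, y)) 0 ≠ ⊤ := by
    rw [Ne, analyticOrderAt_eq_top]
    refine fun h => hbd (h.mono fun s hs => ?_)
    simpa [L, matMap_apply, mul_comm] using hs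
  obtain ⟨n, hn⟩ := ENat.ne_top_iff_exists.1 hord
  obtain ⟨O, hOs, hOo, hO0⟩ := mem_nhds_iff.1
    (hLc.continuousAt.preimage_mem_nhds (x := ((0 : ℝ), (0 : ℝ))) (by rwa [hL0]))
  have hbase : FiniteNear (G ∘ L) 0 (0, α) := by
    refine ⟨O, hOo.mem_nhds hO0, ?_⟩
    have h1 := lintegral_image_matMap hdet (hOo.measurableSet.inter measurableSet_rightHalf)
      fun x => ENNReal.ofReal |G x| ^ (-α)
    have h2 : ∫⁻ x in L '' (O ∩ rightHalf), ENNReal.ofReal |G x| ^ (-α) < ⊤ := by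
      refine (lintegral_mono_set ?_).trans_lt hfin
      rintro _ ⟨v, hv, rfl⟩
      exact hOs hv.1
    rw [h1, ENNReal.mul_lt_top_iff] at h2
    have h3 : ∫⁻ x in O ∩ rightHalf, ENNReal.ofReal |G (L x)| ^ (-α) < ⊤ := by
      rcases h2 with h2 | h2 | h2
      · exact h2.2
      · rw [ENNReal.ofReal_eq_zero] at h2
        exact absurd h2 (not_le.2 (abs_pos.2 hdet))
      · rw [h2]; exact ENNReal.zero_lt_top
    exact (lintegral_mono fun v => weight_le_rpow (G ∘ L) hα v).trans_lt h3
  obtain ⟨V, hV, hVfin⟩ := FiniteNear.stable n hF hn.symm hbase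
  obtain ⟨W, hWs, hWo, hW0⟩ := mem_nhds_iff.1 hV
  refine ⟨W, hWo.mem_nhds hW0, ?_⟩
  have hc : Continuous fun r : ℝ => ((0 : ℝ), r) := by fun_prop
  filter_upwards [hc.continuousAt.eventually hVfin] with r hr
  rw [lintegral_image_matMap hdet (hWo.measurableSet.inter measurableSet_rightHalf)]
  refine ENNReal.mul_lt_top ENNReal.ofReal_lt_top ?_
  exact (lintegral_mono_set (inter_subset_inter_left _ hWs)).trans_lt (by simpa [weight, L] using hr)

/-- For a real analytic function of two variables, the set of exponents `α` for which
`|G| ^ (-α)` is integrable near the origin is open. -/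
theorem eventually_lintegral_rpow_lt_top {G : ℝ × ℝ → ℝ} (hG : AnalyticAt ℝ G (0, 0)) {α : ℝ}
    (hα : 0 < α) {U : Set (ℝ × ℝ)} (hU : U ∈ 𝓝 ((0 : ℝ), (0 : ℝ)))
    (hfin : ∫⁻ x in U, ENNReal.ofReal |G x| ^ (-α) < ⊤) :
    ∃ V ∈ 𝓝 ((0 : ℝ), (0 : ℝ)), ∀ᶠ r in 𝓝 α, ∫⁻ x in V, ENNReal.ofReal |G x| ^ (-r) < ⊤ := by
  obtain ⟨O, hOs, hOo, hO0⟩ := mem_nhds_iff.1 (inter_mem hU hG.eventually_analyticAt)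
  have hGm : MeasurableSet (O ∩ {x | G x = 0}) := by
    have h1 : IsOpen (O ∩ G ⁻¹' {0}ᶜ) := ContinuousOn.isOpen_inter_preimage
      (fun x hx => (hOs hx).2.continuousAt.continuousWithinAt) hOo isOpen_compl_singleton
    have h2 : O ∩ {x | G x = 0} = O \ (O ∩ G ⁻¹' {0}ᶜ) := by ext x; simp
    rw [h2]
    exact hOo.measurableSet.diff h1.measurableSet
  -- The integrand is `⊤` on the zero set, so a finite integral forces this set to be null. In
  -- particular `G` is not identically zero near the origin.
  have hZ : volume (O ∩ {x | G x = 0}) = 0 := by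
    by_contra hpos
    have h1 : ∫⁻ x in O ∩ {x | G x = 0}, (⊤ : ℝ≥0∞) ≤ ∫⁻ x in U, ENNReal.ofReal |G x| ^ (-α) := by
      refine le_trans (setLIntegral_mono' hGm fun x hx => ?_)
        (lintegral_mono_set fun x hx => (hOs hx.1).1)
      have : G x = 0 := hx.2
      simp [this, ENNReal.zero_rpow_of_neg (neg_lt_zero.2 hα)]
    rw [setLIntegral_const, ENNReal.top_mul hpos] at h1
    exact absurd (h1.trans_lt hfin) (lt_irrefl _)
  have hne : ¬ ∀ᶠ x in 𝓝 ((0 : ℝ), (0 : ℝ)), G x = 0 := by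
    intro h
    have h2 : O ∩ {x | G x = 0} ∈ 𝓝 ((0 : ℝ), (0 : ℝ)) := inter_mem (hOo.mem_nhds hO0) h
    exact (Measure.measure_pos_of_mem_nhds volume h2).ne' hZ
  obtain ⟨⟨v₁, v₂⟩, hv0, hv⟩ := exists_direction_not_eventually_zero (G := G) hG hne
  -- Both matrices used send `(0, 1)` to `(v₁, v₂)`, and they send the right half-plane to opposite
  -- sides of that line.
  have hdet : v₂ * v₂ - v₁ * -v₁ ≠ 0 := by
    intro h
    have h1 : v₁ = 0 := by nlinarith [sq_nonneg v₁, sq_nonneg v₂]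
    have h2 : v₂ = 0 := by nlinarith [sq_nonneg v₁, sq_nonneg v₂]
    exact hv0 (by simp [h1, h2])
  have hdet' : -v₂ * v₂ - v₁ * v₁ ≠ 0 := fun h => hdet (by linarith)
  obtain ⟨V, hV, hVf⟩ := exists_half_neighbourhood hG hdet hv hα hU hfin
  obtain ⟨V', hV', hVf'⟩ := exists_half_neighbourhood hG hdet' hv hα hU hfin
  have himage : ∀ {a b c d : ℝ}, a * d - b * c ≠ 0 → ∀ {V : Set (ℝ × ℝ)},
      V ∈ 𝓝 ((0 : ℝ), (0 : ℝ)) → matMap a b c d '' V ∈ 𝓝 ((0 : ℝ), (0 : ℝ)) := by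
    intro a b c d h V hV
    have := ((matMap a b c d).isOpenMap (matMap_bijective h).2).image_mem_nhds hV
    simpa [matMap_apply] using this
  obtain ⟨W, hWs, hWo, hW0⟩ := mem_nhds_iff.1 (inter_mem (hOo.mem_nhds hO0)
    (inter_mem (himage hdet hV) (himage hdet' hV')))
  refine ⟨W, hWo.mem_nhds hW0, ?_⟩
  have hline : volume (matMap v₂ v₁ (-v₁) v₂ '' ({0} ×ˢ univ)) = 0 := by
    rw [Measure.addHaar_image_continuousLinearMap, Measure.volume_eq_prod, Measure.prod_prod]
    simp
  filter_upwards [hVf, hVf', lt_mem_nhds hα] with r h1 h2 hr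
  have hcover : W ⊆ (matMap v₂ v₁ (-v₁) v₂ '' ({0} ×ˢ univ)) ∪
      (matMap v₂ v₁ (-v₁) v₂ '' (V ∩ rightHalf) ∪ matMap (-v₂) v₁ v₁ v₂ '' (V' ∩ rightHalf)) := by
    intro w hw
    obtain ⟨-, ⟨x, hx, hxw⟩, ⟨y, hy, hyw⟩⟩ := hWs hw
    have hxy : y = (-x.1, x.2) := by
      apply (matMap_bijective hdet').1
      rw [hyw, ← hxw]
      simp [matMap_apply]
    rcases lt_trichotomy x.1 0 with h | h | h
    · refine Or.inr (Or.inr ⟨y, ⟨hy, ?_⟩, hyw⟩)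
      rw [hxy]
      simpa [rightHalf] using h
    · exact Or.inl ⟨x, ⟨h, mem_univ _⟩, hxw⟩
    · exact Or.inr (Or.inl ⟨x, ⟨hx, h⟩, hxw⟩)
  -- The indicator restores the value `⊤` on the zero set, where `weight` is too small; it is
  -- integrated over a null set.
  have hle : ∫⁻ x in W, ENNReal.ofReal |G x| ^ (-r) ≤ ∫⁻ x in W, (weight G (0, r) x +
      (O ∩ {x | G x = 0}).indicator (fun _ => ⊤) x) := by
    refine setLIntegral_mono' hWo.measurableSet fun x hx => ?_
    by_cases hx0 : G x = 0
    · rw [indicator_of_mem (show x ∈ O ∩ {x | G x = 0} from ⟨(hWs hx).1, hx0⟩), add_top]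
      exact le_top
    · rw [rpow_eq_weight hx0]
      exact le_self_add
  refine hle.trans_lt ?_
  rw [lintegral_add_right _ (measurable_const.indicator hGm), lintegral_indicator hGm,
    setLIntegral_const, Measure.restrict_apply hGm,
    measure_mono_null inter_subset_left hZ, mul_zero, add_zero]
  refine (lintegral_mono_set hcover).trans_lt ((lintegral_union_le _ _ _).trans_lt ?_)
  rw [setLIntegral_measure_zero _ _ hline, zero_add]
  exact (lintegral_union_le _ _ _).trans_lt (ENNReal.add_lt_top.2 ⟨h1, h2⟩)

/-! ### Symmetry of the iterated derivative of a smooth function -/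

theorem contDiffAt_iteratedFDeriv_apply {E : Type*} [NormedAddCommGroup E] [NormedSpace ℝ E]
    {f : E → ℝ} {x : E} {n k : ℕ} (hf : ContDiffAt ℝ (k + n : ℕ) f x) (v : Fin n → E) :
    ContDiffAt ℝ k (fun y => iteratedFDeriv ℝ n f y v) x := by
  have h := hf.iteratedFDeriv_right (m := k) (i := n) (by push_cast; exact le_rfl)
  exact (ContinuousMultilinearMap.apply ℝ (fun _ : Fin n => E) ℝ v).contDiff.contDiffAt.comp x h

theorem iteratedFDeriv_succ_apply_eq_fderiv {E : Type*} [NormedAddCommGroup E] [NormedSpace ℝ E]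
    {f : E → ℝ} {x : E} {n : ℕ} (hf : ContDiffAt ℝ (n + 1 : ℕ) f x) (v : Fin (n + 1) → E) :
    iteratedFDeriv ℝ (n + 1) f x v =
      fderiv ℝ (fun y => iteratedFDeriv ℝ n f y (Fin.tail v)) x (v 0) :=
  (hf.differentiableAt_iteratedFDeriv
    (by exact_mod_cast n.lt_succ_self)).iteratedFDeriv_succ_apply_left'

/-- Swapping the two outermost slots is the symmetry of a second derivative. Any other adjacent swap
fixes the outermost slot and reduces to one order less under the derivative sign. -/
theorem iteratedFDeriv_comp_adjacent_swap {E : Type*} [NormedAddCommGroup E] [NormedSpace ℝ E]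
    {f : E → ℝ} (n : ℕ) : ∀ {x : E}, ContDiffAt ℝ (n + 1 : ℕ) f x → ∀ (v : Fin (n + 1) → E)
    (i : Fin n), iteratedFDeriv ℝ (n + 1) f x (v ∘ Equiv.swap i.castSucc i.succ) =
      iteratedFDeriv ℝ (n + 1) f x v := by
  induction n with
  | zero => exact fun _ _ i => i.elim0
  | succ n ih =>
    intro x hf v i
    have hnear : ∀ᶠ y in 𝓝 x, ContDiffAt ℝ (n + 1 + 1 : ℕ) f y := hf.eventually (by simp)
    refine Fin.cases ?_ (fun j => ?_) i
    · have key : ∀ w : Fin (n + 1 + 1) → E, iteratedFDeriv ℝ (n + 1 + 1) f x w =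
          fderiv ℝ (fderiv ℝ fun z => iteratedFDeriv ℝ n f z (Fin.tail (Fin.tail w))) x
            (w 0) (w 1) := by
        intro w
        have hg : ContDiffAt ℝ (2 : ℕ) (fun z => iteratedFDeriv ℝ n f z (Fin.tail (Fin.tail w))) x :=
          contDiffAt_iteratedFDeriv_apply (by rwa [show 2 + n = n + 1 + 1 by omega]) _
        have hg' : DifferentiableAt ℝ
            (fderiv ℝ fun z => iteratedFDeriv ℝ n f z (Fin.tail (Fin.tail w))) x :=
          (hg.fderiv_right (m := 1) (by norm_num)).differentiableAt (by simp)
        rw [iteratedFDeriv_succ_apply_eq_fderiv hf]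
        have heq : (fun y => iteratedFDeriv ℝ (n + 1) f y (Fin.tail w)) =ᶠ[𝓝 x] fun y =>
            fderiv ℝ (fun z => iteratedFDeriv ℝ n f z (Fin.tail (Fin.tail w))) y (w 1) := by
          filter_upwards [hnear] with y hy
          rw [iteratedFDeriv_succ_apply_eq_fderiv (hy.of_le (by exact_mod_cast Nat.le_succ _))]
          rfl
        rw [heq.fderiv_eq, fderiv_clm_apply hg' (by fun_prop)]
        simp
      rw [key, key]
      have hg : ContDiffAt ℝ (2 : ℕ) (fun z => iteratedFDeriv ℝ n f z (Fin.tail (Fin.tail v))) x :=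
        contDiffAt_iteratedFDeriv_apply (by rwa [show 2 + n = n + 1 + 1 by omega]) _
      have htail : Fin.tail (Fin.tail (v ∘ Equiv.swap (Fin.castSucc 0) (Fin.succ 0))) =
          Fin.tail (Fin.tail v) := by
        funext k
        simp only [Fin.tail, Function.comp]
        rw [Equiv.swap_apply_of_ne_of_ne]
        · exact Fin.succ_ne_zero _
        · intro h
          exact Fin.succ_ne_zero _ (Fin.succ_injective _ h)
      rw [htail]
      have h0 : (v ∘ Equiv.swap (Fin.castSucc 0) (Fin.succ 0)) 0 = v 1 := by simp
      have h1 : (v ∘ Equiv.swap (Fin.castSucc 0) (Fin.succ 0)) 1 = v 0 := by simp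
      rw [h0, h1]
      exact hg.isSymmSndFDerivAt (by simp) _ _
    · rw [iteratedFDeriv_succ_apply_eq_fderiv hf, iteratedFDeriv_succ_apply_eq_fderiv hf]
      have h0 : (v ∘ Equiv.swap j.succ.castSucc j.succ.succ) 0 = v 0 := by
        simp only [Function.comp]
        rw [Equiv.swap_apply_of_ne_of_ne]
        · rw [← Fin.succ_castSucc]; exact (Fin.succ_ne_zero _).symm
        · exact (Fin.succ_ne_zero _).symm
      have htail : Fin.tail (v ∘ Equiv.swap j.succ.castSucc j.succ.succ) =
          Fin.tail v ∘ Equiv.swap j.castSucc j.succ := by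
        funext k
        simp only [Fin.tail, Function.comp]
        congr 1
        rw [← Fin.succ_castSucc]
        exact ((Fin.succ_injective _).map_swap _ _ _).symm
      rw [h0, htail]
      have heq : (fun y => iteratedFDeriv ℝ (n + 1) f y
          (Fin.tail v ∘ Equiv.swap j.castSucc j.succ)) =ᶠ[𝓝 x]
          fun y => iteratedFDeriv ℝ (n + 1) f y (Fin.tail v) := by
        filter_upwards [hnear] with y hy
        exact ih (hy.of_le (by exact_mod_cast Nat.le_succ _)) _ _
      rw [heq.fderiv_eq]

theorem iteratedFDeriv_comp_perm {E : Type*} [NormedAddCommGroup E] [NormedSpace ℝ E]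
    {f : E → ℝ} {n : ℕ} {x : E} (hf : ContDiffAt ℝ n f x) (v : Fin n → E)
    (σ : Equiv.Perm (Fin n)) :
    iteratedFDeriv ℝ n f x (v ∘ σ) = iteratedFDeriv ℝ n f x v := by
  rcases n with _ | n
  · congr 1; funext i; exact i.elim0
  have hσ : σ ∈ Submonoid.closure (range fun i : Fin n => Equiv.swap i.castSucc i.succ) := by
    rw [Equiv.Perm.mclosure_swap_castSucc_succ]; trivial
  induction hσ using Submonoid.closure_induction generalizing v with
  | mem τ hτ =>
    obtain ⟨i, rfl⟩ := hτ
    exact iteratedFDeriv_comp_adjacent_swap n hf v i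
  | one => rfl
  | mul τ τ' _ _ h h' =>
    rw [show v ∘ (τ * τ' : Equiv.Perm (Fin (n + 1))) = (v ∘ τ) ∘ τ' from rfl, h', h]

/-! ### Taylor expansions and the Newton polyhedron -/

/-- By symmetry only the number of slots holding the first basis vector matters: a permutation
carries `s` to the first `s.card` slots. -/
theorem iteratedFDeriv_piecewise_eq_taylorCoeff {f : E2 → ℝ} {n : ℕ} (hf : ContDiffAt ℝ n f 0)
    (s : Finset (Fin n)) :
    iteratedFDeriv ℝ n f 0 (s.piecewise (fun _ => EuclideanSpace.single (0 : Fin 2) (1 : ℝ))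
      (fun _ => EuclideanSpace.single (1 : Fin 2) (1 : ℝ))) =
      taylorCoeff f s.card (n - s.card) * ((s.card.factorial : ℝ) * (n - s.card).factorial) := by
  have hcard : s.card ≤ n := by simpa using s.card_le_univ
  obtain ⟨k, hk⟩ : ∃ k, n = s.card + k := ⟨n - s.card, by omega⟩
  obtain ⟨j, hj⟩ : ∃ j, j = s.card := ⟨_, rfl⟩
  rw [← hj] at hk ⊢
  subst hk
  rw [Nat.add_sub_cancel_left, taylorCoeff, div_mul_cancel₀ _ (by positivity)]
  let e : {i : Fin (j + k) // i ∈ s} ≃ {i : Fin (j + k) // i.val < j} :=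
    Fintype.equivOfCardEq (by
      rw [Fintype.card_coe, ← hj, Fintype.card_subtype]
      have : (Finset.univ.filter fun i : Fin (j + k) => i.val < j) =
          (Finset.univ : Finset (Fin j)).map (Fin.castAddEmb k) := by
        ext i
        simp only [Finset.mem_filter, Finset.mem_univ, true_and, Finset.mem_map]
        exact ⟨fun h => ⟨⟨i, h⟩, by ext; simp⟩, by rintro ⟨a, rfl⟩; simp⟩
      rw [this]; simp)
  rw [← iteratedFDeriv_comp_perm hf (Fin.append _ _) e.extendSubtype]
  congr 1
  funext i
  by_cases hi : i ∈ s
  · have h1 : (e.extendSubtype i).val < j := by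
      rw [e.extendSubtype_apply_of_mem i hi]; exact (e ⟨i, hi⟩).2
    rw [Finset.piecewise_eq_of_mem _ _ _ hi]
    have : e.extendSubtype i = Fin.castAdd k ⟨(e.extendSubtype i).val, h1⟩ := by ext; simp
    rw [Function.comp_apply, this, Fin.append_left]
  · have h1 : ¬ (e.extendSubtype i).val < j := e.extendSubtype_not_mem i hi
    rw [Finset.piecewise_eq_of_notMem _ _ _ hi]
    have : e.extendSubtype i = Fin.natAdd j ⟨(e.extendSubtype i).val - j, by omega⟩ := by
      ext; simp; omega
    rw [Function.comp_apply, this, Fin.append_right]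

theorem euclidean_eq_smul_add_smul (x : E2) :
    x = x 0 • EuclideanSpace.single (0 : Fin 2) (1 : ℝ) +
      x 1 • EuclideanSpace.single (1 : Fin 2) (1 : ℝ) := by
  ext i
  fin_cases i <;> simp

theorem norm_le_abs_add_abs (x : E2) : ‖x‖ ≤ |x 0| + |x 1| := by
  conv_lhs => rw [euclidean_eq_smul_add_smul x]
  refine (norm_add_le _ _).trans ?_
  rw [norm_smul, norm_smul]
  simp

/-- The anisotropic box of size `δ` with weight `κ`. -/
def weightBox (κ₀ κ₁ δ : ℝ) : Set E2 := {x | |x 0| ≤ δ ^ κ₀ ∧ |x 1| ≤ δ ^ κ₁}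

/-- On the box the monomial of exponent `m` is at most `δ ^ (κ₀ * m.1 + κ₁ * m.2) ≤ δ`. The Taylor
remainder is `O(‖x‖ ^ (n + 1))` with `‖x‖ ≤ 2 * δ ^ min κ₀ κ₁`, so it is `O(δ)` once `min κ₀ κ₁ * (n
+ 1) ≥ 1`; convergence of the series is not needed. -/
theorem exists_bound_on_weightBox {f : E2 → ℝ} (hf : ContDiffNear ∞ f 0) {κ₀ κ₁ : ℝ} (h₀ : 0 < κ₀)
    (h₁ : 0 < κ₁) (hs : ∀ m ∈ taylorSupport f, 1 ≤ κ₀ * m.1 + κ₁ * m.2) :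
    ∃ C > 0, ∀ᶠ δ in 𝓝[>] (0 : ℝ), ∀ x ∈ weightBox κ₀ κ₁ δ, |f x| ≤ C * δ := by
  obtain ⟨n, hn⟩ := exists_nat_gt (1 / min κ₀ κ₁)
  have hmin : 0 < min κ₀ κ₁ := lt_min h₀ h₁
  have hn1 : 1 ≤ min κ₀ κ₁ * (n + 1 : ℕ) := by
    rw [div_lt_iff₀ hmin] at hn
    push_cast; nlinarith
  have hf0 : ∀ k : ℕ, ContDiffAt ℝ k f 0 := fun k => hf.self_of_nhds.of_le (by exact_mod_cast le_top)
  -- the homogeneous terms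
  have hterm : ∀ k : ℕ, ∃ C ≥ 0, ∀ δ : ℝ, 0 < δ → δ ≤ 1 → ∀ x ∈ weightBox κ₀ κ₁ δ,
      |iteratedFDeriv ℝ k f 0 (fun _ => x)| ≤ C * δ := by
    intro k
    refine ⟨∑ s : Finset (Fin k), |iteratedFDeriv ℝ k f 0
      (s.piecewise (fun _ => EuclideanSpace.single (0 : Fin 2) (1 : ℝ))
        (fun _ => EuclideanSpace.single (1 : Fin 2) (1 : ℝ)))|, by positivity,
      fun δ hδ hδ1 x hx => ?_⟩
    have hexp := multilinear_apply_smul_add_smul (iteratedFDeriv ℝ k f 0).toMultilinearMap (x 0) (x 1)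
      (EuclideanSpace.single (0 : Fin 2) (1 : ℝ)) (EuclideanSpace.single (1 : Fin 2) (1 : ℝ))
    rw [← euclidean_eq_smul_add_smul x] at hexp
    simp only [ContinuousMultilinearMap.coe_coe] at hexp
    rw [hexp, Finset.sum_mul]
    refine (Finset.abs_sum_le_sum_abs _ _).trans (Finset.sum_le_sum fun s _ => ?_)
    rw [iteratedFDeriv_piecewise_eq_taylorCoeff (hf0 k) s]
    by_cases hc : taylorCoeff f s.card (k - s.card) = 0
    · simp [hc]
    · rw [abs_mul, mul_comm]
      refine mul_le_mul_of_nonneg_left ?_ (abs_nonneg _)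
      have hsupp := hs (s.card, k - s.card) hc
      rw [abs_mul, abs_pow, abs_pow]
      calc |x 0| ^ s.card * |x 1| ^ (k - s.card)
          ≤ (δ ^ κ₀) ^ s.card * (δ ^ κ₁) ^ (k - s.card) := by
            gcongr
            · exact hx.1
            · exact hx.2
        _ = δ ^ (κ₀ * s.card + κ₁ * (k - s.card : ℕ)) := by
            rw [Real.rpow_add hδ, Real.rpow_mul hδ.le, Real.rpow_mul hδ.le, Real.rpow_natCast,
              Real.rpow_natCast]
        _ ≤ δ ^ (1 : ℝ) := Real.rpow_le_rpow_of_exponent_ge hδ hδ1 hsupp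
        _ = δ := Real.rpow_one δ
  choose T hT0 hT using hterm
  -- the remainder
  have hcont : ContinuousAt (fun y => ‖iteratedFDeriv ℝ (n + 1) f y‖) 0 :=
    (((hf0 (n + 1)).iteratedFDeriv_right (m := 0) (i := n + 1) (by simp)).continuousAt).norm
  set R := ‖iteratedFDeriv ℝ (n + 1) f 0‖ + 1 with hR
  obtain ⟨r, hr, hball⟩ := Metric.eventually_nhds_iff_ball.1
    ((hcont.eventually (gt_mem_nhds (lt_add_one _))).and hf)
  set C := ∑ k ∈ Finset.range (n + 1), T k + R * 2 ^ (n + 1) + 1 with hC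
  have hRpos : 0 < R := by positivity
  have hCpos : 0 < C := by
    have : 0 ≤ ∑ k ∈ Finset.range (n + 1), T k := Finset.sum_nonneg fun k _ => hT0 k
    positivity
  refine ⟨C, hCpos, ?_⟩
  have hsmall : ∀ᶠ δ in 𝓝[>] (0 : ℝ), 2 * δ ^ min κ₀ κ₁ < r := by
    have h1 : ContinuousAt (fun δ : ℝ => 2 * δ ^ min κ₀ κ₁) 0 :=
      (Real.continuousAt_rpow_const 0 _ (Or.inr hmin.le)).const_mul 2
    refine nhdsWithin_le_nhds (h1.eventually (gt_mem_nhds ?_))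
    simpa [Real.zero_rpow hmin.ne'] using hr
  filter_upwards [hsmall, Ioo_mem_nhdsGT one_pos] with δ hδr hδ x hx
  have hδ0 := hδ.1
  have hδ1 := hδ.2.le
  have hxn : ‖x‖ ≤ 2 * δ ^ min κ₀ κ₁ := by
    have e0 : δ ^ κ₀ ≤ δ ^ min κ₀ κ₁ := Real.rpow_le_rpow_of_exponent_ge hδ0 hδ1 (min_le_left _ _)
    have e1 : δ ^ κ₁ ≤ δ ^ min κ₀ κ₁ := Real.rpow_le_rpow_of_exponent_ge hδ0 hδ1 (min_le_right _ _)
    have := norm_le_abs_add_abs x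
    have := hx.1
    have := hx.2
    linarith
  have hmemball : ∀ t ∈ Icc (0 : ℝ) 1, (0 : E2) + t • x ∈ Metric.ball (0 : E2) r := by
    intro t ht
    rw [zero_add, mem_ball_zero_iff, norm_smul, Real.norm_eq_abs, abs_of_nonneg ht.1]
    exact (mul_le_of_le_one_left (norm_nonneg _) ht.2).trans_lt (hxn.trans_lt hδr)
  have htay := map_add_eq_sum_add_integral_iteratedFDeriv (f := f) (x := 0) (y := x) (n := n)
    fun t ht => ((hball _ (hmemball t ht)).2.of_le (by exact_mod_cast le_top))
  rw [zero_add] at htay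
  have hpow : ‖x‖ ^ (n + 1) ≤ 2 ^ (n + 1) * δ := by
    calc ‖x‖ ^ (n + 1) ≤ (2 * δ ^ min κ₀ κ₁) ^ (n + 1) := by gcongr
      _ = 2 ^ (n + 1) * δ ^ (min κ₀ κ₁ * (n + 1 : ℕ)) := by
          rw [mul_pow, Real.rpow_mul hδ0.le, Real.rpow_natCast]
      _ ≤ 2 ^ (n + 1) * δ ^ (1 : ℝ) := by
          gcongr 2 ^ (n + 1) * ?_
          exact Real.rpow_le_rpow_of_exponent_ge hδ0 hδ1 hn1
      _ = _ := by rw [Real.rpow_one]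
  have hfact : ∀ k : ℕ, |((k.factorial : ℝ))⁻¹| ≤ 1 := by
    intro k
    rw [abs_of_pos (by positivity)]
    exact inv_le_one_of_one_le₀ (by exact_mod_cast Nat.factorial_pos k)
  have hint : |∫ t in (0 : ℝ)..1, (1 - t) ^ n • iteratedFDeriv ℝ (n + 1) f (0 + t • x)
      (fun _ => x)| ≤ R * (2 ^ (n + 1) * δ) := by
    have := intervalIntegral.norm_integral_le_of_norm_le_const (a := 0) (b := 1)
      (f := fun t => (1 - t) ^ n • iteratedFDeriv ℝ (n + 1) f (0 + t • x) (fun _ => x))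
      (C := R * (2 ^ (n + 1) * δ)) (fun t ht => by
        rw [uIoc_of_le zero_le_one] at ht
        have hb := (hball _ (hmemball t ⟨ht.1.le, ht.2⟩)).1
        rw [norm_smul, norm_pow]
        have e1 : ‖1 - t‖ ^ n ≤ 1 := pow_le_one₀ (norm_nonneg _) (by
          rw [Real.norm_eq_abs, abs_of_nonneg (by linarith [ht.2])]; linarith [ht.1])
        have e2 : ‖iteratedFDeriv ℝ (n + 1) f (0 + t • x) (fun _ => x)‖ ≤ R * (2 ^ (n + 1) * δ) := by
          refine ((iteratedFDeriv ℝ (n + 1) f (0 + t • x)).le_opNorm _).trans ?_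
          simp only [Finset.prod_const, Finset.card_univ, Fintype.card_fin]
          exact mul_le_mul hb.le hpow (by positivity) hRpos.le
        exact (mul_le_of_le_one_left (norm_nonneg _) e1).trans e2)
    simpa using this
  rw [htay]
  refine (abs_add_le _ _).trans ?_
  have s1 : |∑ k ∈ Finset.range (n + 1), (k.factorial : ℝ)⁻¹ • iteratedFDeriv ℝ k f 0 (fun _ => x)| ≤
      (∑ k ∈ Finset.range (n + 1), T k) * δ := by
    rw [Finset.sum_mul]
    refine (Finset.abs_sum_le_sum_abs _ _).trans (Finset.sum_le_sum fun k _ => ?_)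
    rw [smul_eq_mul, abs_mul]
    exact (mul_le_of_le_one_left (abs_nonneg _) (hfact k)).trans (hT k δ hδ0 hδ1 x hx)
  have s2 : |(n.factorial : ℝ)⁻¹ • ∫ t in (0 : ℝ)..1, (1 - t) ^ n •
      iteratedFDeriv ℝ (n + 1) f (0 + t • x) (fun _ => x)| ≤ R * (2 ^ (n + 1) * δ) := by
    rw [smul_eq_mul, abs_mul]
    exact (mul_le_of_le_one_left (abs_nonneg _) (hfact n)).trans hint
  rw [hC]
  nlinarith

/-- A weight separating the Newton polyhedron from a point of the bisectrix in front of it. -/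
theorem exists_separating_weight {f : E2 → ℝ} {p : ℝ} (hp : 0 < p)
    (h : ENNReal.ofReal p < newtonDistance f) :
    ∃ κ₀ κ₁ : ℝ, 0 < κ₀ ∧ 0 < κ₁ ∧ (κ₀ + κ₁) * p < 1 ∧
      ∀ m ∈ taylorSupport f, 1 ≤ κ₀ * m.1 + κ₁ * m.2 := by
  obtain ⟨d, hpd, hd⟩ := ENNReal.lt_iff_exists_nnreal_btwn.1 h
  have hpd' : p < d := by
    rw [← ENNReal.ofReal_coe_nnreal] at hpd
    exact (ENNReal.ofReal_lt_ofReal_iff_of_nonneg hp.le).1 hpd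
  have hdN : ((d : ℝ), (d : ℝ)) ∉ newtonPolyhedron f := by
    intro hmem
    exact absurd hd (not_lt.2 (iInf₂_le d hmem))
  have hup : ∀ t ∈ newtonPolyhedron f, ∀ u : ℝ × ℝ, 0 ≤ u.1 → 0 ≤ u.2 →
      t + u ∈ newtonPolyhedron f := by
    intro t ht u hu1 hu2
    have h1 : (fun s => s + u) '' newtonPolyhedron f ⊆ newtonPolyhedron f := by
      have himg : (fun s => s + u) '' newtonPolyhedron f = convexHull ℝ ((fun s => s + u) ''
          (⋃ m ∈ taylorSupport f, {t : ℝ × ℝ | (m.1 : ℝ) ≤ t.1 ∧ (m.2 : ℝ) ≤ t.2})) := by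
        have := (AffineMap.id ℝ (ℝ × ℝ) + AffineMap.const ℝ (ℝ × ℝ) u).image_convexHull
          (⋃ m ∈ taylorSupport f, {t : ℝ × ℝ | (m.1 : ℝ) ≤ t.1 ∧ (m.2 : ℝ) ≤ t.2})
        exact this
      rw [himg]
      refine convexHull_mono ?_
      rintro _ ⟨s, hs, rfl⟩
      simp only [mem_iUnion, mem_ofPred_eq, exists_prop] at hs ⊢
      obtain ⟨m, hm, hm1, hm2⟩ := hs
      exact ⟨m, hm, by simp; linarith, by simp; linarith⟩
    exact h1 ⟨t, ht, rfl⟩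
  -- The polyhedron is stable under adding nonnegative vectors, so any of its points below and to
  -- the left of `(d, d)` would put `(d, d)` in it.
  have hdisj : Disjoint (Iio (d : ℝ) ×ˢ Iio (d : ℝ)) (newtonPolyhedron f) := by
    rw [Set.disjoint_left]
    rintro ⟨t₁, t₂⟩ ⟨ht1, ht2⟩ hN
    simp only [mem_Iio] at ht1 ht2
    refine hdN ?_
    have := hup _ hN (d - t₁, d - t₂) (by simp; linarith) (by simp; linarith)
    simpa using this
  obtain ⟨F, u, hF1, hF2⟩ := geometric_hahn_banach_open ((convex_Iio _).prod (convex_Iio _))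
    (isOpen_Iio.prod isOpen_Iio) (convex_convexHull ℝ _) hdisj
  set a := F (1, 0) with ha
  set b := F (0, 1) with hb
  have hFab : ∀ x y : ℝ, F (x, y) = a * x + b * y := by
    intro x y
    have : ((x, y) : ℝ × ℝ) = x • ((1 : ℝ), (0 : ℝ)) + y • ((0 : ℝ), (1 : ℝ)) := by simp
    rw [this, map_add, map_smul, map_smul, smul_eq_mul, smul_eq_mul]; ring
  have hlt : ∀ x y : ℝ, x < d → y < d → a * x + b * y < u := by
    intro x y hx hy
    rw [← hFab]; exact hF1 _ ⟨hx, hy⟩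
  have hdpos : (0 : ℝ) < d := hp.trans hpd'
  have hu : 0 < u := by simpa using hlt 0 0 hdpos hdpos
  -- The separating functional is bounded above on a quadrant that extends to `-∞` in both
  -- directions.
  have ha0 : 0 ≤ a := by
    by_contra hneg
    rw [not_le] at hneg
    have := hlt (u / a) 0 ((div_neg_of_pos_of_neg hu hneg).trans hdpos) hdpos
    rw [mul_div_cancel₀ _ hneg.ne] at this
    simp at this
  have hb0 : 0 ≤ b := by
    by_contra hneg
    rw [not_le] at hneg
    have := hlt 0 (u / b) hdpos ((div_neg_of_pos_of_neg hu hneg).trans hdpos)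
    rw [mul_div_cancel₀ _ hneg.ne] at this
    simp at this
  have hpp : a * p + b * p < u := hlt p p hpd' hpd'
  -- The numbers `a` and `b` may vanish (both may, if the polyhedron is empty). Adding `η` to each
  -- makes the weights positive and uses only half of the slack in `(a + b) * p < u`.
  set η := (u - (a * p + b * p)) / (4 * p) with hη
  have hη0 : 0 < η := div_pos (by linarith) (by linarith)
  have hηp : η * p = (u - (a * p + b * p)) / 4 := by rw [hη]; field_simp
  refine ⟨(a + η) / u, (b + η) / u, by positivity, by positivity, ?_, ?_⟩
  · rw [← add_div, div_mul_eq_mul_div, div_lt_one hu]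
    nlinarith
  · intro m hm
    have hmN : ((m.1 : ℝ), (m.2 : ℝ)) ∈ newtonPolyhedron f := by
      refine subset_convexHull ℝ _ ?_
      simp only [mem_iUnion, mem_ofPred_eq, exists_prop]
      exact ⟨m, hm, le_rfl, le_rfl⟩
    have := hF2 _ hmN
    rw [hFab] at this
    have h1 : (0 : ℝ) ≤ m.1 := Nat.cast_nonneg _
    have h2 : (0 : ℝ) ≤ m.2 := Nat.cast_nonneg _
    rw [div_mul_eq_mul_div, div_mul_eq_mul_div, ← add_div, le_div_iff₀ hu]
    nlinarith [mul_nonneg hη0.le h1, mul_nonneg hη0.le h2]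

/-! ### Integrals over the Euclidean plane -/

/-- The identification of `ℝ × ℝ` with the Euclidean plane. -/
def planeEquiv : ℝ × ℝ ≃ᵐ E2 :=
  MeasurableEquiv.finTwoArrow.symm.trans (MeasurableEquiv.toLp 2 (Fin 2 → ℝ))

theorem planeEquiv_apply (v : ℝ × ℝ) : planeEquiv v = !₂[v.1, v.2] := rfl

theorem measurePreserving_planeEquiv : MeasurePreserving planeEquiv :=
  (EuclideanSpace.volume_preserving_symm_measurableEquiv_toLp (Fin 2)).symm.comp
    (volume_preserving_finTwoArrow ℝ).symm

theorem contDiff_planeEquiv {n : WithTop ℕ∞} : ContDiff ℝ n planeEquiv := by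
  rw [contDiff_euclidean]
  intro i
  fin_cases i
  · exact contDiff_fst
  · exact contDiff_snd

theorem planeEquiv_zero : planeEquiv (0, 0) = 0 := by
  rw [planeEquiv_apply]; ext i; fin_cases i <;> rfl

theorem continuous_planeEquiv_symm : Continuous planeEquiv.symm := by
  have : ∀ x : E2, planeEquiv.symm x = (x 0, x 1) := fun x => rfl
  simp only [continuous_congr this]
  fun_prop

theorem lintegral_planeEquiv (s : Set E2) (g : E2 → ℝ≥0∞) :
    ∫⁻ v in planeEquiv ⁻¹' s, g (planeEquiv v) = ∫⁻ x in s, g x :=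
  measurePreserving_planeEquiv.setLIntegral_comp_preimage_emb
    planeEquiv.measurableEmbedding g s

/-- Openness of the exponents of integrability, on the Euclidean plane. -/
theorem eventually_lintegral_rpow_lt_top_euclidean {φ : E2 → ℝ} (hφ : AnalyticAt ℝ φ 0) {α : ℝ}
    (hα : 0 < α) {U : Set E2} (hU : U ∈ 𝓝 (0 : E2))
    (hfin : ∫⁻ x in U, ENNReal.ofReal |φ x| ^ (-α) < ⊤) :
    ∃ V ∈ 𝓝 (0 : E2), ∀ᶠ r in 𝓝 α, ∫⁻ x in V, ENNReal.ofReal |φ x| ^ (-r) < ⊤ := by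
  have hc : Continuous planeEquiv := (contDiff_planeEquiv (n := 0)).continuous
  have hG : AnalyticAt ℝ (φ ∘ planeEquiv) (0, 0) := by
    refine AnalyticAt.comp (by rwa [planeEquiv_zero]) ?_
    exact (contDiff_planeEquiv (n := ω)).contDiffAt.analyticAt
  rw [← lintegral_planeEquiv] at hfin
  obtain ⟨V, hV, h⟩ := eventually_lintegral_rpow_lt_top hG hα
    (hc.continuousAt.preimage_mem_nhds (by rwa [planeEquiv_zero])) hfin
  refine ⟨planeEquiv.symm ⁻¹' V, continuous_planeEquiv_symm.continuousAt.preimage_mem_nhds ?_,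
    h.mono fun r hr => ?_⟩
  · rw [← planeEquiv_zero, MeasurableEquiv.symm_apply_apply]; exact hV
  · rw [← lintegral_planeEquiv, ← preimage_comp]
    simpa using hr

theorem volume_weightBox {κ₀ κ₁ δ : ℝ} (hδ : 0 < δ) :
    volume (weightBox κ₀ κ₁ δ) = ENNReal.ofReal (4 * δ ^ (κ₀ + κ₁)) := by
  have hpre : planeEquiv ⁻¹' weightBox κ₀ κ₁ δ =
      Icc (-δ ^ κ₀) (δ ^ κ₀) ×ˢ Icc (-δ ^ κ₁) (δ ^ κ₁) := by
    ext v
    simp only [mem_preimage, mem_prod, mem_Icc, ← abs_le]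
    rfl
  rw [← measurePreserving_planeEquiv.measure_preimage_equiv, hpre, Measure.volume_eq_prod,
    Measure.prod_prod, Real.volume_Icc, Real.volume_Icc,
    ← ENNReal.ofReal_mul (by have := Real.rpow_pos_of_pos hδ κ₀; linarith), Real.rpow_add hδ]
  congr 1; ring

theorem isClosed_weightBox (κ₀ κ₁ δ : ℝ) : IsClosed (weightBox κ₀ κ₁ δ) :=
  (isClosed_le (f := fun x : E2 => |x 0|) (by fun_prop) continuous_const).inter
    (isClosed_le (f := fun x : E2 => |x 1|) (by fun_prop) continuous_const)

theorem weightBox_subset_ball {κ₀ κ₁ : ℝ} (h₀ : 0 < κ₀) (h₁ : 0 < κ₁) {r : ℝ} (hr : 0 < r) :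
    ∀ᶠ δ in 𝓝[>] (0 : ℝ), weightBox κ₀ κ₁ δ ⊆ Metric.ball 0 r := by
  have hsm : ∀ κ : ℝ, 0 < κ → ∀ᶠ δ in 𝓝[>] (0 : ℝ), δ ^ κ < r / 2 := by
    intro κ hκ
    have h1 : ContinuousAt (fun δ : ℝ => δ ^ κ) 0 := Real.continuousAt_rpow_const 0 _ (Or.inr hκ.le)
    refine nhdsWithin_le_nhds (h1.eventually (gt_mem_nhds ?_))
    simpa [Real.zero_rpow hκ.ne'] using hr
  filter_upwards [hsm κ₀ h₀, hsm κ₁ h₁] with δ h0 h1 x hx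
  rw [mem_ball_zero_iff]
  have := norm_le_abs_add_abs x
  linarith [hx.1, hx.2]

/-- Below the height, the negative power of a smooth function is not integrable. -/
theorem lintegral_rpow_eq_top_of_lt_height {φ : E2 → ℝ} (hφ : ContDiffNear ∞ φ 0) {p : ℝ}
    (hp : 0 < p) (h : ENNReal.ofReal p < height φ) {U : Set E2} (hU : U ∈ 𝓝 (0 : E2)) :
    ∫⁻ x in U, ENNReal.ofReal |φ x| ^ (-1 / p) = ⊤ := by
  simp only [height, lt_iSup_iff] at h
  obtain ⟨ψ, ⟨hψ, hψ0, A, hA⟩, hd⟩ := h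
  obtain ⟨κ₀, κ₁, h₀, h₁, hκp, hsupp⟩ := exists_separating_weight hp hd
  have hψc : ContinuousAt ψ 0 := hψ.self_of_nhds.continuousAt
  have hf : ContDiffNear ∞ (φ ∘ ψ) 0 := by
    have h1 : ∀ᶠ y in 𝓝 (0 : E2), ContDiffAt ℝ ∞ φ (ψ y) :=
      hψc.eventually (by rw [hψ0]; exact hφ)
    filter_upwards [h1, hψ] with y h1 h2
    exact h1.comp y h2
  obtain ⟨C, hC, hbound⟩ := exists_bound_on_weightBox hf h₀ h₁ hsupp
  have hstrict : HasStrictFDerivAt ψ (A : E2 →L[ℝ] E2) 0 :=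
    hψ.self_of_nhds.hasStrictFDerivAt' hA (by simp)
  have hdet : (A : E2 →L[ℝ] E2).det ≠ 0 := by
    have := (LinearEquiv.isUnit_det' A.toLinearEquiv).ne_zero
    exact this
  set m : ℝ≥0 := ‖(A : E2 →L[ℝ] E2).det‖₊ / 2 with hm
  have hmpos : 0 < m := by
    have : 0 < ‖(A : E2 →L[ℝ] E2).det‖₊ := nnnorm_pos.2 hdet
    positivity
  have hmlt : (m : ℝ≥0∞) < ENNReal.ofReal |(A : E2 →L[ℝ] E2).det| := by
    rw [← Real.norm_eq_abs, ofReal_norm, enorm_eq_nnnorm, ENNReal.coe_lt_coe, hm]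
    exact half_lt_self (nnnorm_pos.2 hdet)
  -- A map close enough to its linear part `A` scales areas by at least `m`, half of `|det A|`.
  obtain ⟨c, hc, hc0⟩ := ((mul_le_addHaar_image_of_lt_det volume (A : E2 →L[ℝ] E2) hmlt).and
    self_mem_nhdsWithin).exists
  obtain ⟨s, hs, happ⟩ := hstrict.approximates_deriv_on_nhds (Or.inr hc0)
  obtain ⟨r, hr, hrs⟩ := Metric.mem_nhds_iff.1 (inter_mem hs (inter_mem
    (hψc.preimage_mem_nhds (t := U) (by rwa [hψ0])) hψ))
  set ε := 1 / p - (κ₀ + κ₁) with hε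
  have hε0 : 0 < ε := by rw [hε, sub_pos, lt_div_iff₀ hp]; exact hκp
  -- On the image of the box `|φ| ≤ C * δ`, and its area is at least `m * 4 * δ ^ (κ₀ + κ₁)`; the
  -- total exponent of `δ` is `-ε < 0`.
  have hlow : ∀ᶠ δ in 𝓝[>] (0 : ℝ), ENNReal.ofReal (C ^ (-1 / p) * (m * 4) * δ ^ (-ε)) ≤
      ∫⁻ x in U, ENNReal.ofReal |φ x| ^ (-1 / p) := by
    filter_upwards [hbound, weightBox_subset_ball h₀ h₁ hr, self_mem_nhdsWithin] with δ hb hsub hδ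
    have hδ0 : (0 : ℝ) < δ := hδ
    have hcompact : IsCompact (weightBox κ₀ κ₁ δ) :=
      Metric.isCompact_of_isClosed_isBounded (isClosed_weightBox _ _ _)
        (Metric.isBounded_ball.subset hsub)
    have himg : MeasurableSet (ψ '' weightBox κ₀ κ₁ δ) :=
      (hcompact.image_of_continuousOn fun x hx =>
        (show ContDiffAt ℝ ∞ ψ x from (hrs (hsub hx)).2.2).continuousAt.continuousWithinAt).measurableSet
    have hvol := hc _ ψ (happ.mono_set fun x hx => (hrs (hsub hx)).1)
    calc ENNReal.ofReal (C ^ (-1 / p) * (m * 4) * δ ^ (-ε))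
        = ENNReal.ofReal (C * δ) ^ (-1 / p) * (m * volume (weightBox κ₀ κ₁ δ)) := by
          rw [volume_weightBox hδ0, ENNReal.ofReal_rpow_of_pos (by positivity),
            ← ENNReal.ofReal_coe_nnreal (p := m), ← ENNReal.ofReal_mul m.coe_nonneg,
            ← ENNReal.ofReal_mul (by positivity), Real.mul_rpow hC.le hδ0.le,
            show -ε = -1 / p + (κ₀ + κ₁) by rw [hε]; ring, Real.rpow_add hδ0]
          congr 1; ring
      _ ≤ ENNReal.ofReal (C * δ) ^ (-1 / p) * volume (ψ '' weightBox κ₀ κ₁ δ) := by gcongr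
      _ = ∫⁻ _ in ψ '' weightBox κ₀ κ₁ δ, ENNReal.ofReal (C * δ) ^ (-1 / p) := by
          rw [setLIntegral_const]
      _ ≤ ∫⁻ x in ψ '' weightBox κ₀ κ₁ δ, ENNReal.ofReal |φ x| ^ (-1 / p) := by
          refine setLIntegral_mono' himg ?_
          rintro _ ⟨x, hx, rfl⟩
          rw [neg_div, ENNReal.rpow_neg, ENNReal.rpow_neg, ENNReal.inv_le_inv]
          exact ENNReal.rpow_le_rpow (ENNReal.ofReal_le_ofReal (hb x hx)) (by positivity)
      _ ≤ _ := by
          refine lintegral_mono_set ?_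
          rintro _ ⟨x, hx, rfl⟩
          exact (hrs (hsub hx)).2.1
  have htend : Tendsto (fun δ : ℝ => C ^ (-1 / p) * (m * 4) * δ ^ (-ε)) (𝓝[>] 0) atTop :=
    (tendsto_rpow_neg_nhdsGT_zero (neg_lt_zero.2 hε0)).const_mul_atTop (by positivity)
  have h2 := ENNReal.tendsto_ofReal_atTop.comp htend
  exact top_le_iff.1 (le_of_tendsto h2 hlow)

/-! ### Area of graphs -/

theorem euclideanHausdorffMeasure_image_le {X Y : Type*} [EMetricSpace X] [EMetricSpace Y]
    [MeasurableSpace X] [BorelSpace X] [MeasurableSpace Y] [BorelSpace Y] {f : X → Y} {s : Set X}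
    {K : ℝ≥0} (hf : LipschitzOnWith K f s) (d : ℕ) :
    μHE[d] (f '' s) ≤ (K : ℝ≥0∞) ^ d * μHE[d] s := by
  have h := hf.hausdorffMeasure_image_le (d := d) (Nat.cast_nonneg d)
  rw [ENNReal.rpow_natCast] at h
  simp only [Measure.euclideanHausdorffMeasure_def, Measure.smul_apply, ENNReal.smul_def,
    smul_eq_mul]
  rw [mul_left_comm]
  gcongr

section

variable {X : Type*} [MetricSpace X] [MeasurableSpace X] [BorelSpace X] {π : X → E2} {G : E2 → X}
  {B : Set E2}

/-- A 1-Lipschitz left inverse does not increase area, so a graph has at least the area of its base.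
With `lintegral_image_le_lintegral` this replaces the area formula. -/
theorem lintegral_le_lintegral_image (hπ : LipschitzWith 1 π) (hG : ContinuousOn G B)
    (hB : MeasurableSet B) (hπG : ∀ x ∈ B, π (G x) = x) {F : X → ℝ≥0∞} (hF : Measurable F) :
    ∫⁻ x in B, F (G x) ≤ ∫⁻ y in G '' B, F y ∂μHE[2] := by
  rw [← lintegral_map' hF.aemeasurable (hG.aemeasurable hB)]
  refine lintegral_mono' (Measure.le_iff.2 fun s hs => ?_) le_rfl
  rw [Measure.map_apply_of_aemeasurable (hG.aemeasurable hB) hs, Measure.restrict_apply' hB, Measure.restrict_apply hs]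
  calc volume (G ⁻¹' s ∩ B) = μHE[2] (G ⁻¹' s ∩ B) := by
        rw [EuclideanSpace.euclideanHausdorffMeasure_eq_volume]
    _ ≤ μHE[2] (π '' (s ∩ G '' B)) := by
        refine measure_mono ?_
        rintro x ⟨hx, hxB⟩
        exact ⟨G x, ⟨hx, x, hxB, rfl⟩, hπG x hxB⟩
    _ ≤ μHE[2] (s ∩ G '' B) := by
        simpa using euclideanHausdorffMeasure_image_le (hπ.lipschitzOnWith (s := s ∩ G '' B)) 2

theorem lintegral_image_le_lintegral (hG : ContinuousOn G B) (hB : MeasurableSet B) {K : ℝ≥0}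
    (hGK : LipschitzOnWith K G B) {F : X → ℝ≥0∞} (hF : Measurable F) :
    ∫⁻ y in G '' B, F y ∂μHE[2] ≤ (K : ℝ≥0∞) ^ 2 * ∫⁻ x in B, F (G x) := by
  rw [← lintegral_map' hF.aemeasurable (hG.aemeasurable hB), ← smul_eq_mul, ← lintegral_smul_measure]
  refine lintegral_mono' (Measure.le_iff.2 fun s hs => ?_) le_rfl
  rw [Measure.smul_apply, smul_eq_mul, Measure.map_apply_of_aemeasurable (hG.aemeasurable hB) hs, Measure.restrict_apply' hB,
    Measure.restrict_apply hs, ← EuclideanSpace.euclideanHausdorffMeasure_eq_volume 2]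
  refine le_trans (measure_mono ?_)
    (euclideanHausdorffMeasure_image_le (hGK.mono (inter_subset_right (s := G ⁻¹' s))) 2)
  rintro _ ⟨hy, x, hx, rfl⟩
  exact ⟨x, ⟨hy, hx⟩, rfl⟩

end

/-! ### Surfaces as graphs over their tangent planes -/

/-- The splitting of space into the horizontal plane and the vertical axis. -/
noncomputable def spaceEquiv : (E2 × ℝ) ≃L[ℝ] E3 :=
  LinearEquiv.toContinuousLinearEquiv
    { toFun := fun v => !₂[v.1 0, v.1 1, v.2]
      invFun := fun y => (!₂[y 0, y 1], y 2)
      map_add' := fun v w => by ext i; fin_cases i <;> rfl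
      map_smul' := fun c v => by ext i; fin_cases i <;> rfl
      left_inv := fun v => by
        refine Prod.ext ?_ rfl
        ext i; fin_cases i <;> rfl
      right_inv := fun y => by ext i; fin_cases i <;> rfl }

theorem spaceEquiv_symm_apply (y : E3) : spaceEquiv.symm y = (!₂[y 0, y 1], y 2) := rfl

theorem norm_spaceEquiv_symm_fst_le (y : E3) : ‖(spaceEquiv.symm y).1‖ ≤ ‖y‖ := by
  rw [spaceEquiv_symm_apply, EuclideanSpace.norm_eq, EuclideanSpace.norm_eq, Fin.sum_univ_three,
    Fin.sum_univ_two]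
  exact Real.sqrt_le_sqrt (le_add_of_nonneg_right (by positivity))

theorem eventually_of_continuousAt {X Y : Type*} [TopologicalSpace X] [TopologicalSpace Y]
    {f : X → Y} {a : X} {b : Y} (hf : ContinuousAt f a) (hab : f a = b) {q : Y → Prop}
    (h : ∀ᶠ y in 𝓝 b, q y) : ∀ᶠ x in 𝓝 a, q (f x) :=
  hf.eventually (hab ▸ h)

theorem hasDerivAt_comp_of_fderiv_eq_zero {φ : E2 → ℝ} (hφ : HasFDerivAt φ (0 : E2 →L[ℝ] ℝ) 0)
    {c : ℝ → E2} {c' : E2} (hc : HasDerivAt c c' 0) (h0 : c 0 = 0) :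
    HasDerivAt (fun t => φ (c t)) 0 0 :=
  HasFDerivAt.comp_hasDerivAt (l' := 0) 0 (h0 ▸ hφ) hc

/-- `J` splits space orthogonally, and `S` is in this splitting the graph of `φ` near `x₀`. -/
structure IsGraphIn (S : Set E3) (x₀ : E3) (φ : E2 → ℝ) (J : (E2 × ℝ) ≃L[ℝ] E3) : Prop where
  norm_fst_le : ∀ v, ‖(J.symm v).1‖ ≤ ‖v‖
  abs_snd_le : ∀ v, |(J.symm v).2| ≤ ‖v‖
  norm_vertical_le : ∀ z : ℝ, ‖J (0, z)‖ ≤ |z|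
  mem_iff : ∀ᶠ x in 𝓝 x₀, (x ∈ S ↔ (J.symm (x - x₀)).2 = φ (J.symm (x - x₀)).1)

/-- `J` is the splitting of space followed by the inverse of the linear part of the motion. The
translation to `(0, 0, 1)` cancels the `1` in `1 + φ`. -/
theorem IsGraphRepresentation.exists_isGraphIn {S : Set E3} {x₀ : E3} {φ : E2 → ℝ}
    (h : IsGraphRepresentation S x₀ φ) : ∃ J, IsGraphIn S x₀ φ J := by
  obtain ⟨-, -, -, M, hM0, hM⟩ := h
  set A := M.linearIsometryEquiv
  have hMx : ∀ x, M x = A (x - x₀) + !₂[0, 0, 1] := fun x => by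
    rw [← hM0, ← sub_eq_iff_eq_add]
    exact (M.map_vsub x x₀).symm
  refine ⟨spaceEquiv.trans A.symm.toContinuousLinearEquiv, fun v => ?_, fun v => ?_, fun z => ?_, ?_⟩
  · exact (norm_spaceEquiv_symm_fst_le (A v)).trans_eq (A.norm_map v)
  · exact (PiLp.norm_apply_le (A v) 2).trans_eq (A.norm_map v)
  · refine ((A.symm.norm_map _).trans ?_).le
    change ‖(!₂[(0 : ℝ), 0, z] : E3)‖ = |z|
    rw [EuclideanSpace.norm_eq]
    simp [Fin.sum_univ_three, Real.sqrt_sq_eq_abs]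
  · rw [← hM0] at hM
    filter_upwards [M.continuous.continuousAt.eventually hM] with x hx
    rw [M.injective.mem_set_image, hMx] at hx
    rw [hx]
    change A (x - x₀) 2 + 1 = 1 + φ !₂[A (x - x₀) 0 + 0, A (x - x₀) 1 + 0] ↔
      A (x - x₀) 2 = φ !₂[A (x - x₀) 0, A (x - x₀) 1]
    rw [add_zero, add_zero, add_comm, add_right_inj]

namespace IsGraphIn

variable {S : Set E3} {x₀ : E3} {φ : E2 → ℝ} {J : (E2 × ℝ) ≃L[ℝ] E3}

/-- The height of a curve in the graph is `φ` of its horizontal part, with derivative `0` at the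
base point. Conversely a horizontal vector is the velocity of a straight line lifted to the graph.
-/
theorem tangentSpaceAt_eq (h : IsGraphIn S x₀ φ J) (hφ : ContDiffNear ∞ φ 0) (h0 : φ 0 = 0)
    (h1 : fderiv ℝ φ 0 = 0) : tangentSpaceAt S x₀ = {v | (J.symm v).2 = 0} := by
  have hd : HasFDerivAt φ (0 : E2 →L[ℝ] ℝ) 0 := by
    rw [← h1]
    exact (hφ.self_of_nhds.differentiableAt (by simp)).hasFDerivAt
  ext v
  constructor
  · rintro ⟨γ, -, hγ0, hγS, hγ⟩
    have hJ : HasDerivAt (fun t => J.symm (γ t - x₀)) (J.symm v) 0 :=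
      (J.symm : E3 →L[ℝ] E2 × ℝ).hasFDerivAt.comp_hasDerivAt 0 (hγ.sub_const x₀)
    have h2 : HasDerivAt (fun t => (J.symm (γ t - x₀)).2) (J.symm v).2 0 := hJ.snd
    have h3 : HasDerivAt (fun t => φ (J.symm (γ t - x₀)).1) 0 0 :=
      hasDerivAt_comp_of_fderiv_eq_zero hd hJ.fst (by simp [hγ0])
    have h4 := eventually_of_continuousAt hγ.continuousAt hγ0 h.mem_iff
    refine h2.unique (h3.congr_of_eventuallyEq ?_)
    filter_upwards [hγS, h4] with t ht ht'
    exact ht'.1 ht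
  · intro hv
    have hv : (J.symm v).2 = 0 := hv
    set w := (J.symm v).1 with hw
    have hlin : ContDiff ℝ ∞ (fun t : ℝ => t • w) := by fun_prop
    have hJw : J (w, 0) = v := by
      rw [← hv, hw]; exact J.apply_symm_apply v
    refine ⟨fun t => x₀ + J (t • w, φ (t • w)), ?_, by simp [h0], ?_, ?_⟩
    · filter_upwards [eventually_of_continuousAt hlin.continuous.continuousAt (zero_smul ℝ w) hφ]
        with t ht
      exact contDiffAt_const.add (J.contDiff.contDiffAt.comp t
        (hlin.contDiffAt.prodMk (ht.comp t hlin.contDiffAt)))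
    · have hc : ContinuousAt (fun t : ℝ => x₀ + J (t • w, φ (t • w))) 0 := by
        have h5 : ContinuousAt φ ((0 : ℝ) • w) := by
          rw [zero_smul]; exact hφ.self_of_nhds.continuousAt
        have h6 : ContinuousAt (fun t : ℝ => φ (t • w)) 0 :=
          h5.comp (f := fun t : ℝ => t • w) hlin.continuous.continuousAt
        exact continuousAt_const.add (J.continuous.continuousAt.comp
          (hlin.continuous.continuousAt.prodMk h6))
      filter_upwards [eventually_of_continuousAt hc (by simp [h0]) h.mem_iff] with t ht
      rw [ht]
      simp
    · have h5 : HasDerivAt (fun t : ℝ => t • w) w 0 := by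
        simpa using (hasDerivAt_id (0 : ℝ)).smul_const w
      have h6 : HasDerivAt (fun t : ℝ => φ (t • w)) 0 0 :=
        hasDerivAt_comp_of_fderiv_eq_zero hd h5 (zero_smul ℝ w)
      have h7 := ((J : E2 × ℝ →L[ℝ] E3).hasFDerivAt.comp_hasDerivAt 0 (h5.prodMk h6)).const_add x₀
      rw [ContinuousLinearEquiv.coe_coe, hJw] at h7
      exact h7

/-- The foot of the perpendicular gives the upper bound; the lower bound holds because the height
coordinate is 1-Lipschitz and constant on the plane. -/
theorem tangentPlaneDist_eq (h : IsGraphIn S x₀ φ J) (hφ : ContDiffNear ∞ φ 0) (h0 : φ 0 = 0)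
    (h1 : fderiv ℝ φ 0 = 0) (x : E3) :
    tangentPlaneDist S x₀ x = ENNReal.ofReal |(J.symm (x - x₀)).2| := by
  rw [tangentPlaneDist, h.tangentSpaceAt_eq hφ h0 h1]
  apply le_antisymm
  · set z := (J.symm (x - x₀)).2 with hz
    have hmem : x - J (0, z) ∈ (fun v => x₀ + v) '' {v | (J.symm v).2 = 0} := by
      refine ⟨x - x₀ - J (0, z), ?_, by
        change x₀ + (x - x₀ - J (0, z)) = x - J (0, z)
        abel⟩
      change (J.symm (x - x₀ - J (0, z))).2 = 0
      rw [map_sub, J.symm_apply_apply, Prod.snd_sub, ← hz, sub_self]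
    refine (Metric.infEDist_le_edist_of_mem hmem).trans ?_
    rw [edist_dist, dist_eq_norm, sub_sub_cancel]
    exact ENNReal.ofReal_le_ofReal (h.norm_vertical_le z)
  · refine Metric.le_infEDist.2 ?_
    rintro _ ⟨v, hv, rfl⟩
    have hv : (J.symm v).2 = 0 := hv
    rw [edist_dist, dist_eq_norm]
    refine ENNReal.ofReal_le_ofReal ?_
    have := h.abs_snd_le (x - (x₀ + v))
    rwa [← sub_sub, map_sub, Prod.snd_sub, hv, sub_zero, sub_sub] at this

theorem measurable_tangentPlaneDist_rpow (r : ℝ) :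
    Measurable fun x => tangentPlaneDist S x₀ x ^ r :=
  Metric.continuous_infEDist.measurable.pow_const r

theorem contDiffAt_graph {n : WithTop ℕ∞} {x : E2} (hφ : ContDiffAt ℝ n φ x) :
    ContDiffAt ℝ n (fun x => x₀ + J (x, φ x)) x :=
  contDiffAt_const.add (J.contDiff.contDiffAt.comp x (contDiffAt_id.prodMk hφ))

theorem exists_lintegral_le (h : IsGraphIn S x₀ φ J) (hφ : ContDiffNear ∞ φ 0) (h0 : φ 0 = 0)
    (h1 : fderiv ℝ φ 0 = 0) {U : Set E3} (hU : U ∈ 𝓝 x₀) :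
    ∃ V ∈ 𝓝 (0 : E2), ∀ r : ℝ, ∫⁻ x in V, ENNReal.ofReal |φ x| ^ r ≤
      ∫⁻ x in S ∩ U, tangentPlaneDist S x₀ x ^ r ∂μHE[2] := by
  set G : E2 → E3 := fun x => x₀ + J (x, φ x) with hG
  have hG0 : G 0 = x₀ := by simp [hG, h0]
  have hGc : ContinuousAt G 0 := (contDiffAt_graph hφ.self_of_nhds).continuousAt
  have hsymm : ∀ x, J.symm (G x - x₀) = (x, φ x) := fun x => by simp [hG]
  obtain ⟨ρ, hρ, hball⟩ := Metric.eventually_nhds_iff_ball.1 (hφ.and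
    (hGc.eventually (by rw [hG0]; exact h.mem_iff.and hU)))
  refine ⟨Metric.ball 0 ρ, Metric.ball_mem_nhds _ hρ, fun r => ?_⟩
  have hlip : LipschitzWith 1 fun x : E3 => (J.symm (x - x₀)).1 := by
    refine LipschitzWith.of_dist_le_mul fun x y => ?_
    have := h.norm_fst_le (x - x₀ - (y - x₀))
    rw [map_sub, Prod.fst_sub, sub_sub_sub_cancel_right] at this
    simpa [dist_eq_norm] using this
  have hle := lintegral_le_lintegral_image hlip (G := G) (B := Metric.ball 0 ρ)
    (fun x hx => (contDiffAt_graph (hball x hx).1).continuousAt.continuousWithinAt)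
    Metric.isOpen_ball.measurableSet (fun x _ => by rw [hsymm])
    (measurable_tangentPlaneDist_rpow (S := S) (x₀ := x₀) r)
  simp only [h.tangentPlaneDist_eq hφ h0 h1, hsymm] at hle ⊢
  refine hle.trans (lintegral_mono_set ?_)
  rintro _ ⟨x, hx, rfl⟩
  refine ⟨(hball x hx).2.1.2 ?_, (hball x hx).2.2⟩
  rw [hsymm]

theorem exists_lintegral_ge (h : IsGraphIn S x₀ φ J) (hφ : ContDiffNear ∞ φ 0) (h0 : φ 0 = 0)
    (h1 : fderiv ℝ φ 0 = 0) {V : Set E2} (hV : V ∈ 𝓝 (0 : E2)) :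
    ∃ U ∈ 𝓝 x₀, ∃ K : ℝ≥0, ∀ r : ℝ, ∫⁻ x in S ∩ U, tangentPlaneDist S x₀ x ^ r ∂μHE[2] ≤
      (K : ℝ≥0∞) ^ 2 * ∫⁻ x in V, ENNReal.ofReal |φ x| ^ r := by
  set G : E2 → E3 := fun x => x₀ + J (x, φ x) with hG
  have hsymm : ∀ x, J.symm (G x - x₀) = (x, φ x) := fun x => by simp [hG]
  have hGd : ContDiffAt ℝ ∞ G 0 := contDiffAt_graph hφ.self_of_nhds
  obtain ⟨K, t, ht, hK⟩ := (hGd.of_le (m := 1) (by simp)).exists_lipschitzOnWith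
  obtain ⟨ρ, hρ, hball⟩ := Metric.mem_nhds_iff.1 (inter_mem ht hV)
  have hπ : ContinuousAt (fun x : E3 => (J.symm (x - x₀)).1) x₀ := by fun_prop
  refine ⟨{x | x ∈ S ↔ (J.symm (x - x₀)).2 = φ (J.symm (x - x₀)).1} ∩
    (fun x : E3 => (J.symm (x - x₀)).1) ⁻¹' Metric.ball 0 ρ, inter_mem h.mem_iff
    (hπ.preimage_mem_nhds (by simpa using Metric.ball_mem_nhds (0 : E2) hρ)), K, fun r => ?_⟩
  have hKB := hK.mono fun x hx => (hball hx).1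
  have hle := lintegral_image_le_lintegral (G := G) hKB.continuousOn
    Metric.isOpen_ball.measurableSet hKB
    (measurable_tangentPlaneDist_rpow (S := S) (x₀ := x₀) r)
  refine (lintegral_mono_set ?_).trans (hle.trans ?_)
  · rintro x ⟨hxS, hx, hxB⟩
    have hx : x ∈ S ↔ (J.symm (x - x₀)).2 = φ (J.symm (x - x₀)).1 := hx
    refine ⟨_, hxB, ?_⟩
    change x₀ + J ((J.symm (x - x₀)).1, φ (J.symm (x - x₀)).1) = x
    rw [← hx.1 hxS, Prod.mk.eta, J.apply_symm_apply, add_sub_cancel]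
  · simp only [h.tangentPlaneDist_eq hφ h0 h1, hsymm]
    exact mul_le_mul_right (lintegral_mono_set fun x hx => (hball hx).2) _

/-- The function representing an analytic surface is analytic. -/
theorem analyticAt (h : IsGraphIn S x₀ φ J) (hφ : ContDiffNear ∞ φ 0) (h0 : φ 0 = 0)
    (h1 : fderiv ℝ φ 0 = 0) (hS : IsHypersurfaceNear ω S x₀) : AnalyticAt ℝ φ 0 := by
  obtain ⟨f, hf, hf', hfS⟩ := hS
  set g : E2 × ℝ → ℝ := fun v => f (x₀ + J v) with hg
  have hfa : AnalyticAt ℝ f (x₀ + J ((0 : E2), (0 : ℝ))) := by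
    rw [Prod.mk_zero_zero, map_zero, add_zero]; exact hf.self_of_nhds.analyticAt
  have hga : AnalyticAt ℝ g (0, 0) := by
    refine hfa.comp (f := fun v => x₀ + J v) ?_
    exact (contDiff_const.add J.contDiff : ContDiff ℝ ω fun v => x₀ + J v).contDiffAt.analyticAt
  have hGc : ContinuousAt (fun x => x₀ + J (x, φ x)) 0 :=
    (contDiffAt_graph hφ.self_of_nhds).continuousAt
  have hzero : ∀ᶠ x in 𝓝 (0 : E2), g (x, φ x) = 0 := by
    filter_upwards [eventually_of_continuousAt hGc (by simp [h0]) (hfS.and h.mem_iff)] with x hx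
    refine hx.1.1 (hx.2.2 ?_)
    simp
  have hg0 : g (0, 0) = 0 := by simpa [h0] using hzero.self_of_nhds
  have hgf : fderiv ℝ g (0, 0) = (fderiv ℝ f x₀).comp (J : E2 × ℝ →L[ℝ] E3) := by
    have h2 : HasFDerivAt f (fderiv ℝ f x₀) (x₀ + J ((0 : E2), (0 : ℝ))) := by
      rw [Prod.mk_zero_zero, map_zero, add_zero] at hfa ⊢
      exact hfa.differentiableAt.hasFDerivAt
    exact (h2.comp (f := fun v => x₀ + J v) _ (J.hasFDerivAt.const_add x₀)).fderiv
  -- Differentiating `g (x, φ x) = 0` with zero derivative of `φ` kills the horizontal derivatives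
  -- of `g`. A zero vertical derivative would then make that of `f` vanish at `x₀`.
  have hpartial : fderiv ℝ g (0, 0) (0, 1) ≠ 0 := by
    intro hz
    have hd : HasFDerivAt φ (0 : E2 →L[ℝ] ℝ) 0 := by
      rw [← h1]
      exact (hφ.self_of_nhds.differentiableAt (by simp)).hasFDerivAt
    have h3 : HasFDerivAt (fun x => g (x, φ x)) ((fderiv ℝ g (0, 0)).comp
        ((ContinuousLinearMap.id ℝ E2).prod 0)) 0 := by
      have h4 : HasFDerivAt g (fderiv ℝ g (0, 0)) ((0 : E2), φ 0) := by
        rw [h0]; exact hga.differentiableAt.hasFDerivAt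
      exact h4.comp (f := fun x => (x, φ x)) 0 ((hasFDerivAt_id 0).prodMk hd)
    have h5 : HasFDerivAt (fun x => g (x, φ x)) (0 : E2 →L[ℝ] ℝ) 0 :=
      (hasFDerivAt_const (0 : ℝ) (0 : E2)).congr_of_eventuallyEq hzero
    have h6 := h3.unique h5
    have h7 : ∀ v, fderiv ℝ g (0, 0) v = 0 := by
      rintro ⟨x, z⟩
      have h8 : fderiv ℝ g (0, 0) (x, 0) = 0 := by
        simpa using congrArg (fun L : E2 →L[ℝ] ℝ => L x) h6
      have : ((x, z) : E2 × ℝ) = (x, 0) + z • (0, 1) := by simp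
      rw [this, map_add, map_smul, h8, hz]; simp
    refine hf' (ContinuousLinearMap.ext fun y => ?_)
    have := h7 (J.symm y)
    rw [hgf] at this
    simpa using this
  -- Local uniqueness in the implicit function theorem identifies `φ` with the analytic solution.
  obtain ⟨ψ, hψ, -, hu⟩ := exists_analyticAt_implicit hga hg0 hpartial
  refine hψ.congr ?_
  have hc : ContinuousAt (fun x => (x, φ x)) 0 :=
    continuousAt_id.prodMk hφ.self_of_nhds.continuousAt
  filter_upwards [eventually_of_continuousAt hc (by rw [h0]) hu, hzero] with x hx hx'
  exact hx.1 hx'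

end IsGraphIn

/-! ### Divergence of the surface integral below and at the height. -/

theorem lintegral_tangentPlaneDist_eq_top_of_lt {S : Set E3} {x₀ : E3} {p : ℝ} (hp : 0 < p)
    (hlt : ENNReal.ofReal p < surfaceHeight S x₀) {U : Set E3} (hU : U ∈ 𝓝 x₀) :
    ∫⁻ x in S ∩ U, tangentPlaneDist S x₀ x ^ (-1 / p) ∂μHE[2] = ⊤ := by
  simp only [surfaceHeight, lt_iSup_iff] at hlt
  obtain ⟨φ, hφ, hlt⟩ := hlt
  obtain ⟨J, hJ⟩ := hφ.exists_isGraphIn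
  obtain ⟨V, hV, hle⟩ := hJ.exists_lintegral_le hφ.1 hφ.2.1 hφ.2.2.1 hU
  exact top_le_iff.1 ((lintegral_rpow_eq_top_of_lt_height hφ.1 hp hlt hV).ge.trans (hle _))

/-- Finiteness at `1 / p` would, by openness, persist for a slightly larger exponent `r`, and `1 /
r` lies below the height. -/
theorem lintegral_tangentPlaneDist_eq_top_of_eq {S : Set E3} {x₀ : E3}
    (hS : IsHypersurfaceNear ω S x₀) {p : ℝ} (hp : 0 < p)
    (heq : ENNReal.ofReal p = surfaceHeight S x₀) {U : Set E3} (hU : U ∈ 𝓝 x₀) :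
    ∫⁻ x in S ∩ U, tangentPlaneDist S x₀ x ^ (-1 / p) ∂μHE[2] = ⊤ := by
  by_contra hfin
  -- A supremum over no graph representation would be `0`, whereas the height equals `p > 0`.
  obtain ⟨φ, hφ⟩ : ∃ φ, IsGraphRepresentation S x₀ φ := by
    have : 0 < surfaceHeight S x₀ := heq ▸ ENNReal.ofReal_pos.2 hp
    simp only [surfaceHeight, lt_iSup_iff] at this
    exact ⟨this.choose, this.choose_spec.choose⟩
  obtain ⟨J, hJ⟩ := hφ.exists_isGraphIn
  obtain ⟨V, hV, hle⟩ := hJ.exists_lintegral_le hφ.1 hφ.2.1 hφ.2.2.1 hU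
  have hα : 0 < 1 / p := by positivity
  obtain ⟨W, hW, hr⟩ := eventually_lintegral_rpow_lt_top_euclidean
    (hJ.analyticAt hφ.1 hφ.2.1 hφ.2.2.1 hS) hα hV
    (by rw [← neg_div]; exact (hle _).trans_lt (lt_top_iff_ne_top.2 hfin))
  -- Every neighbourhood of `1 / p` contains exponents `r > 1 / p`.
  obtain ⟨r, hr, hpr⟩ := ((hr.filter_mono nhdsWithin_le_nhds).and
    (self_mem_nhdsWithin (s := Ioi (1 / p)))).exists
  have hpr : 1 / p < r := hpr
  have hr0 : 0 < r := hα.trans hpr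
  obtain ⟨U', hU', K, hge⟩ := hJ.exists_lintegral_ge hφ.1 hφ.2.1 hφ.2.2.1 hW
  have hlt : ENNReal.ofReal (1 / r) < surfaceHeight S x₀ := by
    rw [← heq, ENNReal.ofReal_lt_ofReal_iff hp]
    exact (one_div_lt hp hr0).1 hpr
  have htop := lintegral_tangentPlaneDist_eq_top_of_lt (one_div_pos.2 hr0) hlt hU'
  rw [show -1 / (1 / r) = -r by simp] at htop
  have := hge (-r)
  rw [htop, top_le_iff] at this
  exact ENNReal.mul_ne_top (by simp) hr.ne this

end SurfaceHeight

theorem proposition1p8 (S : Set SurfaceHeight.E3) (hS : SurfaceHeight.IsSmoothHypersurface S)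
    (x₀ : SurfaceHeight.E3) (hx₀ : x₀ ∈ S) :
    (∀ p : ℝ, 0 < p → ENNReal.ofReal p < SurfaceHeight.surfaceHeight S x₀ →
      ∀ U ∈ 𝓝 x₀,
        ∫⁻ x in S ∩ U, SurfaceHeight.tangentPlaneDist S x₀ x ^ (-1 / p)
          ∂(Measure.euclideanHausdorffMeasure 2) = ⊤) ∧
    (SurfaceHeight.IsHypersurfaceNear ω S x₀ →
      ∀ p : ℝ, 0 < p → ENNReal.ofReal p = SurfaceHeight.surfaceHeight S x₀ →
        ∀ U ∈ 𝓝 x₀,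
          ∫⁻ x in S ∩ U, SurfaceHeight.tangentPlaneDist S x₀ x ^ (-1 / p)
            ∂(Measure.euclideanHausdorffMeasure 2) = ⊤) :=
  ⟨fun _ hp hlt _ hU => SurfaceHeight.lintegral_tangentPlaneDist_eq_top_of_lt hp hlt hU,
    fun hω _ hp heq _ hU => SurfaceHeight.lintegral_tangentPlaneDist_eq_top_of_eq hω hp heq hU⟩
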